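/- Setting. Let $d,n\ge1$, $1\le p\le\infty$ (with $1/p=0$ for $p=\infty$), $\delta>0$, $\nu,\eta\in\mathbb R$. Let $\psi,\varphi_1,\dots,\varphi_n:\mathbb R^d\to\mathbb C$ be measurable, $|\psi|$ homogeneous of degree $\eta$ and $|\varphi_j|$ homogeneous of degree $\nu$ (with respect to positive dilations), $\psi(t)\ne0$ and $\sum_{j}|\varphi_j(t)|\ne0$ for almost all $t$. Let $F$ be the Fourier transform on the tempered distributions $S'$ of $\mathbb R^d$, normalized by $Fx(\xi)=\int x(t)e^{-i\langle t,\xi\rangle}\,dt$, and put $$X_p=\{x\in S':Fx\in L_p(\mathbb R^d),\ \varphi_jFx\in L_2(\mathbb R^d),\ j=1,\dots,n\},$$ $$D_jx=F^{-1}(\varphi_jFx),\quad \Lambda x=F^{-1}(\psi Fx),\quad W_p^{\mathcal D}=\{x\in X_p:\|D_jx\|_{L_2(\mathbb R^d)}\le1,\ j=1,\dots,n\}.$$ The error of a method (an arbitrary map) $m:L_p(\mathbb R^d)\to L_\infty(\mathbb R^d)$ is $$e(m)=\sup\{\|\Lambda x-m(y)\|_{L_\infty(\mathbb R^d)}:x\in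 W_p^{\mathcal D},\ y\in L_p(\mathbb R^d),\ \|Fx-y\|_{L_p(\mathbb R^d)}\le\delta\},$$ $E_{p\infty}(\Lambda,\mathcal D)=\inf_m e(m)$, and $m$ is optimal if it attains this infimum. Put $s_2(t)=\sum_{j=1}^n|\varphi_j(t)|^2$ and, with $B$ the beta function, $$\gamma_1=\frac{\nu-\eta-d/2}{\nu+d(1/2-1/p)},\qquad q_1=\frac1{1/2+\gamma_1(1/2-1/p)},$$ $$\widetilde C_p(\nu,\eta)=\gamma_1^{-\gamma_1/p}\Bigl(\frac{1-\gamma_1}n\Bigr)^{-\frac{1-\gamma_1}2}\left(\frac{B\left(q_1\gamma_1/p+1,\,q_1(1-\gamma_1)/2\right)}{2|\nu-\eta-d/2|}\right)^{1/q_1}.$$ Let $k(t)=\min\{1,(2\pi)^d|\psi(t)|^{-1}\}$ if $p=1$, $k(t)=\max\{1-s_2(t)|\psi(t)|^{-1},0\}$ if $p=\infty$, and for $1<p<\infty$ let $k(t)\in[0,1)$ be the root of $$\frac{k(t)}{(1-k(t))^{p-1}}=(2\pi)^d\frac{|\psi(t)|^{p-2}}{s_2^{p-1}(t)}.$$ Theorem.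 Let $\gamma_1\in(0,1)$. Assume that $$I=\int_{S^{d-1}}\frac{|\psi(\omega)|^{q_1}}{s_2(\omega)^{q_1(1-\gamma_1)/2}}\,d\sigma(\omega)<\infty$$ and $I'_1=\dots=I'_n$, where $$I'_j=\int_{S^{d-1}}\frac{|\psi(\omega)|^{q_1}|\varphi_j(\omega)|^2}{s_2(\omega)^{q_1(1-\gamma_1)/2+1}}\,d\sigma(\omega),$$ and $\sigma$ is the surface measure on the unit sphere $S^{d-1}$ (counting measure on $\{\pm1\}$ if $d=1$). Then $\Lambda$ maps $X_p$ into $L_\infty(\mathbb R^d)$, and $$E_{p\infty}(\Lambda,\mathcal D)=\frac1{(2\pi)^{d(1+\gamma_1)/2}}\widetilde C_p(\nu,\eta)I^{1/q_1}\delta^{\gamma_1}.$$ The method $$\widehat m(y)=F^{-1}\Bigl(k\bigl(\xi_1^{\frac1{\nu+d(1/2-1/p)}}\,\cdot\,\bigr)\psi(\cdot)\,y(\cdot)\Bigr),$$ $$\xi_1=\delta\,\gamma_1^{-\frac{q_1}{2p}}\Bigl(\frac{1-\gamma_1}n\Bigr)^{\frac{q_1}2(1-\frac1p)}\left(\frac{\widetilde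 C_p(\nu,\eta)I^{1/q_1}}{(2\pi)^{d(1+\gamma_1)/2}}\right)^{q_1(1/2-1/p)},$$ is a well-defined map from $L_p(\mathbb R^d)$ to $L_\infty(\mathbb R^d)$ and is optimal. Moreover, for all $x\in X_p$ the inequality $$\|\Lambda x\|_{L_\infty(\mathbb R^d)}\le\frac1{(2\pi)^{d(1+\gamma_1)/2}}\widetilde C_p(\nu,\eta)I^{1/q_1}\,\|Fx\|_{L_p(\mathbb R^d)}^{\gamma_1}\Bigl(\max_{1\le j\le n}\|D_jx\|_{L_2(\mathbb R^d)}\Bigr)^{1-\gamma_1}$$ holds, and it is sharp: the constant cannot be replaced by a smaller one. -/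

import Mathlib

open MeasureTheory SchwartzMap FourierTransform
open scoped ENNReal

namespace NoisyFourier

noncomputable section

/-- The Euclidean space `ℝᵈ`. -/
abbrev Space (d : ℕ) := EuclideanSpace ℝ (Fin d)

/-! ### The Fourier transform `F x(ξ) = ∫ x(t) exp(-i⟨t, ξ⟩) dt` on `S` and on `S'` -/

/-- The dilation `t ↦ 2πt` of `ℝᵈ`. -/
def dil (d : ℕ) : Space d ≃L[ℝ] Space d :=
  ContinuousLinearEquiv.smulLeft (Units.mk0 (2 * Real.pi) Real.two_pi_pos.ne')

/-- The Fourier transform on Schwartz functions, `(F f)(ξ) = ∫ f(t) exp(-i⟨t, ξ⟩) dt`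
(see `fourierS_apply`). -/
def fourierS (d : ℕ) : 𝓢(Space d, ℂ) →L[ℂ] 𝓢(Space d, ℂ) :=
  (compCLMOfContinuousLinearEquiv ℂ (dil d).symm).comp (fourierCLM ℂ 𝓢(Space d, ℂ))

/-- The inverse Fourier transform on Schwartz functions,
`(F⁻¹ f)(t) = (2π)⁻ᵈ ∫ f(ξ) exp(i⟨ξ, t⟩) dξ` (see `fourierInvS_apply`). -/
def fourierInvS (d : ℕ) : 𝓢(Space d, ℂ) →L[ℂ] 𝓢(Space d, ℂ) :=
  (fourierInvCLM ℂ 𝓢(Space d, ℂ)).comp (compCLMOfContinuousLinearEquiv ℂ (dil d))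

theorem fourierS_apply {d : ℕ} (f : 𝓢(Space d, ℂ)) (ξ : Space d) :
    fourierS d f ξ = ∫ t, Complex.exp (-(inner ℝ t ξ : ℝ) * Complex.I) * f t := by
  have h : fourierS d f ξ = 𝓕 (f : Space d → ℂ) ((dil d).symm ξ) := rfl
  have h2 : (dil d).symm ξ = (2 * Real.pi)⁻¹ • ξ := rfl
  rw [h, Real.fourier_eq', h2]
  refine integral_congr_ae (Filter.Eventually.of_forall fun t => ?_)
  simp only [smul_eq_mul, inner_smul_right]
  congr 3
  have := Real.pi_ne_zero
  push_cast
  field_simp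

theorem fourierInvS_apply {d : ℕ} (f : 𝓢(Space d, ℂ)) (t : Space d) :
    fourierInvS d f t =
      ((2 * Real.pi) ^ d : ℝ)⁻¹ • ∫ ξ, Complex.exp ((inner ℝ ξ t : ℝ) * Complex.I) * f ξ := by
  have h : fourierInvS d f t =
      𝓕⁻ ((compCLMOfContinuousLinearEquiv ℂ (dil d) f : 𝓢(Space d, ℂ)) : Space d → ℂ) t := by
    rw [← fourierInv_coe]; rfl
  have h2 : ∀ v, (dil d) v = (2 * Real.pi) • v := fun _ => rfl
  rw [h, Real.fourierInv_eq']
  have h3 := Measure.integral_comp_smul (volume : Measure (Space d))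
    (fun ξ : Space d => Complex.exp ((inner ℝ ξ t : ℝ) * Complex.I) * f ξ) (2 * Real.pi)
  rw [finrank_euclideanSpace_fin, abs_of_pos (by positivity)] at h3
  rw [← h3]
  refine integral_congr_ae (Filter.Eventually.of_forall fun v => ?_)
  simp [h2, inner_smul_left]

/-- The Fourier transform on tempered distributions, `⟨F x, f⟩ = ⟨x, F f⟩`. -/
def fourierD (d : ℕ) : 𝓢'(Space d, ℂ) →L[ℂ] 𝓢'(Space d, ℂ) :=
  PointwiseConvergenceCLM.precomp ℂ (fourierS d)

/-- The inverse Fourier transform on tempered distributions, `⟨F⁻¹ x, f⟩ = ⟨x, F⁻¹ f⟩`. -/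
def fourierInvD (d : ℕ) : 𝓢'(Space d, ℂ) →L[ℂ] 𝓢'(Space d, ℂ) :=
  PointwiseConvergenceCLM.precomp ℂ (fourierInvS d)

theorem fourierD_fourierInvD {d : ℕ} (x : 𝓢'(Space d, ℂ)) : fourierD d (fourierInvD d x) = x := by
  ext f
  have : fourierInvS d (fourierS d f) = f := by
    have h : compCLMOfContinuousLinearEquiv ℂ (dil d) (fourierS d f) = 𝓕 f := by
      ext v
      change (𝓕 f) ((dil d).symm (dil d v)) = _
      simp
    change 𝓕⁻ (compCLMOfContinuousLinearEquiv ℂ (dil d) (fourierS d f)) = f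
    rw [h]; simp
  change x (fourierInvS d (fourierS d f)) = x f
  rw [this]

theorem fourierInvD_fourierD {d : ℕ} (x : 𝓢'(Space d, ℂ)) : fourierInvD d (fourierD d x) = x := by
  ext f
  have : fourierS d (fourierInvS d f) = f := by
    change compCLMOfContinuousLinearEquiv ℂ (dil d).symm
      (𝓕 (𝓕⁻ (compCLMOfContinuousLinearEquiv ℂ (dil d) f))) = f
    ext v
    simp
  change x (fourierS d (fourierInvS d f)) = x f
  rw [this]

/-! ### Functions as tempered distributions -/

/-- The tempered distribution `u` is (integration against) the function `g`. -/
def IsFun {d : ℕ} (u : 𝓢'(Space d, ℂ)) (g : Space d → ℂ) : Prop :=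
  AEStronglyMeasurable g volume ∧
    ∀ f : 𝓢(Space d, ℂ), Integrable (fun t => f t * g t) ∧ u f = ∫ t, f t * g t

/-- The function `g` defines a tempered distribution by integration. -/
def IsTempered {d : ℕ} (g : Space d → ℂ) : Prop := ∃ u, IsFun u g

open Classical in
/-- The tempered distribution defined by the function `g` (only meaningful if `IsTempered g`). -/
def ofFun {d : ℕ} (g : Space d → ℂ) : 𝓢'(Space d, ℂ) :=
  if h : IsTempered g then h.choose else 0

open Classical in
/-- The function representing the tempered distribution `u`, which is unique up to null sets
(only meaningful if there is one). -/
def toFun {d : ℕ} (u : 𝓢'(Space d, ℂ)) : Space d → ℂ :=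
  if h : ∃ g, IsFun u g then h.choose else 0

theorem isFun_ofFun {d : ℕ} {g : Space d → ℂ} (h : IsTempered g) : IsFun (ofFun g) g := by
  rw [ofFun, dif_pos h]; exact h.choose_spec

theorem isFun_toFun {d : ℕ} {u : 𝓢'(Space d, ℂ)} (h : ∃ g, IsFun u g) : IsFun u (toFun u) := by
  rw [toFun, dif_pos h]; exact h.choose_spec

/-- The `L_q(ℝᵈ)`-norm of a tempered distribution; it is `∞` if the distribution is not a
function. -/
def distNorm {d : ℕ} (q : ℝ≥0∞) (u : 𝓢'(Space d, ℂ)) : ℝ≥0∞ :=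
  ⨅ (g : Space d → ℂ) (_ : IsFun u g), eLpNorm g q volume

/-- The operator `x ↦ F⁻¹(a · F x)` with symbol `a`. -/
def multOp {d : ℕ} (a : Space d → ℂ) (x : 𝓢'(Space d, ℂ)) : 𝓢'(Space d, ℂ) :=
  fourierInvD d (ofFun fun ξ => a ξ * toFun (fourierD d x) ξ)

/-! ### The recovery problem -/

/-- `X_p = {x ∈ S' : F x ∈ L_p(ℝᵈ), φ_j F x ∈ L_2(ℝᵈ) for all j}`. -/
def classX {d n : ℕ} (p : ℝ≥0∞) (φ : Fin n → Space d → ℂ) : Set 𝓢'(Space d, ℂ) :=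
  {x | (∃ g, IsFun (fourierD d x) g) ∧ MemLp (toFun (fourierD d x)) p ∧
    ∀ j, MemLp (fun ξ => φ j ξ * toFun (fourierD d x) ξ) 2}

/-- `W_p = {x ∈ X_p : ‖D_j x‖_{L_2} ≤ 1 for all j}`, where `D_j` has symbol `φ_j`. -/
def classW {d n : ℕ} (p : ℝ≥0∞) (φ : Fin n → Space d → ℂ) : Set 𝓢'(Space d, ℂ) :=
  {x ∈ classX p φ | ∀ j, distNorm 2 (multOp (φ j) x) ≤ 1}

/-- A recovery method: an arbitrary map `L_p(ℝᵈ) → L_q(ℝᵈ)`. -/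
abbrev Method (d : ℕ) (p q : ℝ≥0∞) :=
  Lp ℂ p (volume : Measure (Space d)) → Lp ℂ q (volume : Measure (Space d))

/-- The error of the method `m`: the supremum of `‖Λ x - m(y)‖_{L_q}` over `x ∈ W_p` and
`y ∈ L_p` with `‖F x - y‖_{L_p} ≤ δ`, where `Λ` has symbol `ψ`. -/
def methodError {d n : ℕ} (p q : ℝ≥0∞) (ψ : Space d → ℂ) (φ : Fin n → Space d → ℂ) (δ : ℝ)
    (m : Method d p q) : ℝ≥0∞ :=
  ⨆ (x : 𝓢'(Space d, ℂ)) (_ : x ∈ classW p φ) (y : Lp ℂ p (volume : Measure (Space d)))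
    (_ : eLpNorm (fun ξ => toFun (fourierD d x) ξ - y ξ) p volume ≤ ENNReal.ofReal δ),
    distNorm q (multOp ψ x - ofFun (m y))

/-- The error of optimal recovery. -/
def optimalError {d n : ℕ} (p q : ℝ≥0∞) (ψ : Space d → ℂ) (φ : Fin n → Space d → ℂ) (δ : ℝ) :
    ℝ≥0∞ :=
  ⨅ m : Method d p q, methodError p q ψ φ δ m

/-- A method is optimal if it attains the error of optimal recovery. -/
def IsOptimal {d n : ℕ} (p q : ℝ≥0∞) (ψ : Space d → ℂ) (φ : Fin n → Space d → ℂ) (δ : ℝ)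
    (m : Method d p q) : Prop :=
  methodError p q ψ φ δ m = optimalError p q ψ φ δ

/-! ### Weights, exponents and constants -/

/-- `|a|` is homogeneous of degree `κ`. -/
def AbsHomogeneous {d : ℕ} (a : Space d → ℂ) (κ : ℝ) : Prop :=
  ∀ t : Space d, t ≠ 0 → ∀ c : ℝ, 0 < c → ‖a (c • t)‖ = c ^ κ * ‖a t‖

/-- `s₂(t) = ∑_j |φ_j(t)|²`. -/
def s2 {d n : ℕ} (φ : Fin n → Space d → ℂ) (t : Space d) : ℝ := ∑ j, ‖φ j t‖ ^ 2

/-- The real number `1/p`, equal to `0` for `p = ∞`. -/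
def recip (p : ℝ≥0∞) : ℝ := (p⁻¹).toReal

/-- `γ₁ = (ν - η - d/2) / (ν + d(1/2 - 1/p))`. -/
def gamma1 (d : ℕ) (p : ℝ≥0∞) (ν η : ℝ) : ℝ :=
  (ν - η - d / 2) / (ν + d * (1 / 2 - recip p))

/-- `q₁ = 1 / (1/2 + γ₁(1/2 - 1/p))`. -/
def q1 (d : ℕ) (p : ℝ≥0∞) (ν η : ℝ) : ℝ :=
  1 / (1 / 2 + gamma1 d p ν η * (1 / 2 - recip p))

/-- The constant `C̃_p(ν, η)`. -/
def constC (d n : ℕ) (p : ℝ≥0∞) (ν η : ℝ) : ℝ :=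
  let γ := gamma1 d p ν η
  let q := q1 d p ν η
  γ ^ (-(γ * recip p)) * ((1 - γ) / n) ^ (-((1 - γ) / 2)) *
    (ProbabilityTheory.beta (q * γ * recip p + 1) (q * (1 - γ) / 2) /
      (2 * |ν - η - d / 2|)) ^ (1 / q)

/-- The surface measure on the unit sphere `S^{d-1}`, written `J(ω) dω` in the angular
coordinates `ω` of the polar transformation. -/
def sphereMeasure (d : ℕ) : Measure (Metric.sphere (0 : Space d) 1) :=
  (volume : Measure (Space d)).toSphere

/-- The integrand `|ψ|^{q₁} / s₂^{q₁(1-γ₁)/2}` of the angular integral `I`. -/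
def angIntegrand {d n : ℕ} (p : ℝ≥0∞) (ν η : ℝ) (ψ : Space d → ℂ) (φ : Fin n → Space d → ℂ)
    (ω : Metric.sphere (0 : Space d) 1) : ℝ :=
  ‖ψ ω‖ ^ q1 d p ν η / s2 φ ω ^ (q1 d p ν η * (1 - gamma1 d p ν η) / 2)

/-- The angular integral `I`. -/
def angI {d n : ℕ} (p : ℝ≥0∞) (ν η : ℝ) (ψ : Space d → ℂ) (φ : Fin n → Space d → ℂ) : ℝ :=
  ∫ ω, angIntegrand p ν η ψ φ ω ∂sphereMeasure d

/-- The angular integral `I'_j`. -/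
def angI' {d n : ℕ} (p : ℝ≥0∞) (ν η : ℝ) (ψ : Space d → ℂ) (φ : Fin n → Space d → ℂ)
    (j : Fin n) : ℝ :=
  ∫ ω : Metric.sphere (0 : Space d) 1,
    ‖ψ ω‖ ^ q1 d p ν η * ‖φ j ω‖ ^ 2 /
      s2 φ ω ^ (q1 d p ν η * (1 - gamma1 d p ν η) / 2 + 1) ∂sphereMeasure d

/-- The sharp constant `(2π)^{-d(1+γ₁)/2} C̃_p(ν, η) I^{1/q₁}`. -/
def sharpConst {d n : ℕ} (p : ℝ≥0∞) (ν η : ℝ) (ψ : Space d → ℂ) (φ : Fin n → Space d → ℂ) : ℝ :=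
  (2 * Real.pi) ^ (-(d * (1 + gamma1 d p ν η) / 2)) * constC d n p ν η *
    angI p ν η ψ φ ^ (1 / q1 d p ν η)

/-- For `r > 0` and `R ≥ 0` the equation `k / (1 - k) ^ r = R` has exactly one root in `[0, 1)`. -/
theorem existsUnique_root {r R : ℝ} (hr : 0 < r) (hR : 0 ≤ R) :
    ∃! k : ℝ, k ∈ Set.Ico 0 1 ∧ k / (1 - k) ^ r = R := by
  have key : ∀ k ∈ Set.Ico (0 : ℝ) 1, (k / (1 - k) ^ r = R ↔ k = R * (1 - k) ^ r) := by
    intro k hk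
    have : 0 < (1 - k) ^ r := Real.rpow_pos_of_pos (by linarith [hk.2]) r
    rw [div_eq_iff this.ne']
  have hc : ContinuousOn (fun k : ℝ => k - R * (1 - k) ^ r) (Set.Icc 0 1) :=
    (continuous_id.sub (continuous_const.mul
      ((continuous_const.sub continuous_id).rpow_const fun _ => Or.inr hr.le))).continuousOn
  obtain ⟨k, hk, hk0⟩ := intermediate_value_Icc (zero_le_one' ℝ) hc
    (show (0 : ℝ) ∈ Set.Icc _ _ by simp [Real.zero_rpow hr.ne', hR])
  have hk0' : k = R * (1 - k) ^ r := by simpa [sub_eq_zero] using hk0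
  have hk1 : k < 1 := by
    refine lt_of_le_of_ne hk.2 fun h => ?_
    rw [h] at hk0'
    simp [Real.zero_rpow hr.ne'] at hk0'
  refine ⟨k, ⟨⟨hk.1, hk1⟩, (key k ⟨hk.1, hk1⟩).2 hk0'⟩, ?_⟩
  rintro l ⟨hl, hl0⟩
  have hl0' := (key l hl).1 hl0
  rcases lt_trichotomy l k with h | h | h
  · have := Real.rpow_le_rpow (by linarith) (by linarith : 1 - k ≤ 1 - l) hr.le
    nlinarith
  · exact h
  · have := Real.rpow_le_rpow (by linarith [hl.2]) (by linarith : 1 - l ≤ 1 - k) hr.le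
    nlinarith

open Classical in
/-- The function `k`. For `1 < p < ∞` it is the root `k ∈ [0, 1)` of
`k / (1 - k)^{p-1} = (2π)^d |ψ|^{p-2} / s₂^{p-1}`, which exists and is unique by
`existsUnique_root`; for `p = 1` it is `min {1, (2π)^d |ψ|⁻¹}`, and for `p = ∞` it is
`(1 - s₂ |ψ|⁻¹)₊`. -/
def kFun {d n : ℕ} (p : ℝ≥0∞) (ψ : Space d → ℂ) (φ : Fin n → Space d → ℂ) (t : Space d) : ℝ :=
  if p = ∞ then max (1 - s2 φ t / ‖ψ t‖) 0
  else if p = 1 then min 1 ((2 * Real.pi) ^ d / ‖ψ t‖)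
  else if h : ∃ k : ℝ, k ∈ Set.Ico 0 1 ∧ k / (1 - k) ^ (p.toReal - 1) =
      (2 * Real.pi) ^ d * ‖ψ t‖ ^ (p.toReal - 2) / s2 φ t ^ (p.toReal - 1)
    then h.choose else 0

/-- The parameter `ξ₁`. -/
def xi1 {d n : ℕ} (p : ℝ≥0∞) (ν η δ : ℝ) (ψ : Space d → ℂ) (φ : Fin n → Space d → ℂ) : ℝ :=
  let γ := gamma1 d p ν η
  let q := q1 d p ν η
  δ * γ ^ (-(q * recip p / 2)) * ((1 - γ) / n) ^ (q * (1 - recip p) / 2) *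
    sharpConst p ν η ψ φ ^ (q * (1 / 2 - recip p))

/-- The multiplier `t ↦ k(ξ₁^{1/(ν + d(1/2 - 1/p))} t) ψ(t)` of the optimal method. -/
def optMultiplier {d n : ℕ} (p : ℝ≥0∞) (ν η δ : ℝ) (ψ : Space d → ℂ) (φ : Fin n → Space d → ℂ)
    (t : Space d) : ℂ :=
  (kFun p ψ φ (xi1 p ν η δ ψ φ ^ (1 / (ν + d * (1 / 2 - recip p))) • t) : ℂ) * ψ t

end

end NoisyFourier

namespace NoisyFourier

/-! ### Dilations -/

/-! Write `g = Fx`. Plancherel gives `‖D_j x‖₂ = (2π)^{-d/2} ‖φ_j g‖₂`, and `‖Λx‖_∞ ≤ (2π)^{-d} ‖ψ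
g‖₁`, with equality, attained at the origin, when `ψ g ≥ 0`. This turns the problem into
inequalities between functions (`recovery_of_bounds`).

Upper bound (`eLpNorm_sub_scaledMultiplier_le`). With `κ = k(c·)ψ` one has `ψ g - κ y = κ (g - y) +
(1 - k(c·)) ψ g`. Hölder bounds the first term by `‖κ‖_{p'} ‖g - y‖_p`, the second by `‖(1 - k(c·))
ψ / √s₂‖₂ ‖√s₂ g‖₂`. For `c = s^{1/(ν + d(1/2 - 1/p))}` the two multiplier norms are at most
`s^{-(1-γ)} A` and `s^γ B` by homogeneity, and minimizing over `s` gives the sharp constant. The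
case `y = 0` is the inequality for `Λ`.

Lower bound (`isExtremal_extremalFun`). Let `f = (1 - k)|ψ| / s₂`. For `1 < p < ∞` the equation
defining `k` says `k|ψ| = (2π)^d f^{p-1}`, so a multiple of a dilate of `f`, with the phase of `ψ̄`,
gives equality in both Hölder steps. Equality of the `I'_j` makes all `‖φ_j g‖₂` agree, so nothing
is lost in passing from `s₂` to the single `φ_j`. The resulting `x` and `-x` are both compatible
with `y = 0`, and no method can do better than `‖Λx‖_∞`.

Constants (`lintegral_weighted`). All norms reduce to integrals of `1 - k` and `(1 - k)²` against `w
= |ψ|² / s₂`. The function `k` is not homogeneous, but `{k < u} = {ρ < Θ(u)}` with `ρ` homogeneous.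
Layer cake and polar coordinates then give a beta function times `I`. The recursion of the beta
function gives the values `J`, `(1 - γ)J`, and hence `γJ` for `k(1 - k)`. The rest is an identity
between exponents, checked on logarithms. -/

theorem quasiMeasurePreserving_smul {d : ℕ} {c : ℝ} (hc : c ≠ 0) :
    Measure.QuasiMeasurePreserving (fun t : Space d => c • t) volume volume := by
  refine ⟨measurable_const_smul c, ?_⟩
  rw [Measure.map_addHaar_smul _ hc]
  exact Measure.smul_absolutelyContinuous

theorem map_smul_volume {d : ℕ} {c : ℝ} (hc : 0 < c) :
    Measure.map (fun t : Space d => c • t) volume =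
      ENNReal.ofReal (c ^ (-(d : ℝ))) • (volume : Measure (Space d)) := by
  rw [Measure.map_addHaar_smul _ hc.ne', finrank_euclideanSpace_fin, abs_of_pos (by positivity),
    Real.rpow_neg hc.le, Real.rpow_natCast]

theorem eLpNorm_comp_smul {d : ℕ} {c : ℝ} (hc : 0 < c) {p : ℝ≥0∞} {f : Space d → ℂ}
    (hf : AEStronglyMeasurable f volume) :
    eLpNorm (fun t => f (c • t)) p volume =
      ENNReal.ofReal (c ^ (-(d * recip p))) * eLpNorm f p volume := by
  have h : AEStronglyMeasurable f (Measure.map (fun t : Space d => c • t) volume) := by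
    rw [map_smul_volume hc]; exact hf.smul_measure _
  have h2 := eLpNorm_map_measure (p := p) h (measurable_const_smul c).aemeasurable
  have h3 : (f ∘ fun t : Space d => c • t) = fun t => f (c • t) := rfl
  rw [h3] at h2
  rw [← h2, map_smul_volume hc, eLpNorm_smul_measure_of_ne_zero, smul_eq_mul,
    ENNReal.ofReal_rpow_of_pos (by positivity), ← Real.rpow_mul hc.le]
  · congr 3
    simp [recip]
  · simp only [ne_eq, ENNReal.ofReal_eq_zero, not_le]; positivity

/-! ### Tempered distributions given by functions -/

theorem IsFun.congr {d : ℕ} {u : 𝓢'(Space d, ℂ)} {g g' : Space d → ℂ} (h : IsFun u g)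
    (hg : g =ᵐ[volume] g') : IsFun u g' := by
  refine ⟨h.1.congr hg, fun f => ?_⟩
  have hae : (fun t => f t * g t) =ᵐ[volume] fun t => f t * g' t := by
    filter_upwards [hg] with t ht
    rw [ht]
  exact ⟨(h.2 f).1.congr hae, (h.2 f).2.trans (integral_congr_ae hae)⟩

theorem IsFun.add {d : ℕ} {u v : 𝓢'(Space d, ℂ)} {g g' : Space d → ℂ} (h : IsFun u g)
    (h' : IsFun v g') : IsFun (u + v) (fun t => g t + g' t) := by
  refine ⟨h.1.add h'.1, fun f => ?_⟩
  simp only [mul_add]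
  refine ⟨(h.2 f).1.add (h'.2 f).1, ?_⟩
  rw [integral_add (h.2 f).1 (h'.2 f).1, ← (h.2 f).2, ← (h'.2 f).2]
  rfl

theorem IsFun.neg {d : ℕ} {u : 𝓢'(Space d, ℂ)} {g : Space d → ℂ} (h : IsFun u g) :
    IsFun (-u) (fun t => -g t) := by
  refine ⟨h.1.neg, fun f => ?_⟩
  simp only [mul_neg]
  refine ⟨(h.2 f).1.neg, ?_⟩
  rw [integral_neg, ← (h.2 f).2]
  rfl

theorem IsFun.sub {d : ℕ} {u v : 𝓢'(Space d, ℂ)} {g g' : Space d → ℂ} (h : IsFun u g)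
    (h' : IsFun v g') : IsFun (u - v) (fun t => g t - g' t) := by
  simpa [sub_eq_add_neg] using h.add h'.neg

/-- A smooth bump equal to 1 on a ball containing the compact set is a Schwartz function, and its
product with `g` is integrable. -/
theorem IsFun.locallyIntegrable {d : ℕ} {u : 𝓢'(Space d, ℂ)} {g : Space d → ℂ}
    (h : IsFun u g) : LocallyIntegrable g volume := by
  rw [locallyIntegrable_iff]
  intro K hK
  obtain ⟨R, hR0, hR⟩ := hK.isBounded.subset_closedBall_lt 0 0
  let b : ContDiffBump (0 : Space d) := ⟨R, R + 1, hR0, by linarith⟩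
  have hc : HasCompactSupport (Complex.ofRealCLM ∘ b) := b.hasCompactSupport.comp_left rfl
  have hs : ContDiff ℝ ((⊤ : ℕ∞) : WithTop ℕ∞) (Complex.ofRealCLM ∘ b) :=
    Complex.ofRealCLM.contDiff.comp b.contDiff
  have := (h.2 (hc.toSchwartzMap hs)).1.integrableOn (s := K)
  refine this.congr_fun_ae ?_
  filter_upwards [ae_restrict_mem hK.measurableSet] with t ht
  have : b t = 1 := b.one_of_mem_closedBall (hR ht)
  simp [this]

/-- The fundamental lemma of the calculus of variations. It makes the arbitrary choices in `toFun`
and `ofFun`, and the infimum in `distNorm`, harmless. -/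
theorem IsFun.ae_eq {d : ℕ} {u : 𝓢'(Space d, ℂ)} {g g' : Space d → ℂ} (h : IsFun u g)
    (h' : IsFun u g') : g =ᵐ[volume] g' := by
  refine ae_eq_of_integral_contDiff_smul_eq h.locallyIntegrable h'.locallyIntegrable
    fun b hb hb' => ?_
  have hc : HasCompactSupport (Complex.ofRealCLM ∘ b) := hb'.comp_left rfl
  have hs : ContDiff ℝ ((⊤ : ℕ∞) : WithTop ℕ∞) (Complex.ofRealCLM ∘ b) :=
    Complex.ofRealCLM.contDiff.comp hb
  have := (h.2 (hc.toSchwartzMap hs)).2.symm.trans (h'.2 (hc.toSchwartzMap hs)).2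
  simpa using this

theorem IsFun.unique {d : ℕ} {u v : 𝓢'(Space d, ℂ)} {g : Space d → ℂ} (h : IsFun u g)
    (h' : IsFun v g) : u = v := by
  ext f
  rw [(h.2 f).2, (h'.2 f).2]

theorem IsFun.ofFun_eq {d : ℕ} {u : 𝓢'(Space d, ℂ)} {g : Space d → ℂ} (h : IsFun u g) :
    ofFun g = u := (isFun_ofFun ⟨u, h⟩).unique h

theorem IsFun.toFun_ae_eq {d : ℕ} {u : 𝓢'(Space d, ℂ)} {g : Space d → ℂ} (h : IsFun u g) :
    toFun u =ᵐ[volume] g := (isFun_toFun ⟨g, h⟩).ae_eq h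

theorem IsFun.distNorm_eq {d : ℕ} {u : 𝓢'(Space d, ℂ)} {g : Space d → ℂ} (h : IsFun u g)
    (q : ℝ≥0∞) : distNorm q u = eLpNorm g q volume := by
  refine le_antisymm (iInf₂_le g h) (le_iInf₂ fun g' h' => ?_)
  exact (eLpNorm_congr_ae (h.ae_eq h')).le

/-- Schwartz functions lie in the conjugate Lebesgue space, so Hölder gives the integrability. -/
theorem isFun_toTemperedDistribution {d : ℕ} {p : ℝ≥0∞} [hp : Fact (1 ≤ p)]
    (g : Lp ℂ p (volume : Measure (Space d))) :
    IsFun (Lp.toTemperedDistribution g) g := by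
  refine ⟨Lp.aestronglyMeasurable g, fun f => ⟨?_, by simp⟩⟩
  have := ENNReal.HolderConjugate.inv_one_sub_inv' hp.out
  exact (Lp.memLp g).integrable_mul (f.memLp (1 - p⁻¹)⁻¹) |>.congr (by
    filter_upwards with t; simp [mul_comm])

theorem isTempered_of_memLp {d : ℕ} {p : ℝ≥0∞} (hp : 1 ≤ p) {g : Space d → ℂ}
    (hg : MemLp g p volume) : IsTempered g := by
  have : Fact (1 ≤ p) := ⟨hp⟩
  exact ⟨_, (isFun_toTemperedDistribution (hg.toLp g)).congr hg.coeFn_toLp⟩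

/-! ### The inverse Fourier transform of an integrable function -/

/-- The inverse Fourier transform of a function. -/
noncomputable def invFourier {d : ℕ} (h : Space d → ℂ) (t : Space d) : ℂ :=
  ((2 * Real.pi) ^ d : ℝ)⁻¹ • ∫ ξ, Complex.exp ((inner ℝ ξ t : ℝ) * Complex.I) * h ξ

theorem enorm_invFourier_le {d : ℕ} (h : Space d → ℂ) (t : Space d) :
    ‖invFourier h t‖ₑ ≤ ENNReal.ofReal ((2 * Real.pi) ^ (-(d : ℝ))) * eLpNorm h 1 volume := by
  rw [invFourier, enorm_smul, eLpNorm_one_eq_lintegral_enorm]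
  gcongr
  · rw [Real.enorm_eq_ofReal (by positivity), Real.rpow_neg (by positivity), Real.rpow_natCast]
  · refine (enorm_integral_le_lintegral_enorm _).trans (lintegral_mono fun ξ => ?_)
    rw [enorm_mul, ← ofReal_norm, Complex.norm_exp_ofReal_mul_I]
    simp

theorem continuous_invFourier {d : ℕ} {h : Space d → ℂ} (hh : Integrable h) :
    Continuous (invFourier h) := by
  have : Continuous fun t : Space d =>
      ∫ ξ, Complex.exp ((inner ℝ ξ t : ℝ) * Complex.I) * h ξ := by
    refine continuous_of_dominated (bound := fun ξ => ‖h ξ‖) ?_ ?_ hh.norm ?_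
    · intro t
      refine AEStronglyMeasurable.mul ?_ hh.1
      exact Continuous.aestronglyMeasurable (by fun_prop)
    · intro t
      filter_upwards with ξ
      rw [norm_mul, Complex.norm_exp_ofReal_mul_I, one_mul]
    · filter_upwards with ξ
      fun_prop
  exact this.const_smul (((2 * Real.pi) ^ d : ℝ)⁻¹)

theorem eLpNorm_invFourier_le {d : ℕ} (h : Space d → ℂ) :
    eLpNorm (invFourier h) ∞ volume ≤
      ENNReal.ofReal ((2 * Real.pi) ^ (-(d : ℝ))) * eLpNorm h 1 volume := by
  rw [eLpNorm_exponent_top]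
  exact eLpNormEssSup_le_of_ae_enorm_bound (Filter.Eventually.of_forall (enorm_invFourier_le h))

/-- The set where a continuous function exceeds its essential supremum is open and null, hence
empty. The lower bounds use this to pass from a value at the origin to the `L_∞` norm. -/
theorem enorm_le_eLpNorm_top {d : ℕ} {f : Space d → ℂ} (hf : Continuous f) (t : Space d) :
    ‖f t‖ₑ ≤ eLpNorm f ∞ volume := by
  by_contra! hlt
  have ho : IsOpen {s | eLpNorm f ∞ volume < ‖f s‖ₑ} := isOpen_lt continuous_const hf.enorm
  refine (ho.measure_ne_zero volume ⟨t, hlt⟩) ?_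
  rw [eLpNorm_exponent_top]
  have := ae_le_eLpNormEssSup (f := f) (μ := volume)
  rw [ae_iff] at this
  simpa using this

/-- Fubini against a Schwartz function; the exponential kernel has modulus 1, so integrability on
the product is that of `h ⊗ f`. -/
theorem isFun_fourierInvD_of_integrable {d : ℕ} {h : Space d → ℂ} (hh : Integrable h) :
    IsFun (fourierInvD d (ofFun h)) (invFourier h) := by
  have hF := isFun_ofFun (isTempered_of_memLp le_rfl (memLp_one_iff_integrable.2 hh))
  refine ⟨(continuous_invFourier hh).aestronglyMeasurable, fun f => ⟨?_, ?_⟩⟩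
  · refine (f.integrable (μ := volume)).mul_bdd (continuous_invFourier hh).aestronglyMeasurable
      (c := (ENNReal.ofReal ((2 * Real.pi) ^ (-(d : ℝ))) * eLpNorm h 1 volume).toReal) ?_
    filter_upwards with t
    rw [← toReal_enorm]
    refine ENNReal.toReal_mono ?_ (enorm_invFourier_le h t)
    exact ENNReal.mul_ne_top (by simp) (memLp_one_iff_integrable.2 hh).2.ne
  · have h1 : fourierInvD d (ofFun h) f = ofFun h (fourierInvS d f) := rfl
    rw [h1, (hF.2 _).2]
    have hint : Integrable (fun z : Space d × Space d =>
        Complex.exp ((inner ℝ z.1 z.2 : ℝ) * Complex.I) * (h z.1 * f z.2))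
        (volume.prod volume) := by
      refine ((hh.mul_prod (f.integrable (μ := volume)))).bdd_mul (c := 1) ?_ ?_
      · exact Continuous.aestronglyMeasurable (by fun_prop)
      · filter_upwards with z
        rw [Complex.norm_exp_ofReal_mul_I]
    calc ∫ ξ, fourierInvS d f ξ * h ξ
        = ∫ ξ, ∫ t, ((2 * Real.pi) ^ d : ℝ)⁻¹ •
            (Complex.exp ((inner ℝ ξ t : ℝ) * Complex.I) * (h ξ * f t)) := by
          refine integral_congr_ae (Filter.Eventually.of_forall fun ξ => ?_)
          simp only [fourierInvS_apply]
          rw [integral_smul, smul_mul_assoc, ← integral_mul_const]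
          congr 1
          refine integral_congr_ae (Filter.Eventually.of_forall fun t => ?_)
          simp only [real_inner_comm]
          ring
      _ = ∫ t, ∫ ξ, ((2 * Real.pi) ^ d : ℝ)⁻¹ •
            (Complex.exp ((inner ℝ ξ t : ℝ) * Complex.I) * (h ξ * f t)) :=
          integral_integral_swap (hint.smul (((2 * Real.pi) ^ d : ℝ)⁻¹))
      _ = ∫ t, f t * invFourier h t := by
          refine integral_congr_ae (Filter.Eventually.of_forall fun t => ?_)
          simp only [invFourier]
          rw [integral_smul, mul_smul_comm, ← integral_const_mul]
          congr 1
          refine integral_congr_ae (Filter.Eventually.of_forall fun ξ => ?_)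
          simp only
          ring

/-! ### Plancherel's theorem -/

/-- Plancherel holds without a constant for the kernel `exp(2πi⟨ξ, t⟩)`. Passing to the present
kernel costs `(2π)^{-d}` from the normalization and `(2π)^{d/2}` from the `L₂` norm of a dilation.
-/
theorem distNorm_two_fourierInvD {d : ℕ} {h : Space d → ℂ} (hh : MemLp h 2 volume) :
    distNorm 2 (fourierInvD d (ofFun h)) =
      ENNReal.ofReal ((2 * Real.pi) ^ (-(d / 2 : ℝ))) * eLpNorm h 2 volume := by
  have h2pi : (0 : ℝ) < (2 * Real.pi)⁻¹ := by positivity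
  have hF : ofFun h = Lp.toTemperedDistribution (hh.toLp h) :=
    ((isFun_toTemperedDistribution (hh.toLp h)).congr hh.coeFn_toLp).ofFun_eq
  set w : Lp ℂ 2 (volume : Measure (Space d)) := 𝓕⁻ (hh.toLp h) with hw
  have hwF := isFun_toTemperedDistribution w
  have hwm := Lp.aestronglyMeasurable w
  -- The change of variables `ξ ↦ 2πξ` turns the unitary inverse transform `w` into this function.
  set H : Space d → ℂ := fun t => ((2 * Real.pi) ^ d : ℝ)⁻¹ • w ((2 * Real.pi)⁻¹ • t) with hH
  have hHF : IsFun (fourierInvD d (ofFun h)) H := by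
    refine ⟨(hwm.comp_quasiMeasurePreserving
      (quasiMeasurePreserving_smul h2pi.ne')).const_smul (((2 * Real.pi) ^ d : ℝ)⁻¹), fun f => ?_⟩
    have h1 : fourierInvD d (ofFun h) f =
        Lp.toTemperedDistribution w (compCLMOfContinuousLinearEquiv ℂ (dil d) f) := by
      rw [hw, ← Lp.fourierInv_toTemperedDistribution_eq, hF]
      rfl
    have h2 := hwF.2 (compCLMOfContinuousLinearEquiv ℂ (dil d) f)
    have h3 : ∀ t, (compCLMOfContinuousLinearEquiv ℂ (dil d) f) t = f ((2 * Real.pi) • t) :=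
      fun _ => rfl
    have h4 : ∀ t : Space d, (2 * Real.pi) • (2 * Real.pi)⁻¹ • t = t := fun t => by
      rw [smul_smul, mul_inv_cancel₀ (by positivity), one_smul]
    have h5 : (fun t => f t * H t) = fun t => ((2 * Real.pi) ^ d : ℝ)⁻¹ •
        (fun s => f ((2 * Real.pi) • s) * w s) ((2 * Real.pi)⁻¹ • t) := by
      funext t
      simp only [hH, h4, mul_smul_comm]
    rw [h1, h2.2, h5, integral_smul, Measure.integral_comp_inv_smul volume
      (fun s : Space d => f ((2 * Real.pi) • s) * w s), finrank_euclideanSpace_fin,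
      smul_smul, abs_of_pos (by positivity), inv_mul_cancel₀ (by positivity), one_smul]
    refine ⟨?_, rfl⟩
    exact (h2.1.comp_smul h2pi.ne').smul (((2 * Real.pi) ^ d : ℝ)⁻¹)
  have hsm : H = ((2 * Real.pi) ^ d : ℝ)⁻¹ • fun t => w ((2 * Real.pi)⁻¹ • t) := rfl
  rw [hHF.distNorm_eq, hsm, eLpNorm_const_smul, eLpNorm_comp_smul h2pi hwm,
    Real.enorm_eq_ofReal (by positivity), ← mul_assoc, ← ENNReal.ofReal_mul (by positivity)]
  congr 1
  · congr 1
    rw [Real.inv_rpow (by positivity), ← Real.rpow_neg (by positivity), ← Real.rpow_natCast,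
      ← Real.rpow_neg (by positivity), ← Real.rpow_add (by positivity)]
    congr 1
    simp [recip]
    ring
  · have : ‖w‖ = ‖hh.toLp h‖ := by
      rw [← Lp.norm_fourier_eq w, hw]; simp
    rw [Lp.norm_def, Lp.norm_def, ENNReal.toReal_eq_toReal_iff' (Lp.memLp _).2.ne (Lp.memLp _).2.ne]
      at this
    rw [this, eLpNorm_congr_ae hh.coeFn_toLp]

/-! ### Reduction of the recovery problem to inequalities for functions -/

theorem multOp_eq {d : ℕ} {x : 𝓢'(Space d, ℂ)} {g : Space d → ℂ} (hx : IsFun (fourierD d x) g)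
    (a : Space d → ℂ) (ht : IsTempered fun ξ => a ξ * g ξ) :
    multOp a x = fourierInvD d (ofFun fun ξ => a ξ * g ξ) := by
  have hae : (fun ξ => a ξ * g ξ) =ᵐ[volume] fun ξ => a ξ * toFun (fourierD d x) ξ := by
    filter_upwards [hx.toFun_ae_eq] with ξ h
    rw [h]
  rw [multOp, ((isFun_ofFun ht).congr hae).ofFun_eq]

theorem distNorm_multOp_two {d : ℕ} {x : 𝓢'(Space d, ℂ)} {g : Space d → ℂ}
    (hx : IsFun (fourierD d x) g) {a : Space d → ℂ} (ha : MemLp (fun ξ => a ξ * g ξ) 2 volume) :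
    distNorm 2 (multOp a x) =
      ENNReal.ofReal ((2 * Real.pi) ^ (-(d / 2 : ℝ))) * eLpNorm (fun ξ => a ξ * g ξ) 2 volume := by
  rw [multOp_eq hx a (isTempered_of_memLp one_le_two ha), distNorm_two_fourierInvD ha]

theorem isFun_multOp {d : ℕ} {x : 𝓢'(Space d, ℂ)} {g : Space d → ℂ}
    (hx : IsFun (fourierD d x) g) {a : Space d → ℂ} (ha : Integrable fun ξ => a ξ * g ξ) :
    IsFun (multOp a x) (invFourier fun ξ => a ξ * g ξ) := by
  rw [multOp_eq hx a (isTempered_of_memLp le_rfl (memLp_one_iff_integrable.2 ha))]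
  exact isFun_fourierInvD_of_integrable ha

theorem invFourier_sub {d : ℕ} {f g : Space d → ℂ} (hf : Integrable f) (hg : Integrable g)
    (t : Space d) :
    invFourier f t - invFourier g t = invFourier (fun ξ => f ξ - g ξ) t := by
  have key : ∀ {h : Space d → ℂ}, Integrable h →
      Integrable fun ξ => Complex.exp ((inner ℝ ξ t : ℝ) * Complex.I) * h ξ := by
    intro h hh
    refine hh.bdd_mul (c := 1) (Continuous.aestronglyMeasurable (by fun_prop)) ?_
    filter_upwards with ξ
    rw [Complex.norm_exp_ofReal_mul_I]
  simp only [invFourier, mul_sub]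
  rw [integral_sub (key hf) (key hg), smul_sub]

theorem memLp_top_invFourier {d : ℕ} {h : Space d → ℂ} (hh : Integrable h) :
    MemLp (invFourier h) ∞ volume := by
  refine ⟨(continuous_invFourier hh).aestronglyMeasurable,
    (eLpNorm_invFourier_le h).trans_lt ?_⟩
  exact ENNReal.mul_lt_top (by simp) (memLp_one_iff_integrable.2 hh).2

theorem ofReal_two_pi_mul {d : ℕ} {r : ℝ} :
    ENNReal.ofReal ((2 * Real.pi) ^ (-(d : ℝ))) * ENNReal.ofReal ((2 * Real.pi) ^ (d : ℝ) * r) =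
      ENNReal.ofReal r := by
  rw [← ENNReal.ofReal_mul (by positivity), ← mul_assoc, ← Real.rpow_add (by positivity)]
  simp

theorem ofReal_two_pi_half_mul {d : ℕ} {r : ℝ} :
    ENNReal.ofReal ((2 * Real.pi) ^ (-(d / 2 : ℝ))) *
      ENNReal.ofReal ((2 * Real.pi) ^ (d / 2 : ℝ) * r) = ENNReal.ofReal r := by
  rw [← ENNReal.ofReal_mul (by positivity), ← mul_assoc, ← Real.rpow_add (by positivity)]
  simp

theorem le_two_pi_half_mul {d : ℕ} {A : ℝ≥0∞} {r : ℝ} (h : ENNReal.ofReal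
    ((2 * Real.pi) ^ (-(d / 2 : ℝ))) * A ≤ ENNReal.ofReal r) :
    A ≤ ENNReal.ofReal ((2 * Real.pi) ^ (d / 2 : ℝ) * r) := by
  have h1 := mul_le_mul_right h (ENNReal.ofReal ((2 * Real.pi) ^ (d / 2 : ℝ)))
  rw [← mul_assoc, ← ENNReal.ofReal_mul (by positivity), ← ENNReal.ofReal_mul (by positivity),
    ← Real.rpow_add (by positivity)] at h1
  simpa using h1

/-- The value at the origin of the inverse Fourier transform of a nonnegative function. -/
theorem enorm_invFourier_zero {d : ℕ} {h : Space d → ℂ}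
    (hpos : ∀ᵐ t, h t = (‖h t‖ : ℂ)) {r : ℝ} (hr : 0 ≤ r)
    (hval : eLpNorm h 1 volume = ENNReal.ofReal ((2 * Real.pi) ^ (d : ℝ) * r))
    (hint : Integrable h) :
    ‖invFourier h 0‖ₑ = ENNReal.ofReal r := by
  have h1 : ∫ ξ, Complex.exp ((inner ℝ ξ (0 : Space d) : ℝ) * Complex.I) * h ξ =
      ((∫ ξ, ‖h ξ‖ : ℝ) : ℂ) := by
    rw [← integral_complex_ofReal]
    refine integral_congr_ae ?_
    filter_upwards [hpos] with ξ hξ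
    simp [← hξ]
  have h2 : ∫ ξ, ‖h ξ‖ = (2 * Real.pi) ^ (d : ℝ) * r := by
    rw [integral_norm_eq_lintegral_enorm hint.1, ← eLpNorm_one_eq_lintegral_enorm, hval,
      ENNReal.toReal_ofReal (by positivity)]
  rw [invFourier, h1, h2, enorm_smul, Real.enorm_eq_ofReal (by positivity), ← ofReal_norm,
    Complex.norm_real, Real.norm_of_nonneg (by positivity), ← ENNReal.ofReal_mul (by positivity),
    Real.rpow_natCast, inv_mul_cancel_left₀ (by positivity)]

section Reduction

variable {d n : ℕ} {p : ℝ≥0∞} {ψ κ : Space d → ℂ} {φ : Fin n → Space d → ℂ} {E γ δ : ℝ}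

/-- The pointwise data of an extremal function of the recovery problem. -/
structure IsExtremal (p : ℝ≥0∞) (ψ : Space d → ℂ) (φ : Fin n → Space d → ℂ) (δ V : ℝ)
    (g : Space d → ℂ) : Prop where
  meas : AEStronglyMeasurable g volume
  norm_le : eLpNorm g p volume ≤ ENNReal.ofReal δ
  symbol_le : ∀ j, eLpNorm (fun ξ => φ j ξ * g ξ) 2 volume ≤
    ENNReal.ofReal ((2 * Real.pi) ^ (d / 2 : ℝ))
  nonneg : ∀ᵐ t, ψ t * g t = (‖ψ t * g t‖ : ℂ)
  value : eLpNorm (fun ξ => ψ ξ * g ξ) 1 volume = ENNReal.ofReal ((2 * Real.pi) ^ (d : ℝ) * V)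

/-- `multOp` is built from chosen representatives, so even its oddness rests on their uniqueness. -/
theorem multOp_neg {x : 𝓢'(Space d, ℂ)} {g : Space d → ℂ}
    (hx : IsFun (fourierD d x) g) (a : Space d → ℂ) (ht : IsTempered fun ξ => a ξ * g ξ) :
    multOp a (-x) = -multOp a x := by
  have h1 : IsFun (fourierD d (-x)) fun t => -g t := by rw [map_neg]; exact hx.neg
  have h2 := (isFun_ofFun ht).neg
  have h3 : (fun t => -(a t * g t)) = fun t => a t * -g t := by funext t; ring
  rw [h3] at h2
  rw [multOp_eq hx a ht, multOp_eq h1 a ⟨_, h2⟩, h2.ofFun_eq, map_neg]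

theorem mem_classX_of_isFun {x : 𝓢'(Space d, ℂ)} {g : Space d → ℂ}
    (hx : IsFun (fourierD d x) g) (hg : MemLp g p volume)
    (hg2 : ∀ j, MemLp (fun ξ => φ j ξ * g ξ) 2 volume) : x ∈ classX p φ := by
  refine ⟨⟨g, hx⟩, hg.ae_eq hx.toFun_ae_eq.symm, fun j => (hg2 j).ae_eq ?_⟩
  filter_upwards [hx.toFun_ae_eq] with t ht
  rw [ht]

theorem mem_classW_of_isFun {x : 𝓢'(Space d, ℂ)} {g : Space d → ℂ}
    (hx : IsFun (fourierD d x) g) (hg : MemLp g p volume)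
    (hg2 : ∀ j, MemLp (fun ξ => φ j ξ * g ξ) 2 volume)
    (hle : ∀ j, eLpNorm (fun ξ => φ j ξ * g ξ) 2 volume ≤
      ENNReal.ofReal ((2 * Real.pi) ^ (d / 2 : ℝ))) : x ∈ classW p φ := by
  refine ⟨mem_classX_of_isFun hx hg hg2, fun j => ?_⟩
  rw [distNorm_multOp_two hx (hg2 j)]
  calc _ ≤ _ := mul_le_mul_right (hle j) _
    _ = 1 := by
      have := ofReal_two_pi_half_mul (d := d) (r := 1)
      rw [mul_one] at this
      rw [this, ENNReal.ofReal_one]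

variable (hp : 1 ≤ p) (hφ : ∀ j, AEStronglyMeasurable (φ j) volume)
include hp hφ

/-- The distribution attached to an extremal function. -/
theorem IsExtremal.exists_dist {V : ℝ} (hV : 0 ≤ V) {g : Space d → ℂ}
    (hψ : AEStronglyMeasurable ψ volume)
    (hg : IsExtremal p ψ φ δ V g) :
    ∃ x : 𝓢'(Space d, ℂ), IsFun (fourierD d x) g ∧ x ∈ classW p φ ∧ -x ∈ classW p φ ∧
      ∃ H : Space d → ℂ, Continuous H ∧ IsFun (multOp ψ x) H ∧ IsFun (multOp ψ (-x)) (-H) ∧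
        ‖H 0‖ₑ = ENNReal.ofReal V := by
  have hgp : MemLp g p volume := ⟨hg.meas, hg.norm_le.trans_lt ENNReal.ofReal_lt_top⟩
  have hg2 : ∀ j, MemLp (fun ξ => φ j ξ * g ξ) 2 volume := fun j =>
    ⟨(hφ j).mul hg.meas, (hg.symbol_le j).trans_lt ENNReal.ofReal_lt_top⟩
  have hg1 : Integrable fun ξ => ψ ξ * g ξ := memLp_one_iff_integrable.1
    ⟨hψ.mul hg.meas, hg.value.trans_lt ENNReal.ofReal_lt_top⟩
  have hF : IsFun (fourierD d (fourierInvD d (ofFun g))) g := by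
    rw [fourierD_fourierInvD]; exact isFun_ofFun (isTempered_of_memLp hp hgp)
  have hFn : IsFun (fourierD d (-fourierInvD d (ofFun g))) (fun t => -g t) := by
    rw [map_neg]; exact hF.neg
  refine ⟨_, hF, mem_classW_of_isFun hF hgp hg2 hg.symbol_le, ?_, _, continuous_invFourier hg1,
    isFun_multOp hF hg1, ?_, enorm_invFourier_zero hg.nonneg hV hg.value hg1⟩
  · have heq : ∀ j, (fun ξ => φ j ξ * -g ξ) = -fun ξ => φ j ξ * g ξ := fun j => by
      funext ξ; simp
    refine mem_classW_of_isFun hFn hgp.neg (fun j => ?_) fun j => ?_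
    · rw [heq]; exact (hg2 j).neg
    · rw [heq, eLpNorm_neg]; exact hg.symbol_le j
  · rw [multOp_neg hF ψ (isTempered_of_memLp le_rfl (memLp_one_iff_integrable.2 hg1))]
    exact (isFun_multOp hF hg1).neg

/-- Both `x` and `-x` are admissible with the observation `y = 0`, so `m` returns the same `m 0` for
them. The triangle inequality gives `2‖Λx‖_∞ ≤ ‖Λx - m 0‖_∞ + ‖-Λx - m 0‖_∞`, whatever the map `m`
is. -/
theorem ofReal_le_methodError {V : ℝ} (hV : 0 ≤ V) {g : Space d → ℂ}
    (hψ : AEStronglyMeasurable ψ volume) (hg : IsExtremal p ψ φ δ V g) (m : Method d p ∞) :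
    ENNReal.ofReal V ≤ methodError p ∞ ψ φ δ m := by
  obtain ⟨x, hx, hxW, hxW', H, hHc, hH, hH', hH0⟩ := hg.exists_dist hp hφ hV hψ
  have : Fact (1 ≤ (∞ : ℝ≥0∞)) := ⟨le_top⟩
  set y : Space d → ℂ := ⇑(m 0) with hy
  have hyF : IsFun (ofFun (m 0)) y :=
    isFun_ofFun ⟨_, isFun_toTemperedDistribution (m 0)⟩
  have hle : ∀ z ∈ classW p φ, eLpNorm (toFun (fourierD d z)) p volume ≤ ENNReal.ofReal δ →
      distNorm ∞ (multOp ψ z - ofFun (m 0)) ≤ methodError p ∞ ψ φ δ m := by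
    intro z hz hzδ
    refine le_iSup₂_of_le z hz (le_iSup₂_of_le 0 ?_ le_rfl)
    refine le_trans (le_of_eq (eLpNorm_congr_ae ?_)) hzδ
    filter_upwards with t
    simp
  have e1 : eLpNorm (fun t => H t - y t) ∞ volume ≤ methodError p ∞ ψ φ δ m := by
    rw [← (hH.sub hyF).distNorm_eq]
    exact hle x hxW ((eLpNorm_congr_ae hx.toFun_ae_eq).trans_le hg.norm_le)
  have e2 : eLpNorm (fun t => (-H) t - y t) ∞ volume ≤ methodError p ∞ ψ φ δ m := by
    rw [← (hH'.sub hyF).distNorm_eq]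
    refine hle (-x) hxW' ?_
    have : IsFun (fourierD d (-x)) (fun t => -g t) := by rw [map_neg]; exact hx.neg
    rw [eLpNorm_congr_ae this.toFun_ae_eq]
    exact (eLpNorm_neg g p volume).trans_le hg.norm_le
  have e3 : eLpNorm ((2 : ℂ) • H) ∞ volume ≤ 2 * methodError p ∞ ψ φ δ m := by
    have : ((2 : ℂ) • H) = (fun t => H t - y t) - fun t => (-H) t - y t := by
      funext t
      simp only [Pi.smul_apply, Pi.sub_apply, Pi.neg_apply, smul_eq_mul]
      ring
    rw [this, two_mul]
    exact (eLpNorm_sub_le (hH.sub hyF).1 (hH'.sub hyF).1 le_top).trans (add_le_add e1 e2)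
  have e4 : eLpNorm ((2 : ℂ) • H) ∞ volume = 2 * eLpNorm H ∞ volume := by
    rw [eLpNorm_const_smul]
    congr 1
    simp [← ofReal_norm]
  rw [e4] at e3
  have e5 := enorm_le_eLpNorm_top hHc 0
  rw [hH0] at e5
  exact e5.trans ((ENNReal.mul_le_mul_iff_right two_ne_zero ENNReal.ofNat_ne_top).1 e3)

/-- Reduction of the recovery problem to inequalities between functions. -/
theorem recovery_of_bounds (hδ : 0 < δ) (hE : 0 ≤ E) (hγ : γ ∈ Set.Ioo 0 1)
    (hψ : AEStronglyMeasurable ψ volume) (hφ0 : ∀ᵐ t, ∑ j, ‖φ j t‖ ≠ 0)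
    (hκ : ∀ y : Space d → ℂ, MemLp y p volume → Integrable fun t => κ t * y t)
    (hup : ∀ g y : Space d → ℂ, AEStronglyMeasurable g volume → AEStronglyMeasurable y volume →
      eLpNorm (fun t => g t - y t) p volume ≤ ENNReal.ofReal δ →
      (∀ j, eLpNorm (fun t => φ j t * g t) 2 volume ≤
        ENNReal.ofReal ((2 * Real.pi) ^ (d / 2 : ℝ) * 1)) →
      eLpNorm (fun t => ψ t * g t - κ t * y t) 1 volume ≤
        ENNReal.ofReal ((2 * Real.pi) ^ (d : ℝ) * (E * δ ^ γ)))
    (hineq : ∀ (g : Space d → ℂ) (G N : ℝ), AEStronglyMeasurable g volume → 0 < G → 0 < N →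
      eLpNorm g p volume ≤ ENNReal.ofReal G →
      (∀ j, eLpNorm (fun t => φ j t * g t) 2 volume ≤
        ENNReal.ofReal ((2 * Real.pi) ^ (d / 2 : ℝ) * N)) →
      eLpNorm (fun t => ψ t * g t) 1 volume ≤
        ENNReal.ofReal ((2 * Real.pi) ^ (d : ℝ) * (E * G ^ γ * N ^ (1 - γ))))
    (hlow : ∃ g, IsExtremal p ψ φ δ (E * δ ^ γ) g) :
    (∀ x ∈ classX p φ, IsTempered (fun ξ => ψ ξ * toFun (fourierD d x) ξ) ∧
      distNorm ∞ (multOp ψ x) < ∞) ∧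
    optimalError p ∞ ψ φ δ = ENNReal.ofReal (E * δ ^ γ) ∧
    (∃ m : Method d p ∞,
      (∀ y, IsTempered (fun t => κ t * y t) ∧
        ofFun (m y) = fourierInvD d (ofFun fun t => κ t * y t)) ∧
      IsOptimal p ∞ ψ φ δ m) ∧
    IsLeast {K : ℝ≥0∞ | ∀ x ∈ classX p φ, distNorm ∞ (multOp ψ x) ≤
        K * eLpNorm (toFun (fourierD d x)) p volume ^ γ *
          (⨆ j, distNorm 2 (multOp (φ j) x)) ^ (1 - γ)}
      (ENNReal.ofReal E) := by
  have hγ0 : 0 < γ := hγ.1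
  have hγ1 : 0 < 1 - γ := sub_pos.2 hγ.2
  have hXF : ∀ x ∈ classX p φ, IsFun (fourierD d x) (toFun (fourierD d x)) :=
    fun x hx => isFun_toFun hx.1
  have hsup : ∀ x ∈ classX p φ, (⨆ j, distNorm 2 (multOp (φ j) x)) < ∞ := by
    intro x hx
    refine iSup_lt_iff.2 ⟨∑ j, distNorm 2 (multOp (φ j) x), ENNReal.sum_lt_top.2 fun j _ => ?_,
      fun j => Finset.single_le_sum (f := fun j => distNorm 2 (multOp (φ j) x))
        (fun _ _ => zero_le) (Finset.mem_univ j)⟩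
    rw [distNorm_multOp_two (hXF x hx) (hx.2.2 j)]
    exact ENNReal.mul_lt_top (by simp) (hx.2.2 j).2
  have hbound : ∀ x ∈ classX p φ, ∀ N : ℝ, (⨆ j, distNorm 2 (multOp (φ j) x)) ≤ ENNReal.ofReal N →
      ∀ j, eLpNorm (fun t => φ j t * toFun (fourierD d x) t) 2 volume ≤
        ENNReal.ofReal ((2 * Real.pi) ^ (d / 2 : ℝ) * N) := by
    intro x hx N hN j
    have := (le_iSup (fun j => distNorm 2 (multOp (φ j) x)) j).trans hN
    rw [distNorm_multOp_two (hXF x hx) (hx.2.2 j)] at this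
    exact le_two_pi_half_mul this
  -- `hineq` needs strictly positive bounds; for integrability any finite bound will do, so 1 is
  -- added.
  have hle_add : ∀ A : ℝ≥0∞, A < ∞ → A ≤ ENNReal.ofReal (A.toReal + 1) := fun A hA =>
    (ENNReal.ofReal_toReal hA.ne).symm.trans_le (ENNReal.ofReal_le_ofReal (by linarith))
  have hint : ∀ x ∈ classX p φ, Integrable fun t => ψ t * toFun (fourierD d x) t := by
    intro x hx
    refine memLp_one_iff_integrable.1 ⟨hψ.mul hx.2.1.1, ?_⟩
    refine (hineq _ ((eLpNorm (toFun (fourierD d x)) p volume).toReal + 1)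
      ((⨆ j, distNorm 2 (multOp (φ j) x)).toReal + 1) hx.2.1.1 (by positivity) (by positivity)
      (hle_add _ hx.2.1.2) (hbound x hx _ (hle_add _ (hsup x hx)))).trans_lt ENNReal.ofReal_lt_top
  have hlower : ∀ m : Method d p ∞, ENNReal.ofReal (E * δ ^ γ) ≤ methodError p ∞ ψ φ δ m := by
    obtain ⟨g, hg⟩ := hlow
    exact ofReal_le_methodError hp hφ (by positivity) hψ hg
  let m : Method d p ∞ := fun y => (memLp_top_invFourier (hκ y (Lp.memLp y))).toLp _
  have hm : ∀ y, IsFun (fourierInvD d (ofFun fun t => κ t * y t)) (m y) := fun y =>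
    (isFun_fourierInvD_of_integrable (hκ y (Lp.memLp y))).congr (MemLp.coeFn_toLp _).symm
  have hupper : methodError p ∞ ψ φ δ m ≤ ENNReal.ofReal (E * δ ^ γ) := by
    refine iSup₂_le fun x hx => iSup₂_le fun y hy => ?_
    have h1 := isFun_multOp (hXF x hx.1) (hint x hx.1)
    have h2 := isFun_fourierInvD_of_integrable (hκ y (Lp.memLp y))
    rw [(hm y).ofFun_eq, (h1.sub h2).distNorm_eq]
    have h3 : (fun t => invFourier (fun ξ => ψ ξ * toFun (fourierD d x) ξ) t -
        invFourier (fun ξ => κ ξ * y ξ) t) =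
        invFourier fun ξ => ψ ξ * toFun (fourierD d x) ξ - κ ξ * y ξ := by
      funext t
      exact invFourier_sub (hint x hx.1) (hκ y (Lp.memLp y)) t
    rw [h3, ← ofReal_two_pi_mul (d := d)]
    refine (eLpNorm_invFourier_le _).trans (mul_le_mul_right ?_ _)
    refine hup _ _ hx.1.2.1.1 (Lp.aestronglyMeasurable y) hy (hbound x hx.1 1 ?_)
    rw [ENNReal.ofReal_one]
    exact iSup_le hx.2
  have hopt : optimalError p ∞ ψ φ δ = ENNReal.ofReal (E * δ ^ γ) :=
    le_antisymm ((iInf_le _ m).trans hupper) (le_iInf hlower)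
  refine ⟨fun x hx => ⟨isTempered_of_memLp le_rfl (memLp_one_iff_integrable.2 (hint x hx)), ?_⟩,
    hopt, ⟨m, fun y => ⟨isTempered_of_memLp le_rfl (memLp_one_iff_integrable.2
      (hκ y (Lp.memLp y))), (hm y).ofFun_eq⟩, ?_⟩, ?_, ?_⟩
  · rw [(isFun_multOp (hXF x hx) (hint x hx)).distNorm_eq]
    exact (memLp_top_invFourier (hint x hx)).2
  · rw [IsOptimal, hopt]
    exact le_antisymm hupper (hlower m)
  · intro x hx
    rw [(isFun_multOp (hXF x hx) (hint x hx)).distNorm_eq]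
    -- `hineq` does not cover a vanishing norm. In either degenerate case `Fx = 0` almost everywhere
    -- and the left side is 0.
    have hzero : toFun (fourierD d x) =ᵐ[volume] 0 →
        eLpNorm (invFourier fun ξ => ψ ξ * toFun (fourierD d x) ξ) ∞ volume ≤ 0 := by
      intro h0
      refine (eLpNorm_invFourier_le _).trans ?_
      have : (fun ξ => ψ ξ * toFun (fourierD d x) ξ) =ᵐ[volume] 0 := by
        filter_upwards [h0] with t ht
        simp [ht]
      simp [eLpNorm_congr_ae this]
    by_cases hG : eLpNorm (toFun (fourierD d x)) p volume = 0
    · exact (hzero ((eLpNorm_eq_zero_iff hx.2.1.1 (by positivity)).1 hG)).trans zero_le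
    -- Here every `φ_j Fx` vanishes almost everywhere, while almost everywhere some `φ_j` is
    -- nonzero.
    by_cases hN : (⨆ j, distNorm 2 (multOp (φ j) x)) = 0
    · refine (hzero ?_).trans zero_le
      have hz : ∀ j, ∀ᵐ t, φ j t * toFun (fourierD d x) t = 0 := by
        intro j
        have := hbound x hx 0 (by simp [hN]) j
        simp only [mul_zero, ENNReal.ofReal_zero, nonpos_iff_eq_zero] at this
        exact (eLpNorm_eq_zero_iff (hx.2.2 j).1 two_ne_zero).1 this
      filter_upwards [hφ0, ae_all_iff.2 hz] with t h1 h2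
      by_contra h3
      apply h1
      refine Finset.sum_eq_zero fun j _ => ?_
      exact norm_eq_zero.2 ((mul_eq_zero.1 (h2 j)).resolve_right h3)
    have hGt := ENNReal.toReal_pos hG hx.2.1.2.ne
    have hNt := ENNReal.toReal_pos hN (hsup x hx).ne
    have h1 := hineq _ _ _ hx.2.1.1 hGt hNt (ENNReal.ofReal_toReal hx.2.1.2.ne).ge
      (hbound x hx _ (ENNReal.ofReal_toReal (hsup x hx).ne).ge)
    refine (eLpNorm_invFourier_le _).trans ((mul_le_mul_right h1 _).trans ?_)
    rw [ofReal_two_pi_mul, ENNReal.ofReal_mul (by positivity), ENNReal.ofReal_mul hE,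
      ← ENNReal.ofReal_rpow_of_pos hGt, ← ENNReal.ofReal_rpow_of_pos hNt,
      ENNReal.ofReal_toReal hx.2.1.2.ne, ENNReal.ofReal_toReal (hsup x hx).ne]
  · intro K hK
    obtain ⟨g, hg⟩ := hlow
    obtain ⟨x, hx, hxW, -, H, hHc, hH, -, hH0⟩ := hg.exists_dist hp hφ (by positivity) hψ
    have h1 := hK x hxW.1
    rw [hH.distNorm_eq, eLpNorm_congr_ae hx.toFun_ae_eq] at h1
    have h2 := (hH0.symm.trans_le (enorm_le_eLpNorm_top hHc 0)).trans h1
    -- Testing `K` on the extremal element: the value at the origin is `E δ^γ`, while the norms on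
    -- the right are at most `δ` and 1. The factor `δ^γ` then cancels.
    have h3 : ENNReal.ofReal E * ENNReal.ofReal δ ^ γ ≤ K * ENNReal.ofReal δ ^ γ := by
      rw [ENNReal.ofReal_rpow_of_pos hδ, ← ENNReal.ofReal_mul hE]
      refine h2.trans ?_
      rw [← ENNReal.ofReal_rpow_of_pos hδ]
      refine (mul_le_mul' (mul_le_mul_right (ENNReal.rpow_le_rpow hg.norm_le hγ0.le) _)
        (ENNReal.rpow_le_one (iSup_le hxW.2) hγ1.le)).trans_eq (mul_one _)
    refine (ENNReal.mul_le_mul_iff_left ?_ ?_).1 h3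
    · rw [ENNReal.ofReal_rpow_of_pos hδ]; simp; positivity
    · rw [ENNReal.ofReal_rpow_of_pos hδ]; simp

end Reduction

/-! ### Polar coordinates and homogeneous functions -/

/-- The polar coordinates `(ω, r) ↦ r ω` as a map on the product of the sphere and the ray. -/
def polarMap (d : ℕ) (z : Metric.sphere (0 : Space d) 1 × Set.Ioi (0 : ℝ)) : Space d :=
  z.2.1 • z.1.1

/-- For `d > 0` the origin is null and its complement is homeomorphic to sphere times ray. A
homeomorphism is a measurable embedding, so `F` need not be measurable. -/
theorem lintegral_eq_prod {d : ℕ} {F : Space d → ℝ≥0∞} (hd : 0 < d) :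
    ∫⁻ t, F t = ∫⁻ z, F (polarMap d z)
      ∂((sphereMeasure d).prod (Measure.volumeIoiPow (d - 1))) := by
  have : Nontrivial (Space d) := by
    rw [← Module.finrank_pos_iff (R := ℝ), finrank_euclideanSpace_fin]; exact hd
  have h1 : ∫⁻ t, F t = ∫⁻ x : ({(0 : Space d)}ᶜ : Set (Space d)), F x
      ∂(Measure.comap (↑) (volume : Measure (Space d))) := by
    rw [lintegral_subtype_comap (measurableSet_singleton _).compl, restrict_compl_singleton]
  have h2 := (Measure.measurePreserving_homeomorphUnitSphereProd
    (volume : Measure (Space d))).lintegral_comp_emb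
    (Homeomorph.measurableEmbedding _) (fun z => F (polarMap d z))
  rw [finrank_euclideanSpace_fin] at h2
  rw [h1, sphereMeasure, ← h2]
  refine lintegral_congr fun x => ?_
  congr 1
  have hx : (x : Space d) ≠ 0 := x.2
  simp [polarMap, smul_smul, hx]

theorem quasiMeasurePreserving_polarMap {d : ℕ} (hd : 0 < d) :
    Measure.QuasiMeasurePreserving (polarMap d)
      ((sphereMeasure d).prod (Measure.volumeIoiPow (d - 1))) volume := by
  have hm : Measurable (polarMap d) := by unfold polarMap; fun_prop
  refine ⟨hm, Measure.AbsolutelyContinuous.mk fun s hs h0 => ?_⟩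
  have := lintegral_eq_prod (F := s.indicator 1) hd
  rw [lintegral_indicator_one hs, h0] at this
  rw [Measure.map_apply hm hs, ← lintegral_indicator_one (hm hs), this]
  rfl

theorem volumeIoiPow_ne_zero (k : ℕ) : Measure.volumeIoiPow k ≠ 0 := by
  intro h
  have := Measure.volumeIoiPow_apply_Iio k ⟨1, Set.mem_Ioi.2 one_pos⟩
  rw [h] at this
  simp only [Measure.coe_zero, Pi.zero_apply, one_pow] at this
  have h2 := (ENNReal.ofReal_eq_zero.1 this.symm)
  have : (0 : ℝ) < 1 / (k + 1) := by positivity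
  linarith

/-- A property which is invariant under dilations and holds almost everywhere in the space holds
almost everywhere on the sphere. -/
theorem ae_sphere_of_ae {d : ℕ} (hd : 0 < d) {P : Space d → Prop} (hP : ∀ᵐ t, P t)
    (hinv : ∀ t : Space d, t ≠ 0 → ∀ r : ℝ, 0 < r → P (r • t) → P t) :
    ∀ᵐ ω : Metric.sphere (0 : Space d) 1 ∂sphereMeasure d, P ω := by
  have h1 := Measure.ae_ae_of_ae_prod ((quasiMeasurePreserving_polarMap hd).ae hP)
  have : NeZero (Measure.volumeIoiPow (d - 1)) := ⟨volumeIoiPow_ne_zero _⟩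
  have : (ae (Measure.volumeIoiPow (d - 1))).NeBot := ae_neBot.2 (volumeIoiPow_ne_zero _)
  filter_upwards [h1] with ω hω
  -- On almost every ray the property holds at almost every radius; one radius is enough because of
  -- the invariance.
  obtain ⟨r, hr⟩ := hω.exists
  exact hinv ω (ne_zero_of_mem_unit_sphere ω) r r.2 hr

/-- The sphere is a null set, so measurability does not simply restrict to it. Fubini provides some
radius `r` at which `ω ↦ f(rω)` is measurable, and homogeneity brings it back to radius 1. -/
theorem aemeasurable_sphere {d : ℕ} (hd : 0 < d) {f : Space d → ℝ} {κ : ℝ}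
    (hf : AEMeasurable f volume)
    (hh : ∀ t : Space d, t ≠ 0 → ∀ r : ℝ, 0 < r → f (r • t) = r ^ κ * f t) :
    AEMeasurable (fun ω : Metric.sphere (0 : Space d) 1 => f ω) (sphereMeasure d) := by
  have : SFinite (sphereMeasure d) := by unfold sphereMeasure; infer_instance
  have h1 := (hf.comp_quasiMeasurePreserving (quasiMeasurePreserving_polarMap hd)).prod_swap
  have h2 := h1.aestronglyMeasurable.prodMk_left
  have : (ae (Measure.volumeIoiPow (d - 1))).NeBot := ae_neBot.2 (volumeIoiPow_ne_zero _)
  obtain ⟨r, hr⟩ := h2.exists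
  have hr0 : (0 : ℝ) < r := r.2
  refine (hr.aemeasurable.const_mul ((r : ℝ) ^ (-κ))).congr ?_
  filter_upwards with ω
  simp only [Function.comp, Prod.swap, polarMap]
  rw [hh _ (ne_zero_of_mem_unit_sphere ω) _ hr0, ← mul_assoc, ← Real.rpow_add hr0]
  simp

theorem lintegral_volumeIoiPow {k : ℕ} {f : ℝ → ℝ≥0∞} :
    ∫⁻ r, f r ∂(Measure.volumeIoiPow k) =
      ∫⁻ r in Set.Ioi (0 : ℝ), ENNReal.ofReal (r ^ k) * f r := by
  rw [Measure.volumeIoiPow, lintegral_withDensity_eq_lintegral_mul_non_measurable]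
  · simp only [Pi.mul_apply]
    rw [lintegral_subtype_comap measurableSet_Ioi
      fun r : ℝ => ENNReal.ofReal (r ^ k) * f r]
  · fun_prop
  · filter_upwards with r
    simp

/-- The exponents have the same sign. With `R = x^{1/β}` the sublevel set is `(0, R)` if both are
positive and `(R, ∞)` if both are negative; in each case the power converges and integrates to `R^α
/ |α|`. -/
theorem lintegral_ite_rpow_lt {α β x : ℝ} (hαβ : 0 < α / β) (hx : 0 < x) :
    ∫⁻ r in Set.Ioi (0 : ℝ), (if r ^ β < x then ENNReal.ofReal (r ^ (α - 1)) else 0) =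
      ENNReal.ofReal (x ^ (α / β) / |α|) := by
  have hβ : β ≠ 0 := by rintro rfl; simp at hαβ
  set R := x ^ (1 / β) with hR
  have hR0 : 0 < R := by positivity
  have hRβ : R ^ β = x := by rw [hR, ← Real.rpow_mul hx.le]; simp [hβ]
  have hRα : x ^ (α / β) = R ^ α := by rw [hR, ← Real.rpow_mul hx.le]; congr 1; field_simp
  rw [hRα]
  rcases lt_or_gt_of_ne hβ with hneg | hpos
  · have hα : α < 0 := by
      by_contra! h
      exact absurd hαβ (not_lt.2 (div_nonpos_of_nonneg_of_nonpos h hneg.le))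
    have hset : ∀ r ∈ Set.Ioi (0 : ℝ), (if r ^ β < x then ENNReal.ofReal (r ^ (α - 1)) else 0) =
        (Set.Ioi R).indicator (fun r => ENNReal.ofReal (r ^ (α - 1))) r := by
      intro r hr
      have : r ^ β < x ↔ R < r := by
        rw [← hRβ]; exact Real.rpow_lt_rpow_iff_of_neg hr hR0 hneg
      simp [Set.indicator_apply, this]
    rw [setLIntegral_congr_fun measurableSet_Ioi hset, lintegral_indicator measurableSet_Ioi,
      Measure.restrict_restrict measurableSet_Ioi,
      Set.inter_eq_left.2 (Set.Ioi_subset_Ioi hR0.le),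
      ← ofReal_integral_eq_lintegral_ofReal (integrableOn_Ioi_rpow_of_lt (by linarith) hR0),
      integral_Ioi_rpow_of_lt (by linarith) hR0, abs_of_neg hα]
    · congr 1; rw [sub_add_cancel, neg_div, div_neg]
    · filter_upwards [ae_restrict_mem measurableSet_Ioi] with r hr
      exact Real.rpow_nonneg (hR0.le.trans (le_of_lt hr)) _
  · have hα : 0 < α := by
      by_contra! h
      exact absurd hαβ (not_lt.2 (div_nonpos_of_nonpos_of_nonneg h hpos.le))
    have hset : ∀ r ∈ Set.Ioi (0 : ℝ), (if r ^ β < x then ENNReal.ofReal (r ^ (α - 1)) else 0) =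
        (Set.Iio R).indicator (fun r => ENNReal.ofReal (r ^ (α - 1))) r := by
      intro r hr
      have : r ^ β < x ↔ r < R := by
        rw [← hRβ]; exact Real.rpow_lt_rpow_iff (le_of_lt hr) hR0.le hpos
      simp [Set.indicator_apply, this]
    have hii := (intervalIntegral.intervalIntegrable_rpow' (a := 0) (b := R)
      (r := α - 1) (by linarith))
    rw [setLIntegral_congr_fun measurableSet_Ioi hset, lintegral_indicator measurableSet_Iio,
      Measure.restrict_restrict measurableSet_Iio, Set.Iio_inter_Ioi,
      Measure.restrict_congr_set Ioo_ae_eq_Ioc,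
      ← ofReal_integral_eq_lintegral_ofReal hii.1, ← intervalIntegral.integral_of_le hR0.le,
      integral_rpow (Or.inl (by linarith)), abs_of_pos hα]
    · congr 1; simp [hα.ne']
    · filter_upwards [ae_restrict_mem measurableSet_Ioc] with r hr
      exact Real.rpow_nonneg hr.1.le _

/-- On the ray through `ω` the condition reads `r^β < θ / ρ(ω)` and the weight with the Jacobian is
`r^{α-1} W(ω)`, so `lintegral_ite_rpow_lt` does the radial integral. -/
theorem lintegral_sublevel {d : ℕ} (hd : 0 < d) {W ρ : Space d → ℝ} {α β θ : ℝ}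
    (hαβ : 0 < α / β) (hθ : 0 < θ) (hW : AEMeasurable W volume) (hρ : AEMeasurable ρ volume)
    (hWh : ∀ t : Space d, t ≠ 0 → ∀ r : ℝ, 0 < r → W (r • t) = r ^ (α - d) * W t)
    (hρh : ∀ t : Space d, t ≠ 0 → ∀ r : ℝ, 0 < r → ρ (r • t) = r ^ β * ρ t)
    (hρ0 : ∀ᵐ ω : Metric.sphere (0 : Space d) 1 ∂sphereMeasure d, 0 < ρ ω) :
    ∫⁻ t, (if ρ t < θ then ENNReal.ofReal (W t) else 0) = ENNReal.ofReal (θ ^ (α / β) / |α|) *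
      ∫⁻ ω : Metric.sphere (0 : Space d) 1, ENNReal.ofReal (W ω * ρ ω ^ (-(α / β)))
        ∂sphereMeasure d := by
  have hset : NullMeasurableSet {t : Space d | ρ t < θ} volume :=
    nullMeasurableSet_lt hρ aemeasurable_const
  have hmeas : AEMeasurable (fun t => if ρ t < θ then ENNReal.ofReal (W t) else 0) volume := by
    have := hW.ennreal_ofReal.indicator₀ hset
    refine this.congr (Filter.Eventually.of_forall fun t => ?_)
    simp [Set.indicator_apply]
  have hmeas' := hmeas.comp_quasiMeasurePreserving (quasiMeasurePreserving_polarMap hd)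
  simp only [Function.comp_def] at hmeas'
  rw [lintegral_eq_prod hd, lintegral_prod _ hmeas',
    ← lintegral_const_mul'']
  · refine lintegral_congr_ae ?_
    filter_upwards [hρ0] with ω hω
    have h1 := lintegral_volumeIoiPow (k := d - 1) (f := fun r : ℝ =>
      if ρ (r • (ω : Space d)) < θ then ENNReal.ofReal (W (r • (ω : Space d))) else 0)
    refine h1.trans ?_
    have h2 : ∀ r ∈ Set.Ioi (0 : ℝ), ENNReal.ofReal (r ^ (d - 1)) *
        (if ρ (r • (ω : Space d)) < θ then ENNReal.ofReal (W (r • (ω : Space d))) else 0) =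
        ENNReal.ofReal (W ω) *
          (if r ^ β < θ / ρ ω then ENNReal.ofReal (r ^ (α - 1)) else 0) := by
      intro r hr
      have hr0 : (0 : ℝ) < r := hr
      rw [hWh _ (ne_zero_of_mem_unit_sphere ω) r hr, hρh _ (ne_zero_of_mem_unit_sphere ω) r hr]
      simp only [← lt_div_iff₀ hω]
      split_ifs
      · rw [← ENNReal.ofReal_mul (by positivity), ← mul_assoc, ← Real.rpow_natCast,
          ← Real.rpow_add hr0, mul_comm, ENNReal.ofReal_mul' (by positivity)]
        congr 3
        rw [Nat.cast_sub hd]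
        push_cast
        ring
      · simp
    rw [setLIntegral_congr_fun measurableSet_Ioi h2, lintegral_const_mul' _ _ ENNReal.ofReal_ne_top,
      lintegral_ite_rpow_lt hαβ (by positivity)]
    have e : (θ / ρ ω) ^ (α / β) / |α| = θ ^ (α / β) / |α| * ρ ω ^ (-(α / β)) := by
      rw [Real.div_rpow hθ.le hω.le, Real.rpow_neg hω.le]
      ring
    have hnn : 0 ≤ ρ ω ^ (-(α / β)) := (Real.rpow_pos_of_pos hω _).le
    rw [e, ENNReal.ofReal_mul (by positivity), ENNReal.ofReal_mul' hnn, mul_left_comm]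
  · exact ((aemeasurable_sphere hd hW hWh).mul
      ((aemeasurable_sphere hd hρ hρh).pow_const _)).ennreal_ofReal

/-! ### Integrals of functions of the multiplier -/

/-- Layer cake: `h(x)` is the integral of `m` over `(x, 1)`, so Tonelli reduces the integral to the
sets `{k < u}`. These are sublevel sets of the homogeneous `ρ`, although `k` itself is not
homogeneous. -/
theorem lintegral_layer {d : ℕ} (hd : 0 < d) {W ρ k : Space d → ℝ} {Θ m h : ℝ → ℝ} {α β : ℝ}
    (hαβ : 0 < α / β) (hΘ : Measurable Θ) (hΘ0 : ∀ u ∈ Set.Ioo (0 : ℝ) 1, 0 < Θ u)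
    (hm : Measurable m)
    (hh : ∀ x ∈ Set.Icc (0 : ℝ) 1,
      ENNReal.ofReal (h x) = ∫⁻ u in Set.Ioo (0 : ℝ) 1, if x < u then ENNReal.ofReal (m u) else 0)
    (hW : AEMeasurable W volume) (hρ : AEMeasurable ρ volume)
    (hWh : ∀ t : Space d, t ≠ 0 → ∀ r : ℝ, 0 < r → W (r • t) = r ^ (α - d) * W t)
    (hρh : ∀ t : Space d, t ≠ 0 → ∀ r : ℝ, 0 < r → ρ (r • t) = r ^ β * ρ t)
    (hρ0 : ∀ᵐ ω : Metric.sphere (0 : Space d) 1 ∂sphereMeasure d, 0 < ρ ω)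
    (hk : ∀ᵐ t, k t ∈ Set.Icc (0 : ℝ) 1 ∧ ∀ u ∈ Set.Ioo (0 : ℝ) 1, k t < u ↔ ρ t < Θ u) :
    ∫⁻ t, ENNReal.ofReal (h (k t)) * ENNReal.ofReal (W t) =
      (∫⁻ u in Set.Ioo (0 : ℝ) 1, ENNReal.ofReal (m u) * ENNReal.ofReal (Θ u ^ (α / β) / |α|)) *
      ∫⁻ ω : Metric.sphere (0 : Space d) 1, ENNReal.ofReal (W ω * ρ ω ^ (-(α / β)))
        ∂sphereMeasure d := by
  have h1 : ∫⁻ t, ENNReal.ofReal (h (k t)) * ENNReal.ofReal (W t) =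
      ∫⁻ t, ∫⁻ u in Set.Ioo (0 : ℝ) 1,
        if ρ t < Θ u then ENNReal.ofReal (m u) * ENNReal.ofReal (W t) else 0 := by
    refine lintegral_congr_ae ?_
    filter_upwards [hk] with t ht
    rw [hh _ ht.1, ← lintegral_mul_const' _ _ ENNReal.ofReal_ne_top]
    refine setLIntegral_congr_fun measurableSet_Ioo fun u hu => ?_
    simp only [ht.2 u hu, ite_mul, zero_mul]
  have hmeas : AEMeasurable (Function.uncurry fun (t : Space d) (u : ℝ) =>
      if ρ t < Θ u then ENNReal.ofReal (m u) * ENNReal.ofReal (W t) else 0)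
      (volume.prod (volume.restrict (Set.Ioo (0 : ℝ) 1))) := by
    have hset : NullMeasurableSet {z : Space d × ℝ | ρ z.1 < Θ z.2}
        (volume.prod (volume.restrict (Set.Ioo (0 : ℝ) 1))) :=
      nullMeasurableSet_lt hρ.comp_fst (hΘ.comp measurable_snd).aemeasurable
    have := ((hm.comp measurable_snd).ennreal_ofReal.aemeasurable.mul
      hW.comp_fst.ennreal_ofReal).indicator₀ hset
    refine this.congr (Filter.Eventually.of_forall fun t => ?_)
    simp [Set.indicator_apply, Function.uncurry]
  rw [h1, lintegral_lintegral_swap hmeas, ← lintegral_mul_const'']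
  · refine setLIntegral_congr_fun measurableSet_Ioo fun u hu => ?_
    rw [mul_assoc, ← lintegral_sublevel hd hαβ (hΘ0 u hu) hW hρ hWh hρh hρ0,
      ← lintegral_const_mul' _ _ ENNReal.ofReal_ne_top]
    simp only [mul_ite, mul_zero]
  · exact (hm.ennreal_ofReal.mul ((hΘ.pow_const _).div_const _).ennreal_ofReal).aemeasurable

theorem ofReal_one_sub_eq_lintegral {x : ℝ} (hx : x ∈ Set.Icc (0 : ℝ) 1) :
    ENNReal.ofReal (1 - x) =
      ∫⁻ u in Set.Ioo (0 : ℝ) 1, if x < u then ENNReal.ofReal 1 else 0 := by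
  have : ∀ u, (if x < u then ENNReal.ofReal 1 else 0) = (Set.Ioi x).indicator 1 u := by
    intro u; simp [Set.indicator_apply]
  simp only [this]
  rw [lintegral_indicator_one measurableSet_Ioi, Measure.restrict_apply measurableSet_Ioi,
    Set.inter_comm, Set.Ioo_inter_Ioi, sup_of_le_right hx.1, Real.volume_Ioo]

theorem ofReal_one_sub_sq_eq_lintegral {x : ℝ} (hx : x ∈ Set.Icc (0 : ℝ) 1) :
    ENNReal.ofReal ((1 - x) ^ 2) =
      ∫⁻ u in Set.Ioo (0 : ℝ) 1, if x < u then ENNReal.ofReal (2 * (1 - u)) else 0 := by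
  have : ∀ u, (if x < u then ENNReal.ofReal (2 * (1 - u)) else 0) =
      (Set.Ioi x).indicator (fun u => ENNReal.ofReal (2 * (1 - u))) u := by
    intro u; simp [Set.indicator_apply]
  simp only [this]
  rw [lintegral_indicator measurableSet_Ioi, Measure.restrict_restrict measurableSet_Ioi,
    Set.inter_comm, Set.Ioo_inter_Ioi, sup_of_le_right hx.1,
    Measure.restrict_congr_set Ioo_ae_eq_Ioc,
    ← ofReal_integral_eq_lintegral_ofReal, ← intervalIntegral.integral_of_le hx.2]
  · have hi : ∫ u in x..1, (1 - u) = (1 - x) - (1 ^ 2 - x ^ 2) / 2 := by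
      rw [intervalIntegral.integral_sub (by simp) (by simp), integral_id]
      simp
    rw [intervalIntegral.integral_const_mul, hi]
    congr 1
    ring
  · exact (Continuous.intervalIntegrable (by fun_prop) _ _).1
  · filter_upwards [ae_restrict_mem measurableSet_Ioc] with u hu
    have := hu.2
    simp only [Pi.zero_apply]
    linarith

/-- This is the normalization of the beta density, multiplied out. -/
theorem lintegral_beta {x y : ℝ} (hx : 0 < x) (hy : 0 < y) :
    ∫⁻ u in Set.Ioo (0 : ℝ) 1, ENNReal.ofReal (u ^ (x - 1) * (1 - u) ^ (y - 1)) =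
      ENNReal.ofReal (ProbabilityTheory.beta x y) := by
  have h1 := ProbabilityTheory.lintegral_betaPDF_eq_one hx hy
  rw [ProbabilityTheory.lintegral_betaPDF] at h1
  have hb := ProbabilityTheory.beta_pos hx hy
  have h2 : ∀ u : ℝ, ENNReal.ofReal
      (1 / ProbabilityTheory.beta x y * u ^ (x - 1) * (1 - u) ^ (y - 1)) =
      ENNReal.ofReal (1 / ProbabilityTheory.beta x y) *
        ENNReal.ofReal (u ^ (x - 1) * (1 - u) ^ (y - 1)) := by
    intro u
    rw [mul_assoc, ENNReal.ofReal_mul (by positivity)]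
  simp only [h2] at h1
  rw [lintegral_const_mul' _ _ ENNReal.ofReal_ne_top] at h1
  have h3 : ENNReal.ofReal (ProbabilityTheory.beta x y) *
      ENNReal.ofReal (1 / ProbabilityTheory.beta x y) = 1 := by
    rw [← ENNReal.ofReal_mul hb.le, mul_one_div_cancel hb.ne', ENNReal.ofReal_one]
  calc _ = (ENNReal.ofReal (ProbabilityTheory.beta x y) *
      ENNReal.ofReal (1 / ProbabilityTheory.beta x y)) * _ := by rw [h3, one_mul]
    _ = _ := by rw [mul_assoc, h1, mul_one]

theorem beta_add_one {x y : ℝ} (hx : 0 < x) (hy : 0 < y) :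
    ProbabilityTheory.beta x (y + 1) = y / (x + y) * ProbabilityTheory.beta x y := by
  have h1 : (Real.Gamma (x + y)) ≠ 0 := (Real.Gamma_pos_of_pos (by positivity)).ne'
  rw [ProbabilityTheory.beta, ProbabilityTheory.beta, Real.Gamma_add_one hy.ne', ← add_assoc,
    Real.Gamma_add_one (by positivity)]
  have : x + y ≠ 0 := by positivity
  field_simp

section

variable {d : ℕ} {W ρ k : Space d → ℝ} {Θ : ℝ → ℝ} {α β τ σ : ℝ}

/-- The layer density of `1 - x` is 1, so the integral over levels is that of `u^τ (1 - u)^{σ-1}`.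
-/
theorem lintegral_one_sub_mul (hd : 0 < d)
    (hαβ : 0 < α / β) (hΘ : Measurable Θ) (hΘ0 : ∀ u ∈ Set.Ioo (0 : ℝ) 1, 0 < Θ u)
    (hτ : 0 ≤ τ) (hσ : 0 < σ)
    (hΘτ : ∀ u ∈ Set.Ioo (0 : ℝ) 1, Θ u ^ (α / β) = u ^ τ * (1 - u) ^ (σ - 1))
    (hW : AEMeasurable W volume) (hρ : AEMeasurable ρ volume)
    (hWh : ∀ t : Space d, t ≠ 0 → ∀ r : ℝ, 0 < r → W (r • t) = r ^ (α - d) * W t)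
    (hρh : ∀ t : Space d, t ≠ 0 → ∀ r : ℝ, 0 < r → ρ (r • t) = r ^ β * ρ t)
    (hρ0 : ∀ᵐ ω : Metric.sphere (0 : Space d) 1 ∂sphereMeasure d, 0 < ρ ω)
    (hk : ∀ᵐ t, k t ∈ Set.Icc (0 : ℝ) 1 ∧ ∀ u ∈ Set.Ioo (0 : ℝ) 1, k t < u ↔ ρ t < Θ u) :
    ∫⁻ t, ENNReal.ofReal (1 - k t) * ENNReal.ofReal (W t) =
      ENNReal.ofReal (ProbabilityTheory.beta (τ + 1) σ / |α|) *
      ∫⁻ ω : Metric.sphere (0 : Space d) 1, ENNReal.ofReal (W ω * ρ ω ^ (-(α / β)))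
        ∂sphereMeasure d := by
  rw [lintegral_layer hd (h := fun x => 1 - x) (m := fun _ => 1) hαβ hΘ hΘ0 measurable_const
    (fun x hx => ofReal_one_sub_eq_lintegral hx) hW hρ hWh hρh hρ0 hk]
  congr 1
  rw [div_eq_inv_mul (ProbabilityTheory.beta (τ + 1) σ), ENNReal.ofReal_mul (by positivity),
    ← lintegral_beta (by positivity) hσ,
    ← lintegral_const_mul' _ _ ENNReal.ofReal_ne_top]
  refine setLIntegral_congr_fun measurableSet_Ioo fun u hu => ?_
  rw [hΘτ u hu, ENNReal.ofReal_one, one_mul, ← ENNReal.ofReal_mul (by positivity),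
    add_sub_cancel_right, div_eq_inv_mul]

/-- The layer density `2(1 - u)` raises the second beta parameter by one. By `beta_add_one` the
result differs from `lintegral_one_sub_mul` only by the factor `2σ / (1 + τ + σ)`. -/
theorem lintegral_one_sub_sq_mul (hd : 0 < d)
    (hαβ : 0 < α / β) (hΘ : Measurable Θ) (hΘ0 : ∀ u ∈ Set.Ioo (0 : ℝ) 1, 0 < Θ u)
    (hτ : 0 ≤ τ) (hσ : 0 < σ)
    (hΘτ : ∀ u ∈ Set.Ioo (0 : ℝ) 1, Θ u ^ (α / β) = u ^ τ * (1 - u) ^ (σ - 1))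
    (hW : AEMeasurable W volume) (hρ : AEMeasurable ρ volume)
    (hWh : ∀ t : Space d, t ≠ 0 → ∀ r : ℝ, 0 < r → W (r • t) = r ^ (α - d) * W t)
    (hρh : ∀ t : Space d, t ≠ 0 → ∀ r : ℝ, 0 < r → ρ (r • t) = r ^ β * ρ t)
    (hρ0 : ∀ᵐ ω : Metric.sphere (0 : Space d) 1 ∂sphereMeasure d, 0 < ρ ω)
    (hk : ∀ᵐ t, k t ∈ Set.Icc (0 : ℝ) 1 ∧ ∀ u ∈ Set.Ioo (0 : ℝ) 1, k t < u ↔ ρ t < Θ u) :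
    ∫⁻ t, ENNReal.ofReal ((1 - k t) ^ 2) * ENNReal.ofReal (W t) =
      ENNReal.ofReal (2 * σ / (1 + τ + σ) * (ProbabilityTheory.beta (τ + 1) σ / |α|)) *
      ∫⁻ ω : Metric.sphere (0 : Space d) 1, ENNReal.ofReal (W ω * ρ ω ^ (-(α / β)))
        ∂sphereMeasure d := by
  rw [lintegral_layer hd (h := fun x => (1 - x) ^ 2) (m := fun u => 2 * (1 - u)) hαβ hΘ hΘ0
    (by fun_prop) (fun x hx => ofReal_one_sub_sq_eq_lintegral hx) hW hρ hWh hρh hρ0 hk]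
  congr 1
  have h1 : 2 * σ / (1 + τ + σ) * (ProbabilityTheory.beta (τ + 1) σ / |α|) =
      (2 / |α|) * ProbabilityTheory.beta (τ + 1) (σ + 1) := by
    rw [beta_add_one (by positivity) hσ]
    ring
  rw [h1, ENNReal.ofReal_mul (by positivity), ← lintegral_beta (by positivity) (by positivity),
    ← lintegral_const_mul' _ _ ENNReal.ofReal_ne_top]
  refine setLIntegral_congr_fun measurableSet_Ioo fun u hu => ?_
  have hu1 : 0 < 1 - u := sub_pos.2 hu.2
  rw [hΘτ u hu, ← ENNReal.ofReal_mul (by positivity), ← ENNReal.ofReal_mul (by positivity)]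
  congr 1
  rw [add_sub_cancel_right, add_sub_cancel_right]
  have : (1 - u) ^ σ = (1 - u) ^ (σ - 1) * (1 - u) := by
    rw [Real.rpow_sub_one hu1.ne']; field_simp
  rw [this]
  ring

end

/-! ### Exponents -/

theorem recip_top : recip ∞ = 0 := by simp [recip]

theorem recip_nonneg (p : ℝ≥0∞) : 0 ≤ recip p := ENNReal.toReal_nonneg

theorem recip_eq (p : ℝ≥0∞) : recip p = p.toReal⁻¹ := ENNReal.toReal_inv p

theorem recip_le_one {p : ℝ≥0∞} (hp : 1 ≤ p) : recip p ≤ 1 := by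
  rw [recip, ← ENNReal.toReal_one]
  exact ENNReal.toReal_mono ENNReal.one_ne_top (ENNReal.inv_le_one.2 hp)

theorem one_le_toReal {p : ℝ≥0∞} (hp : 1 ≤ p) (hpt : p ≠ ∞) : 1 ≤ p.toReal := by
  rw [← ENNReal.toReal_one]
  exact ENNReal.toReal_mono hpt hp

section Exponents

variable {d : ℕ} {p : ℝ≥0∞} {ν η : ℝ}

/-- Since `1/p ≤ 1` and `0 < γ₁ < 1`, the denominator of `q1` is at least `(1 - γ₁)/2`. The product
relation is what every later exponent identity reduces to. -/
theorem q1_mul (hp : 1 ≤ p) (hγ : gamma1 d p ν η ∈ Set.Ioo 0 1) :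
    0 < q1 d p ν η ∧ q1 d p ν η * (1 / 2 + gamma1 d p ν η * (1 / 2 - recip p)) = 1 := by
  have h1 := recip_le_one hp
  have : 0 < 1 / 2 + gamma1 d p ν η * (1 / 2 - recip p) := by nlinarith [hγ.1, hγ.2]
  exact ⟨one_div_pos.2 this, one_div_mul_cancel this.ne'⟩

theorem scale_ne_zero (hγ : gamma1 d p ν η ∈ Set.Ioo 0 1) :
    ν + d * (1 / 2 - recip p) ≠ 0 := by
  intro h
  have := hγ.1
  -- With the convention `x / 0 = 0` a vanishing denominator would give `γ₁ = 0`.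
  rw [gamma1, h, div_zero] at this
  exact lt_irrefl _ this

theorem gamma1_mul_scale (hγ : gamma1 d p ν η ∈ Set.Ioo 0 1) :
    gamma1 d p ν η * (ν + d * (1 / 2 - recip p)) = ν - η - d / 2 :=
  div_mul_cancel₀ _ (scale_ne_zero hγ)

/-- The degree of homogeneity of `rhoFun`. -/
noncomputable def rhoDegree (p : ℝ≥0∞) (ν η : ℝ) : ℝ :=
  if p = ∞ then η - 2 * ν else η * (p.toReal - 2) - 2 * ν * (p.toReal - 1)

/-- The exponent `τ` of the level sets of `rhoFun`. -/
noncomputable def rhoExponent (d : ℕ) (p : ℝ≥0∞) (ν η : ℝ) : ℝ :=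
  if p = ∞ then gamma1 d p ν η * q1 d p ν η else gamma1 d p ν η * q1 d p ν η * recip p

theorem rhoExponent_pos (hp : 1 ≤ p) (hγ : gamma1 d p ν η ∈ Set.Ioo 0 1) :
    0 < rhoExponent d p ν η := by
  have hq := (q1_mul hp hγ).1
  have := hγ.1
  unfold rhoExponent
  split_ifs with h
  · positivity
  · have : 0 < recip p := by
      rw [recip_eq]
      have := one_le_toReal hp h
      positivity
    positivity

/-- The numerator is the degree of `|ψ|² / s₂` plus `d`, so the quotient is the exponent `α/β` of
`lintegral_sublevel`. Both degrees are multiples of `ν + d(1/2 - 1/p)`: the numerator is `-2γ₁`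
times it, and `q₁` times the denominator is `-2p` times it (`-2` times it for `p = ∞`). -/
theorem div_rhoDegree (hp : 1 ≤ p) (hγ : gamma1 d p ν η ∈ Set.Ioo 0 1) :
    (2 * (η - ν) + d) / rhoDegree p ν η = rhoExponent d p ν η := by
  obtain ⟨hq, hq1⟩ := q1_mul hp hγ
  have ha := gamma1_mul_scale hγ
  have hb := scale_ne_zero hγ
  have hr := recip_eq p
  set γ := gamma1 d p ν η
  set q := q1 d p ν η
  set r := recip p
  have hα : 2 * (η - ν) + d = -2 * (γ * (ν + d * (1 / 2 - r))) := by rw [ha]; ring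
  by_cases h : p = ∞
  · have hr0 : r = 0 := by rw [hr, h]; simp
    rw [rhoDegree, rhoExponent, if_pos h, if_pos h]
    have hβ : (η - 2 * ν) * q = -2 * (ν + d * (1 / 2 - r)) := by
      have : η - 2 * ν = -2 * (ν + d * (1 / 2 - r)) * (1 / 2 + γ * (1 / 2 - r)) := by
        rw [mul_add, mul_assoc (-2) _ (γ * _),
          show (ν + d * (1 / 2 - r)) * (γ * (1 / 2 - r)) =
            γ * (ν + d * (1 / 2 - r)) * (1 / 2 - r) by ring, ha, hr0]
        ring
      rw [this, mul_assoc, mul_comm _ q, hq1, mul_one]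
    have hβ0 : η - 2 * ν ≠ 0 := by
      intro h0
      rw [h0, zero_mul] at hβ
      exact hb (by linarith)
    rw [div_eq_iff hβ0, hα]
    linear_combination γ * (-hβ)
  · have hP := one_le_toReal hp h
    rw [rhoDegree, rhoExponent, if_neg h, if_neg h]
    set P := p.toReal
    have hPr : P * r = 1 := by rw [hr]; exact mul_inv_cancel₀ (by positivity)
    have hβ : (η * (P - 2) - 2 * ν * (P - 1)) * q = -2 * P * (ν + d * (1 / 2 - r)) := by
      have : η * (P - 2) - 2 * ν * (P - 1) =
          -2 * P * (ν + d * (1 / 2 - r)) * (1 / 2 + γ * (1 / 2 - r)) := by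
        rw [mul_add, mul_assoc (-2 * P) _ (γ * _),
          show (ν + d * (1 / 2 - r)) * (γ * (1 / 2 - r)) =
            γ * (ν + d * (1 / 2 - r)) * (1 / 2 - r) by ring, ha]
        linear_combination 2 * (η - ν) * hPr
      rw [this, mul_assoc, mul_comm _ q, hq1, mul_one]
    have hβ0 : η * (P - 2) - 2 * ν * (P - 1) ≠ 0 := by
      intro h0
      rw [h0, zero_mul] at hβ
      refine hb ?_
      have : P * (ν + d * (1 / 2 - r)) = 0 := by linarith
      exact (mul_eq_zero.1 this).resolve_left (by positivity)
    rw [div_eq_iff hβ0, hα]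
    linear_combination -γ * r * hβ + 2 * γ * (ν + d * (1 / 2 - r)) * hPr

theorem tau_add_sigma (hp : 1 ≤ p) (hγ : gamma1 d p ν η ∈ Set.Ioo 0 1) :
    1 + q1 d p ν η * gamma1 d p ν η * recip p + q1 d p ν η * (1 - gamma1 d p ν η) / 2 =
      q1 d p ν η := by
  linear_combination -(q1_mul hp hγ).2

theorem abs_degree : |2 * (η - ν) + d| = 2 * |ν - η - d / 2| := by
  rw [← abs_two, ← abs_mul, ← abs_neg, abs_two]
  congr 1
  ring

end Exponents

/-! ### The function `k` -/

section Multiplier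

variable {d n : ℕ} {p : ℝ≥0∞} {ψ : Space d → ℂ} {φ : Fin n → Space d → ℂ}

/-- A function whose sublevel sets are those of `kFun`. -/
noncomputable def rhoFun (p : ℝ≥0∞) (ψ : Space d → ℂ) (φ : Fin n → Space d → ℂ) (t : Space d) : ℝ :=
  if p = ∞ then ‖ψ t‖ / s2 φ t
  else (2 * Real.pi) ^ d * ‖ψ t‖ ^ (p.toReal - 2) / s2 φ t ^ (p.toReal - 1)

/-- The value of `rhoFun` where `kFun` takes the value `u`. -/
noncomputable def thetaFun (p : ℝ≥0∞) (u : ℝ) : ℝ :=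
  if p = ∞ then 1 / (1 - u) else u / (1 - u) ^ (p.toReal - 1)

theorem measurable_thetaFun : Measurable (thetaFun p) := by
  unfold thetaFun
  split_ifs <;> fun_prop

theorem thetaFun_pos {u : ℝ} (hu : u ∈ Set.Ioo (0 : ℝ) 1) : 0 < thetaFun p u := by
  have h0 := hu.1
  have h1 : 0 < 1 - u := sub_pos.2 hu.2
  unfold thetaFun
  split_ifs <;> positivity

theorem div_one_sub_rpow_lt_iff {r x y : ℝ} (hr : 0 < r) (hx : x ∈ Set.Ico (0 : ℝ) 1)
    (hy : y ∈ Set.Ico (0 : ℝ) 1) : x / (1 - x) ^ r < y / (1 - y) ^ r ↔ x < y := by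
  have key : ∀ {x y : ℝ}, x ∈ Set.Ico (0 : ℝ) 1 → y ∈ Set.Ico (0 : ℝ) 1 → x < y →
      x / (1 - x) ^ r < y / (1 - y) ^ r := by
    intro x y hx hy h
    have hy1 : 0 < 1 - y := sub_pos.2 hy.2
    exact div_lt_div₀ h (Real.rpow_le_rpow hy1.le (by linarith) hr.le) hy.1
      (Real.rpow_pos_of_pos hy1 r)
  refine ⟨fun h => ?_, key hx hy⟩
  by_contra! hle
  rcases hle.eq_or_lt with rfl | hlt
  · exact lt_irrefl _ h
  · exact lt_asymm h (key hy hx hlt)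

theorem kFun_top (t : Space d) : kFun ∞ ψ φ t = max (1 - s2 φ t / ‖ψ t‖) 0 := by simp [kFun]

theorem kFun_one (t : Space d) : kFun 1 ψ φ t = min 1 ((2 * Real.pi) ^ d / ‖ψ t‖) := by
  simp [kFun]

theorem s2_nonneg (t : Space d) : 0 ≤ s2 φ t := Finset.sum_nonneg fun _ _ => by positivity

theorem kFun_spec (hp : 1 < p) (hpt : p ≠ ∞) (t : Space d) :
    kFun p ψ φ t ∈ Set.Ico (0 : ℝ) 1 ∧
      kFun p ψ φ t / (1 - kFun p ψ φ t) ^ (p.toReal - 1) = rhoFun p ψ φ t := by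
  have hP : 1 < p.toReal := by
    rw [← ENNReal.toReal_one]; exact ENNReal.toReal_strict_mono hpt hp
  have hs := s2_nonneg (φ := φ) t
  have hex := (existsUnique_root (r := p.toReal - 1)
    (R := (2 * Real.pi) ^ d * ‖ψ t‖ ^ (p.toReal - 2) / s2 φ t ^ (p.toReal - 1))
    (by linarith) (by positivity)).exists
  have h1 : kFun p ψ φ t = hex.choose := by
    simp only [kFun, hpt, hp.ne', if_false]
    rw [dif_pos hex]
  rw [h1, rhoFun, if_neg hpt]
  exact hex.choose_spec

theorem kFun_mem_Icc (hp : 1 ≤ p) (t : Space d) : kFun p ψ φ t ∈ Set.Icc (0 : ℝ) 1 := by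
  have hs := s2_nonneg (φ := φ) t
  by_cases hpt : p = ∞
  · rw [hpt, kFun_top]
    refine ⟨le_max_right _ _, max_le ?_ zero_le_one⟩
    have : 0 ≤ s2 φ t / ‖ψ t‖ := by positivity
    linarith
  rcases hp.eq_or_lt with rfl | hp
  · rw [kFun_one]
    exact ⟨le_min zero_le_one (by positivity), min_le_left _ _⟩
  · exact Set.Ico_subset_Icc_self (kFun_spec hp hpt t).1

/-- For `1 < p < ∞` this is strict monotonicity of `u / (1 - u)^{p-1}`. At the endpoints the formula
for `k` is explicit: `u < 1` makes the cap in the minimum irrelevant for `p = 1`, and `0 < u` does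
the same for the truncation at 0 for `p = ∞`. -/
theorem kFun_lt_iff (hp : 1 ≤ p) {t : Space d} (hψ : ψ t ≠ 0) (hs : 0 < s2 φ t) {u : ℝ}
    (hu : u ∈ Set.Ioo (0 : ℝ) 1) : kFun p ψ φ t < u ↔ rhoFun p ψ φ t < thetaFun p u := by
  have hψ0 : 0 < ‖ψ t‖ := norm_pos_iff.2 hψ
  have hu0 := hu.1
  have hu1 : 0 < 1 - u := sub_pos.2 hu.2
  by_cases hpt : p = ∞
  · rw [hpt, kFun_top, rhoFun, thetaFun, if_pos rfl, if_pos rfl, max_lt_iff, and_iff_left hu0,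
      div_lt_div_iff₀ hs hu1, sub_lt_comm, lt_div_iff₀ hψ0]
    rw [one_mul, mul_comm]
  rcases hp.eq_or_lt with rfl | hp
  · rw [kFun_one, rhoFun, thetaFun, if_neg hpt, if_neg hpt, min_lt_iff, or_iff_right hu.2.not_gt]
    norm_num
    rw [Real.rpow_neg_one, div_eq_mul_inv]
  · have hP : 1 < p.toReal := by
      rw [← ENNReal.toReal_one]; exact ENNReal.toReal_strict_mono hpt hp
    obtain ⟨h1, h2⟩ := kFun_spec (ψ := ψ) (φ := φ) hp hpt t
    rw [← h2, thetaFun, if_neg hpt,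
      div_one_sub_rpow_lt_iff (by linarith) h1 (Set.Ioo_subset_Ico_self hu)]

theorem aemeasurable_s2 (hφ : ∀ j, AEStronglyMeasurable (φ j) volume) :
    AEMeasurable (s2 φ) volume :=
  Finset.aemeasurable_fun_sum _ fun j _ => (hφ j).norm.aemeasurable.pow_const 2

theorem aemeasurable_rhoFun (hψ : AEStronglyMeasurable ψ volume)
    (hφ : ∀ j, AEStronglyMeasurable (φ j) volume) : AEMeasurable (rhoFun p ψ φ) volume := by
  have h1 := hψ.norm.aemeasurable
  have h2 := aemeasurable_s2 hφ
  unfold rhoFun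
  split_ifs
  · exact h1.div h2
  · exact ((h1.pow_const _).const_mul _).div (h2.pow_const _)

/-- The roots are chosen pointwise, so measurability is not visible from the definition. By
`kFun_lt_iff`, `1 - k` is almost everywhere the measure of the levels `u` with `ρ < Θ(u)`, an
antitone function of the measurable `ρ`. -/
theorem aemeasurable_kFun (hp : 1 ≤ p) (hψ : AEStronglyMeasurable ψ volume)
    (hφ : ∀ j, AEStronglyMeasurable (φ j) volume) (hpos : ∀ᵐ t, ψ t ≠ 0 ∧ 0 < s2 φ t) :
    AEMeasurable (kFun p ψ φ) volume := by
  let K : ℝ → ℝ≥0∞ := fun x => ∫⁻ u in Set.Ioo (0 : ℝ) 1,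
    if x < thetaFun p u then ENNReal.ofReal 1 else 0
  have hK : Antitone K := by
    intro x y hxy
    refine lintegral_mono fun u => ?_
    simp only
    split_ifs with h1 h2
    · exact le_rfl
    · exact absurd (hxy.trans_lt h1) h2
    · exact zero_le
    · exact le_rfl
  refine ((hK.measurable.comp_aemeasurable (aemeasurable_rhoFun (p := p) hψ hφ)).ennreal_toReal
    |>.const_sub 1).congr ?_
  filter_upwards [hpos] with t ht
  have hk := kFun_mem_Icc (ψ := ψ) (φ := φ) hp t
  have : K (rhoFun p ψ φ t) = ENNReal.ofReal (1 - kFun p ψ φ t) := by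
    rw [ofReal_one_sub_eq_lintegral hk]
    refine setLIntegral_congr_fun measurableSet_Ioo fun u hu => ?_
    simp only [kFun_lt_iff hp ht.1 ht.2 hu]
  simp only [Function.comp, this]
  rw [ENNReal.toReal_ofReal (by linarith [hk.2])]
  ring

/-- The bound `k < 1` matters only for `p = 1`, where the minimum may be capped and the equation
fails. -/
theorem kFun_eq (hp : 1 ≤ p) (hpt : p ≠ ∞) {t : Space d}
    (hk : kFun p ψ φ t < 1) :
    kFun p ψ φ t = rhoFun p ψ φ t * (1 - kFun p ψ φ t) ^ (p.toReal - 1) := by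
  rcases hp.eq_or_lt with rfl | hp
  · rw [kFun_one] at *
    rw [rhoFun, if_neg hpt, min_eq_right ((min_lt_iff.1 hk).resolve_left (lt_irrefl _)).le]
    norm_num
    rw [Real.rpow_neg_one, div_eq_mul_inv]
  · have h1 : (0 : ℝ) < (1 - kFun p ψ φ t) ^ (p.toReal - 1) :=
      Real.rpow_pos_of_pos (sub_pos.2 hk) _
    rw [← (kFun_spec (ψ := ψ) (φ := φ) hp hpt t).2, div_mul_cancel₀ _ h1.ne']

/-- The modulus of the unscaled extremal function. -/
noncomputable def extremalAbs (p : ℝ≥0∞) (ψ : Space d → ℂ) (φ : Fin n → Space d → ℂ)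
    (t : Space d) : ℝ :=
  (1 - kFun p ψ φ t) * ‖ψ t‖ / s2 φ t

theorem extremalAbs_nonneg (hp : 1 ≤ p) (t : Space d) : 0 ≤ extremalAbs p ψ φ t := by
  have := (kFun_mem_Icc (ψ := ψ) (φ := φ) hp t).2
  have h2 := s2_nonneg (φ := φ) t
  unfold extremalAbs
  have : 0 ≤ 1 - kFun p ψ φ t := by linarith
  positivity

/-- Substitute the defining equation of `k`; where `k = 1`, possible only for `p = 1` here, both
sides vanish. The `L_p` norm of the extremal function is thereby an integral of `k(1 - k)|ψ|² / s₂`.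
-/
theorem extremalAbs_rpow (hp : 1 ≤ p) (hpt : p ≠ ∞) {t : Space d} (hψ : ψ t ≠ 0)
    (hs : 0 < s2 φ t) :
    (2 * Real.pi) ^ d * extremalAbs p ψ φ t ^ p.toReal =
      kFun p ψ φ t * (1 - kFun p ψ φ t) * (‖ψ t‖ ^ 2 / s2 φ t) := by
  have hP := one_le_toReal hp hpt
  have hψ0 : 0 < ‖ψ t‖ := norm_pos_iff.2 hψ
  unfold extremalAbs
  rcases (kFun_mem_Icc (ψ := ψ) (φ := φ) hp t).2.eq_or_lt with h | h
  · rw [h]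
    simp [Real.zero_rpow (by positivity : p.toReal ≠ 0)]
  · have h1 : 0 < 1 - kFun p ψ φ t := sub_pos.2 h
    nth_rw 2 [kFun_eq hp hpt h]
    rw [rhoFun, if_neg hpt, Real.div_rpow (by positivity) hs.le,
      Real.mul_rpow h1.le hψ0.le, Real.rpow_sub_one hs.ne', Real.rpow_sub_one h1.ne',
      Real.rpow_sub hψ0, Real.rpow_two]
    field_simp

theorem eLpNorm_le_of_rpow_le {p : ℝ≥0∞} (hp : 1 ≤ p) (hpt : p ≠ ∞) {f : Space d → ℂ}
    {F : Space d → ℝ} {c : ℝ} (hc : 0 ≤ c) (hf : ∀ᵐ t, ‖f t‖ ^ p.toReal ≤ F t)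
    (hF : ∫⁻ t, ENNReal.ofReal (F t) ≤ ENNReal.ofReal c) :
    eLpNorm f p volume ≤ ENNReal.ofReal (c ^ recip p) := by
  have hP := one_le_toReal hp hpt
  rw [eLpNorm_eq_lintegral_rpow_enorm_toReal (by positivity) hpt, recip_eq, one_div,
    ← ENNReal.ofReal_rpow_of_nonneg hc (by positivity)]
  refine ENNReal.rpow_le_rpow ((lintegral_mono_ae ?_).trans hF) (by positivity)
  filter_upwards [hf] with t ht
  rw [← ofReal_norm, ENNReal.ofReal_rpow_of_nonneg (norm_nonneg _) (by positivity)]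
  exact ENNReal.ofReal_le_ofReal ht

theorem lintegral_ofReal_const_mul {c : ℝ} (hc : 0 ≤ c) (F : Space d → ℝ) :
    ∫⁻ t, ENNReal.ofReal (c * F t) = ENNReal.ofReal c * ∫⁻ t, ENNReal.ofReal (F t) := by
  rw [← lintegral_const_mul' _ _ ENNReal.ofReal_ne_top]
  simp only [ENNReal.ofReal_mul hc]

theorem eLpNorm_extremalAbs_le (hp : 1 ≤ p) (hpos : ∀ᵐ t, ψ t ≠ 0 ∧ 0 < s2 φ t) {Q : ℝ}
    (hQ : 0 ≤ Q)
    (hint : ∫⁻ t, ENNReal.ofReal (kFun p ψ φ t * (1 - kFun p ψ φ t) * (‖ψ t‖ ^ 2 / s2 φ t)) ≤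
      ENNReal.ofReal Q) :
    eLpNorm (fun t => (extremalAbs p ψ φ t : ℂ)) p volume ≤
      ENNReal.ofReal ((Q / (2 * Real.pi) ^ d) ^ recip p) := by
  by_cases hpt : p = ∞
  -- For `p = ∞` the claim is that the extremal function is bounded by 1, that is `1 - k ≤ s₂ /
  -- |ψ|`.
  · rw [hpt, recip_top, Real.rpow_zero, eLpNorm_exponent_top]
    refine eLpNormEssSup_le_of_ae_enorm_bound ?_
    filter_upwards [hpos] with t ht
    have hψ0 : 0 < ‖ψ t‖ := norm_pos_iff.2 ht.1
    rw [← ofReal_norm, Complex.norm_real, Real.norm_of_nonneg (extremalAbs_nonneg le_top t)]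
    refine ENNReal.ofReal_le_ofReal ?_
    rw [extremalAbs, kFun_top, div_le_one ht.2, ← le_div_iff₀ hψ0]
    linarith [le_max_left (1 - s2 φ t / ‖ψ t‖) 0]
  · refine eLpNorm_le_of_rpow_le hp hpt (by positivity) (F := fun t => ((2 * Real.pi) ^ d)⁻¹ *
      (kFun p ψ φ t * (1 - kFun p ψ φ t) * (‖ψ t‖ ^ 2 / s2 φ t))) ?_ ?_
    · filter_upwards [hpos] with t ht
      rw [← extremalAbs_rpow hp hpt ht.1 ht.2, inv_mul_cancel_left₀ (by positivity),
        Complex.norm_real, Real.norm_of_nonneg (extremalAbs_nonneg hp t)]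
    · rw [lintegral_ofReal_const_mul (by positivity), div_eq_inv_mul,
        ENNReal.ofReal_mul (by positivity)]
      exact mul_le_mul_right hint _

/-- The exponent conjugate to `p`. -/
noncomputable def conjExp (p : ℝ≥0∞) : ℝ≥0∞ := (1 - p⁻¹)⁻¹

theorem holderConjugate_conjExp (hp : 1 ≤ p) : ENNReal.HolderConjugate p (conjExp p) :=
  ENNReal.HolderConjugate.inv_one_sub_inv' hp

theorem recip_conjExp (hp : 1 ≤ p) : recip (conjExp p) = 1 - recip p := by
  rw [recip, conjExp, inv_inv, ENNReal.toReal_sub_of_le (ENNReal.inv_le_one.2 hp)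
    ENNReal.one_ne_top, ENNReal.toReal_one, recip]

/-- This proportionality is the case of equality in Hölder's inequality between `kψ` and the
extremal function. -/
theorem kFun_mul_eq (hp : 1 ≤ p) (hpt : p ≠ ∞) {t : Space d} (hψ : ψ t ≠ 0) (hs : 0 < s2 φ t)
    (hk : kFun p ψ φ t < 1) :
    kFun p ψ φ t * ‖ψ t‖ = (2 * Real.pi) ^ d * extremalAbs p ψ φ t ^ (p.toReal - 1) := by
  have hψ0 : 0 < ‖ψ t‖ := norm_pos_iff.2 hψ
  have h1 : 0 < 1 - kFun p ψ φ t := sub_pos.2 hk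
  unfold extremalAbs
  nth_rw 1 [kFun_eq hp hpt hk]
  rw [rhoFun, if_neg hpt, Real.div_rpow (by positivity) hs.le, Real.mul_rpow h1.le hψ0.le,
    show p.toReal - 2 = p.toReal - 1 - 1 by ring, Real.rpow_sub_one hψ0.ne' (p.toReal - 1)]
  field_simp

theorem eLpNorm_kFun_mul_le (hp : 1 ≤ p) (hpos : ∀ᵐ t, ψ t ≠ 0 ∧ 0 < s2 φ t) {Q : ℝ}
    (hQ : 0 ≤ Q)
    (hint : ∫⁻ t, ENNReal.ofReal (kFun p ψ φ t * (1 - kFun p ψ φ t) * (‖ψ t‖ ^ 2 / s2 φ t)) ≤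
      ENNReal.ofReal Q) :
    eLpNorm (fun t => (kFun p ψ φ t : ℂ) * ψ t) (conjExp p) volume ≤
      ENNReal.ofReal (((2 * Real.pi) ^ d) ^ recip p * Q ^ (1 - recip p)) := by
  have hnorm : ∀ t, ‖(kFun p ψ φ t : ℂ) * ψ t‖ = kFun p ψ φ t * ‖ψ t‖ := fun t => by
    rw [norm_mul, Complex.norm_real, Real.norm_of_nonneg (kFun_mem_Icc hp t).1]
  by_cases hpt : p = ∞
  · have hc : conjExp p = 1 := by simp [conjExp, hpt]
    rw [hc, hpt, recip_top, Real.rpow_zero, one_mul, sub_zero, Real.rpow_one,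
      eLpNorm_one_eq_lintegral_enorm]
    rw [hpt] at hint hnorm
    refine (lintegral_mono_ae ?_).trans hint
    filter_upwards [hpos] with t ht
    have hψ0 : 0 < ‖ψ t‖ := norm_pos_iff.2 ht.1
    have hs := ht.2
    rw [← ofReal_norm, hnorm]
    refine ENNReal.ofReal_le_ofReal (le_of_eq ?_)
    -- Where `k > 0` one has `(1 - k)|ψ| = s₂`, so `k|ψ|` equals `k(1 - k)|ψ|² / s₂`; elsewhere both
    -- are 0.
    rw [kFun_top]
    rcases le_total (1 - s2 φ t / ‖ψ t‖) 0 with h | h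
    · rw [max_eq_right h]; simp
    · rw [max_eq_left h]
      field_simp
      ring
  rcases hp.eq_or_lt with rfl | hp1
  · have hc : conjExp 1 = ∞ := by simp [conjExp]
    have hr : recip 1 = 1 := by simp [recip]
    rw [hc, hr, sub_self, Real.rpow_zero, Real.rpow_one, mul_one, eLpNorm_exponent_top]
    refine eLpNormEssSup_le_of_ae_enorm_bound ?_
    filter_upwards [hpos] with t ht
    have hψ0 : 0 < ‖ψ t‖ := norm_pos_iff.2 ht.1
    rw [← ofReal_norm, hnorm, kFun_one]
    exact ENNReal.ofReal_le_ofReal ((le_div_iff₀ hψ0).1 (min_le_right _ _))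
  · have hP : 1 < p.toReal := by
      rw [← ENNReal.toReal_one]; exact ENNReal.toReal_strict_mono hpt hp1
    have hP1 : 0 < p.toReal - 1 := by linarith
    have hH := holderConjugate_conjExp hp
    have hc1 : 1 ≤ conjExp p := by simp [conjExp]
    have hrc := recip_conjExp hp
    have hct : conjExp p ≠ ∞ := by
      intro h
      rw [h, recip_top, recip_eq] at hrc
      have := inv_lt_one_of_one_lt₀ hP
      linarith
    have hcr : (conjExp p).toReal = p.toReal / (p.toReal - 1) := by
      rw [recip_eq, recip_eq] at hrc
      rw [← inv_inv (conjExp p).toReal, hrc]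
      field_simp
    have hlam : (0 : ℝ) < (2 * Real.pi) ^ d := by positivity
    -- With `p'` the conjugate exponent, `(k|ψ|)^{p'}` is `(2π)^{d(p'-1)} k(1 - k)|ψ|² / s₂`, and
    -- `(p' - 1)/p' = 1/p`.
    have h1 : ((2 * Real.pi) ^ d : ℝ) ^ recip p * Q ^ (1 - recip p) =
        (((2 * Real.pi) ^ d : ℝ) ^ ((conjExp p).toReal - 1) * Q) ^ recip (conjExp p) := by
      rw [Real.mul_rpow (by positivity) hQ, ← Real.rpow_mul hlam.le, hrc]
      congr 2
      rw [hcr, recip_eq]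
      field_simp
      ring
    rw [h1]
    refine eLpNorm_le_of_rpow_le hc1 hct (by positivity)
      (F := fun t => ((2 * Real.pi) ^ d : ℝ) ^ ((conjExp p).toReal - 1) *
      (kFun p ψ φ t * (1 - kFun p ψ φ t) * (‖ψ t‖ ^ 2 / s2 φ t))) ?_ ?_
    · filter_upwards [hpos] with t ht
      have hg := extremalAbs_nonneg (ψ := ψ) (φ := φ) hp t
      rw [hnorm, ← extremalAbs_rpow hp hpt ht.1 ht.2,
        kFun_mul_eq hp hpt ht.1 ht.2 (kFun_spec hp1 hpt t).1.2,
        Real.mul_rpow hlam.le (by positivity), ← Real.rpow_mul hg,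
        Real.rpow_sub_one hlam.ne', ← mul_assoc, div_mul_cancel₀ _ hlam.ne', hcr,
        mul_div_cancel₀ _ hP1.ne']
    · rw [lintegral_ofReal_const_mul (by positivity), ENNReal.ofReal_mul (by positivity)]
      exact mul_le_mul_right hint _

end Multiplier

/-! ### The integrals of the recovery problem -/

section Integrals

variable {d n : ℕ} {p : ℝ≥0∞} {ν η : ℝ} {ψ : Space d → ℂ} {φ : Fin n → Space d → ℂ}

theorem s2_smul (hφν : ∀ j, AbsHomogeneous (φ j) ν) {t : Space d} (ht : t ≠ 0) {r : ℝ}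
    (hr : 0 < r) : s2 φ (r • t) = r ^ (2 * ν) * s2 φ t := by
  rw [s2, s2, Finset.mul_sum]
  refine Finset.sum_congr rfl fun j _ => ?_
  rw [hφν j t ht r hr, mul_pow, ← Real.rpow_natCast (r ^ ν), ← Real.rpow_mul hr.le]
  congr 2
  push_cast
  ring

theorem s2_pos_iff (t : Space d) : 0 < s2 φ t ↔ ∑ j, ‖φ j t‖ ≠ 0 := by
  have h1 : (s2 φ t = 0) ↔ (∑ j, ‖φ j t‖ = 0) := by
    rw [s2, Finset.sum_eq_zero_iff_of_nonneg fun _ _ => by positivity,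
      Finset.sum_eq_zero_iff_of_nonneg fun _ _ => by positivity]
    simp
  rw [ne_eq, ← h1]
  exact (s2_nonneg t).lt_iff_ne.trans ne_comm

theorem ae_pos (hψ0 : ∀ᵐ t, ψ t ≠ 0) (hφ0 : ∀ᵐ t, ∑ j, ‖φ j t‖ ≠ 0) :
    ∀ᵐ t, ψ t ≠ 0 ∧ 0 < s2 φ t := by
  filter_upwards [hψ0, hφ0] with t h1 h2
  exact ⟨h1, (s2_pos_iff t).2 h2⟩

theorem ae_sphere_pos (hd : 0 < d) (hψη : AbsHomogeneous ψ η)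
    (hφν : ∀ j, AbsHomogeneous (φ j) ν) (hpos : ∀ᵐ t, ψ t ≠ 0 ∧ 0 < s2 φ t) :
    ∀ᵐ ω : Metric.sphere (0 : Space d) 1 ∂sphereMeasure d, ψ ω ≠ 0 ∧ 0 < s2 φ ω := by
  refine ae_sphere_of_ae hd hpos fun t ht r hr h => ⟨fun h0 => h.1 ?_, ?_⟩
  · rw [← norm_eq_zero, hψη t ht r hr, h0]; simp
  · have := h.2
    rw [s2_smul hφν ht hr] at this
    exact pos_of_mul_pos_right this (by positivity)

theorem rhoFun_smul (hψη : AbsHomogeneous ψ η) (hφν : ∀ j, AbsHomogeneous (φ j) ν) (t : Space d)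
    (ht : t ≠ 0) (r : ℝ) (hr : 0 < r) :
    rhoFun p ψ φ (r • t) = r ^ rhoDegree p ν η * rhoFun p ψ φ t := by
  unfold rhoFun rhoDegree
  have hs := s2_nonneg (φ := φ) t
  rw [hψη t ht r hr, s2_smul hφν ht hr]
  split_ifs
  · rw [Real.rpow_sub hr, mul_div_mul_comm]
  · rw [Real.mul_rpow (by positivity) (by positivity), Real.mul_rpow (by positivity) hs,
      ← Real.rpow_mul hr.le, ← Real.rpow_mul hr.le, Real.rpow_sub hr]
    have : r ^ (2 * ν * (p.toReal - 1)) ≠ 0 := (Real.rpow_pos_of_pos hr _).ne'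
    rw [← mul_assoc, mul_comm ((2 * Real.pi) ^ d) (r ^ _), mul_assoc, mul_div_mul_comm]

theorem rhoFun_pos {t : Space d} (hψ : ψ t ≠ 0) (hs : 0 < s2 φ t) : 0 < rhoFun p ψ φ t := by
  have hψ0 : 0 < ‖ψ t‖ := norm_pos_iff.2 hψ
  unfold rhoFun
  split_ifs <;> positivity

theorem weight_smul (hψη : AbsHomogeneous ψ η) (hφν : ∀ j, AbsHomogeneous (φ j) ν) {t : Space d}
    (ht : t ≠ 0) {r : ℝ} (hr : 0 < r) :
    ‖ψ (r • t)‖ ^ 2 / s2 φ (r • t) = r ^ (2 * (η - ν)) * (‖ψ t‖ ^ 2 / s2 φ t) := by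
  rw [hψη t ht r hr, s2_smul hφν ht hr, mul_pow, mul_div_mul_comm, mul_sub, Real.rpow_sub hr,
    mul_comm 2 η, Real.rpow_mul hr.le η 2, Real.rpow_two]

/-- The power of `2π` coming from the sublevel sets of `k`. -/
noncomputable def tauExp (d : ℕ) (p : ℝ≥0∞) (ν η : ℝ) : ℝ :=
  q1 d p ν η * gamma1 d p ν η * recip p

theorem tauExp_nonneg (hp : 1 ≤ p) (hγ : gamma1 d p ν η ∈ Set.Ioo 0 1) : 0 ≤ tauExp d p ν η :=
  mul_nonneg (mul_nonneg (q1_mul hp hγ).1.le hγ.1.le) (recip_nonneg p)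

/-- The exponent of `s₂` in the angular integral. -/
noncomputable def sigmaExp (d : ℕ) (p : ℝ≥0∞) (ν η : ℝ) : ℝ :=
  q1 d p ν η * (1 - gamma1 d p ν η) / 2

theorem sigmaExp_pos (hp : 1 ≤ p) (hγ : gamma1 d p ν η ∈ Set.Ioo 0 1) :
    0 < sigmaExp d p ν η :=
  div_pos (mul_pos (q1_mul hp hγ).1 (sub_pos.2 hγ.2)) two_pos

theorem toReal_mul_recip (hp : 1 ≤ p) (hpt : p ≠ ∞) : p.toReal * recip p = 1 := by
  have := one_le_toReal hp hpt
  rw [recip_eq]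
  exact mul_inv_cancel₀ (by positivity)

/-- The exponents fit the beta integral of the layer formula. For `p = ∞` the power of `u` is
trivial, in agreement with `tauExp` being 0. -/
theorem thetaFun_rpow (hp : 1 ≤ p) (hγ : gamma1 d p ν η ∈ Set.Ioo 0 1) {u : ℝ}
    (hu : u ∈ Set.Ioo (0 : ℝ) 1) :
    thetaFun p u ^ rhoExponent d p ν η =
      u ^ tauExp d p ν η * (1 - u) ^ (sigmaExp d p ν η - 1) := by
  have hu0 := hu.1
  have h1 : 0 < 1 - u := sub_pos.2 hu.2
  have hq := (q1_mul hp hγ).2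
  unfold thetaFun rhoExponent tauExp sigmaExp
  split_ifs with hpt
  · have h0 : recip p = 0 := by rw [hpt, recip_top]
    rw [h0] at hq ⊢
    rw [mul_zero, Real.rpow_zero, one_mul, Real.div_rpow zero_le_one h1.le, Real.one_rpow, one_div,
      ← Real.rpow_neg h1.le]
    congr 1
    linarith
  · have hP := toReal_mul_recip hp hpt
    rw [Real.div_rpow hu0.le (by positivity), ← Real.rpow_mul h1.le, div_eq_mul_inv,
      ← Real.rpow_neg h1.le]
    congr 2
    · ring
    · linear_combination (-(gamma1 d p ν η * q1 d p ν η)) * hP - hq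

/-- The angular density produced by `lintegral_sublevel` is the integrand of `I` up to a power of
`2π`; this is where the exponents `q₁` and `q₁(1 - γ₁)/2` originate. -/
theorem weight_mul_rhoFun_rpow (hp : 1 ≤ p) (hγ : gamma1 d p ν η ∈ Set.Ioo 0 1) {t : Space d}
    (hψ : ψ t ≠ 0) (hs : 0 < s2 φ t) :
    ‖ψ t‖ ^ 2 / s2 φ t * rhoFun p ψ φ t ^ (-rhoExponent d p ν η) =
      ((2 * Real.pi) ^ d) ^ (-tauExp d p ν η) *
        (‖ψ t‖ ^ q1 d p ν η / s2 φ t ^ (q1 d p ν η * (1 - gamma1 d p ν η) / 2)) := by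
  have hψ0 : 0 < ‖ψ t‖ := norm_pos_iff.2 hψ
  have hq := (q1_mul hp hγ).2
  have hlam : (0 : ℝ) < (2 * Real.pi) ^ d := by positivity
  have e1 : ‖ψ t‖ ^ 2 / s2 φ t = ‖ψ t‖ ^ (2 : ℝ) * s2 φ t ^ (-1 : ℝ) := by
    rw [Real.rpow_two, Real.rpow_neg_one, div_eq_mul_inv]
  have e2 : ‖ψ t‖ ^ q1 d p ν η / s2 φ t ^ (q1 d p ν η * (1 - gamma1 d p ν η) / 2) =
      ‖ψ t‖ ^ q1 d p ν η * s2 φ t ^ (-(q1 d p ν η * (1 - gamma1 d p ν η) / 2)) := by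
    rw [div_eq_mul_inv, Real.rpow_neg hs.le]
  rw [e1, e2]
  unfold rhoFun rhoExponent tauExp
  split_ifs with hpt
  · have h0 : recip p = 0 := by rw [hpt, recip_top]
    rw [h0] at hq ⊢
    rw [mul_zero, neg_zero, Real.rpow_zero, one_mul, Real.div_rpow hψ0.le hs.le, div_eq_mul_inv,
      ← Real.rpow_neg hs.le, mul_mul_mul_comm, ← Real.rpow_add hψ0, ← Real.rpow_add hs]
    congr 2 <;> linarith
  · have hP := toReal_mul_recip hp hpt
    rw [Real.div_rpow (by positivity) (by positivity), Real.mul_rpow hlam.le (by positivity),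
      ← Real.rpow_mul hψ0.le, ← Real.rpow_mul hs.le, div_eq_mul_inv, ← Real.rpow_neg hs.le,
      mul_assoc (_ ^ _) (‖ψ t‖ ^ _), mul_left_comm, mul_mul_mul_comm, ← Real.rpow_add hψ0,
      ← Real.rpow_add hs]
    congr 2
    · congr 1; ring
    · congr 1; linear_combination -(gamma1 d p ν η * q1 d p ν η) * hP - 2 * hq
    · congr 1; linear_combination (gamma1 d p ν η * q1 d p ν η) * hP + hq

theorem aemeasurable_weight (hψ : AEStronglyMeasurable ψ volume)
    (hφ : ∀ j, AEStronglyMeasurable (φ j) volume) :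
    AEMeasurable (fun t => ‖ψ t‖ ^ 2 / s2 φ t) volume :=
  (hψ.norm.aemeasurable.pow_const 2).div (aemeasurable_s2 hφ)

/-- The integral of `(1 - k) |ψ|² / s₂`. -/
noncomputable def totalJ (p : ℝ≥0∞) (ν η : ℝ) (ψ : Space d → ℂ) (φ : Fin n → Space d → ℂ) : ℝ :=
  ((2 * Real.pi) ^ d) ^ (-tauExp d p ν η) * (ProbabilityTheory.beta (tauExp d p ν η + 1)
    (sigmaExp d p ν η) / (2 * |ν - η - d / 2|)) * angI p ν η ψ φ

variable (hd : 0 < d) (hp : 1 ≤ p) (hγ : gamma1 d p ν η ∈ Set.Ioo 0 1)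
  (hψ : AEStronglyMeasurable ψ volume) (hφ : ∀ j, AEStronglyMeasurable (φ j) volume)
  (hψη : AbsHomogeneous ψ η) (hφν : ∀ j, AbsHomogeneous (φ j) ν)
  (hpos : ∀ᵐ t, ψ t ≠ 0 ∧ 0 < s2 φ t)
include hd hp hγ hψ hφ hψη hφν hpos

/-- The degree 0 factor `c` serves two uses: `c = 1` yields `I`, and `c = |φ_j|² / s₂` yields
`I'_j`. -/
theorem lintegral_weighted {c : Space d → ℝ} (hc : AEMeasurable c volume)
    (hch : ∀ t : Space d, t ≠ 0 → ∀ r : ℝ, 0 < r → c (r • t) = c t) :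
    (∫⁻ t, ENNReal.ofReal (1 - kFun p ψ φ t) * ENNReal.ofReal (c t * (‖ψ t‖ ^ 2 / s2 φ t)) =
      ENNReal.ofReal (((2 * Real.pi) ^ d) ^ (-tauExp d p ν η) *
        (ProbabilityTheory.beta (tauExp d p ν η + 1) (sigmaExp d p ν η) /
          (2 * |ν - η - d / 2|))) *
        ∫⁻ ω, ENNReal.ofReal (c ω * angIntegrand p ν η ψ φ ω) ∂sphereMeasure d) ∧
    (∫⁻ t, ENNReal.ofReal ((1 - kFun p ψ φ t) ^ 2) *
        ENNReal.ofReal (c t * (‖ψ t‖ ^ 2 / s2 φ t)) =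
      ENNReal.ofReal ((1 - gamma1 d p ν η) * (((2 * Real.pi) ^ d) ^ (-tauExp d p ν η) *
        (ProbabilityTheory.beta (tauExp d p ν η + 1) (sigmaExp d p ν η) /
          (2 * |ν - η - d / 2|)))) *
        ∫⁻ ω, ENNReal.ofReal (c ω * angIntegrand p ν η ψ φ ω) ∂sphereMeasure d) := by
  have hdeg := div_rhoDegree hp hγ
  have hexp := rhoExponent_pos hp hγ
  have hτ := tauExp_nonneg hp hγ
  have hσ := sigmaExp_pos hp hγ
  have hsph := ae_sphere_pos hd hψη hφν hpos
  have hW : AEMeasurable (fun t => c t * (‖ψ t‖ ^ 2 / s2 φ t)) volume :=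
    hc.mul (aemeasurable_weight hψ hφ)
  have hWh : ∀ t : Space d, t ≠ 0 → ∀ r : ℝ, 0 < r →
      c (r • t) * (‖ψ (r • t)‖ ^ 2 / s2 φ (r • t)) =
        r ^ ((2 * (η - ν) + d) - d) * (c t * (‖ψ t‖ ^ 2 / s2 φ t)) := by
    intro t ht r hr
    rw [hch t ht r hr, weight_smul hψη hφν ht hr, add_sub_cancel_right]
    ring
  have hρ0 : ∀ᵐ ω : Metric.sphere (0 : Space d) 1 ∂sphereMeasure d, 0 < rhoFun p ψ φ ω := by
    filter_upwards [hsph] with ω hω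
    exact rhoFun_pos hω.1 hω.2
  have hk : ∀ᵐ t, kFun p ψ φ t ∈ Set.Icc (0 : ℝ) 1 ∧ ∀ u ∈ Set.Ioo (0 : ℝ) 1,
      kFun p ψ φ t < u ↔ rhoFun p ψ φ t < thetaFun p u := by
    filter_upwards [hpos] with t ht
    exact ⟨kFun_mem_Icc hp t, fun u hu => kFun_lt_iff hp ht.1 ht.2 hu⟩
  have hS : ∫⁻ ω : Metric.sphere (0 : Space d) 1,
      ENNReal.ofReal (c ω * (‖ψ ω‖ ^ 2 / s2 φ ω) *
        rhoFun p ψ φ ω ^ (-((2 * (η - ν) + d) / rhoDegree p ν η))) ∂sphereMeasure d =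
      ENNReal.ofReal (((2 * Real.pi) ^ d) ^ (-tauExp d p ν η)) *
        ∫⁻ ω, ENNReal.ofReal (c ω * angIntegrand p ν η ψ φ ω) ∂sphereMeasure d := by
    rw [← lintegral_const_mul' _ _ ENNReal.ofReal_ne_top]
    refine lintegral_congr_ae ?_
    filter_upwards [hsph] with ω hω
    rw [hdeg, mul_assoc, weight_mul_rhoFun_rpow hp hγ hω.1 hω.2,
      ← ENNReal.ofReal_mul (by positivity), angIntegrand]
    congr 1
    ring
  have hbeta : 0 ≤ ProbabilityTheory.beta (tauExp d p ν η + 1) (sigmaExp d p ν η) :=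
    (ProbabilityTheory.beta_pos (by positivity) hσ).le
  have hγ1 : 0 < 1 - gamma1 d p ν η := sub_pos.2 hγ.2
  constructor
  · rw [lintegral_one_sub_mul hd (hdeg.symm ▸ hexp) measurable_thetaFun
      (fun u hu => thetaFun_pos hu) hτ hσ (fun u hu => hdeg.symm ▸ thetaFun_rpow hp hγ hu) hW
      (aemeasurable_rhoFun hψ hφ) hWh (rhoFun_smul hψη hφν) hρ0 hk, hS, ← mul_assoc,
      ← ENNReal.ofReal_mul (by positivity), abs_degree, mul_comm (_ / _)]
  · rw [lintegral_one_sub_sq_mul hd (hdeg.symm ▸ hexp) measurable_thetaFun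
      (fun u hu => thetaFun_pos hu) hτ hσ (fun u hu => hdeg.symm ▸ thetaFun_rpow hp hγ hu) hW
      (aemeasurable_rhoFun hψ hφ) hWh (rhoFun_smul hψη hφν) hρ0 hk, hS, ← mul_assoc,
      ← ENNReal.ofReal_mul (by positivity), abs_degree]
    congr 2
    -- The denominator is `q₁` by `tau_add_sigma`, and `2σ = q₁(1 - γ₁)`.
    have h1 : 2 * sigmaExp d p ν η / (1 + tauExp d p ν η + sigmaExp d p ν η) =
        1 - gamma1 d p ν η := by
      have := tau_add_sigma hp hγ
      unfold tauExp sigmaExp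
      rw [this, div_eq_iff (q1_mul hp hγ).1.ne']
      ring
    rw [h1]
    ring

variable (hI : Integrable (angIntegrand p ν η ψ φ) (sphereMeasure d))

omit hd hp hγ hψ hφ hψη hφν hpos in
theorem angIntegrand_nonneg (ω : Metric.sphere (0 : Space d) 1) :
    0 ≤ angIntegrand p ν η ψ φ ω := by
  have := s2_nonneg (φ := φ) (ω : Space d)
  unfold angIntegrand
  positivity

omit hd hp hγ hψ hφ hψη hφν hpos in
theorem angI_nonneg : 0 ≤ angI p ν η ψ φ := integral_nonneg angIntegrand_nonneg

omit hd hp hγ hψ hφ hψη hφν hpos in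
include hI in
theorem lintegral_angIntegrand :
    ∫⁻ ω, ENNReal.ofReal (angIntegrand p ν η ψ φ ω) ∂sphereMeasure d =
      ENNReal.ofReal (angI p ν η ψ φ) := by
  rw [angI, ofReal_integral_eq_lintegral_ofReal hI]
  exact Filter.Eventually.of_forall angIntegrand_nonneg

include hI

omit hp hγ hψ hφ in
theorem angI_pos : 0 < angI p ν η ψ φ := by
  have hne : sphereMeasure d ≠ 0 := by
    have : Nontrivial (Space d) := by
      rw [← Module.finrank_pos_iff (R := ℝ), finrank_euclideanSpace_fin]; exact hd
    exact Measure.toSphere_ne_zero _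
  have h0 : 0 ≤ angI p ν η ψ φ := integral_nonneg angIntegrand_nonneg
  refine h0.lt_of_ne fun h => ?_
  have h1 := (integral_eq_zero_iff_of_nonneg angIntegrand_nonneg hI).1 h.symm
  have : (ae (sphereMeasure d)).NeBot := ae_neBot.2 hne
  obtain ⟨ω, hω, hω1, hω2⟩ := (h1.and (ae_sphere_pos hd hψη hφν hpos)).exists
  have hψ0 : 0 < ‖ψ ω‖ := norm_pos_iff.2 hω1
  have : 0 < angIntegrand p ν η ψ φ ω := by unfold angIntegrand; positivity
  exact this.ne' hω

omit hψ hφ in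
theorem totalJ_pos : 0 < totalJ p ν η ψ φ := by
  have ha : ν - η - d / 2 ≠ 0 := by
    rw [← gamma1_mul_scale hγ]
    exact mul_ne_zero hγ.1.ne' (scale_ne_zero hγ)
  have h1 := angI_pos (p := p) hd hψη hφν hpos hI
  have h2 := ProbabilityTheory.beta_pos (α := tauExp d p ν η + 1)
    (by linarith [tauExp_nonneg hp hγ]) (sigmaExp_pos hp hγ)
  have : 0 < |ν - η - d / 2| := abs_pos.2 ha
  unfold totalJ
  positivity

theorem lintegral_one_sub_kFun :
    ∫⁻ t, ENNReal.ofReal ((1 - kFun p ψ φ t) * (‖ψ t‖ ^ 2 / s2 φ t)) =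
      ENNReal.ofReal (totalJ p ν η ψ φ) := by
  have h1 := (lintegral_weighted hd hp hγ hψ hφ hψη hφν hpos (c := fun _ => 1)
    aemeasurable_const (fun _ _ _ _ => rfl)).1
  simp only [one_mul] at h1
  rw [lintegral_angIntegrand hI, ← ENNReal.ofReal_mul' angI_nonneg] at h1
  rw [totalJ, ← h1]
  refine lintegral_congr fun t => ?_
  rw [ENNReal.ofReal_mul (by linarith [(kFun_mem_Icc (ψ := ψ) (φ := φ) hp t).2])]

theorem lintegral_one_sub_kFun_sq :
    ∫⁻ t, ENNReal.ofReal ((1 - kFun p ψ φ t) ^ 2 * (‖ψ t‖ ^ 2 / s2 φ t)) =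
      ENNReal.ofReal ((1 - gamma1 d p ν η) * totalJ p ν η ψ φ) := by
  have h1 := (lintegral_weighted hd hp hγ hψ hφ hψη hφν hpos (c := fun _ => 1)
    aemeasurable_const (fun _ _ _ _ => rfl)).2
  simp only [one_mul] at h1
  rw [lintegral_angIntegrand hI, ← ENNReal.ofReal_mul' angI_nonneg] at h1
  rw [totalJ, ← mul_assoc, ← h1]
  refine lintegral_congr fun t => ?_
  rw [ENNReal.ofReal_mul (by positivity)]

/-- Since `k(1 - k) = (1 - k) - (1 - k)²`, the value is `J - (1 - γ₁)J`; the subtraction is a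
cancellation of a finite term. -/
theorem lintegral_kFun_mul_one_sub :
    ∫⁻ t, ENNReal.ofReal (kFun p ψ φ t * (1 - kFun p ψ φ t) * (‖ψ t‖ ^ 2 / s2 φ t)) =
      ENNReal.ofReal (gamma1 d p ν η * totalJ p ν η ψ φ) := by
  have hJ := totalJ_pos hd hp hγ hψη hφν hpos hI
  have h1 := lintegral_one_sub_kFun hd hp hγ hψ hφ hψη hφν hpos hI
  have h2 := lintegral_one_sub_kFun_sq hd hp hγ hψ hφ hψη hφν hpos hI
  have hkm := aemeasurable_kFun hp hψ hφ hpos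
  have hw := aemeasurable_weight hψ hφ
  have hγ1 : 0 < 1 - gamma1 d p ν η := sub_pos.2 hγ.2
  have hγ0 := hγ.1
  have h3 : ∫⁻ t, ENNReal.ofReal ((1 - kFun p ψ φ t) * (‖ψ t‖ ^ 2 / s2 φ t)) =
      (∫⁻ t, ENNReal.ofReal (kFun p ψ φ t * (1 - kFun p ψ φ t) * (‖ψ t‖ ^ 2 / s2 φ t))) +
      ∫⁻ t, ENNReal.ofReal ((1 - kFun p ψ φ t) ^ 2 * (‖ψ t‖ ^ 2 / s2 φ t)) := by
    have hm : AEMeasurable (fun t =>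
        ENNReal.ofReal ((1 - kFun p ψ φ t) ^ 2 * (‖ψ t‖ ^ 2 / s2 φ t))) volume :=
      (((hkm.const_sub 1).pow_const 2).mul hw).ennreal_ofReal
    rw [← lintegral_add_right' _ hm]
    refine lintegral_congr fun t => ?_
    obtain ⟨hk0, hk1⟩ := kFun_mem_Icc (ψ := ψ) (φ := φ) hp t
    have hs := s2_nonneg (φ := φ) t
    have : 0 ≤ 1 - kFun p ψ φ t := by linarith
    rw [← ENNReal.ofReal_add (by positivity) (by positivity)]
    congr 1
    ring
  rw [h1, h2] at h3
  refine (ENNReal.add_left_inj (a := ENNReal.ofReal ((1 - gamma1 d p ν η) * totalJ p ν η ψ φ))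
    ENNReal.ofReal_ne_top).1 ?_
  rw [← h3, ← ENNReal.ofReal_add (by positivity) (by positivity)]
  congr 1
  ring

/-- The `I'_j` add up to `I` because `Σ|φ_j|² = s₂`, so being equal they are all `I/n`. This is the
one place where their equality enters. -/
theorem lintegral_symbol_sq (hI' : ∀ i j, angI' p ν η ψ φ i = angI' p ν η ψ φ j) (j : Fin n) :
    ∫⁻ t, ENNReal.ofReal ((‖φ j t‖ * extremalAbs p ψ φ t) ^ 2) =
      ENNReal.ofReal ((1 - gamma1 d p ν η) * totalJ p ν η ψ φ / n) := by
  have hsph := ae_sphere_pos hd hψη hφν hpos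
  set c : Fin n → Space d → ℝ := fun i t => ‖φ i t‖ ^ 2 / s2 φ t with hc
  have hcm : ∀ i, AEMeasurable (c i) volume := fun i =>
    ((hφ i).norm.aemeasurable.pow_const 2).div (aemeasurable_s2 hφ)
  have hch : ∀ i (t : Space d), t ≠ 0 → ∀ r : ℝ, 0 < r → c i (r • t) = c i t := by
    intro i t ht r hr
    simp only [hc]
    rw [hφν i t ht r hr, s2_smul hφν ht hr, mul_pow, mul_comm 2 ν, Real.rpow_mul hr.le,
      Real.rpow_two, mul_div_mul_left _ _ (by positivity)]
  have hc0 : ∀ i t, 0 ≤ c i t := fun i t => div_nonneg (by positivity) (s2_nonneg t)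
  have hc1 : ∀ i t, c i t ≤ 1 := fun i t => by
    refine div_le_one_of_le₀ ?_ (s2_nonneg t)
    exact Finset.single_le_sum (f := fun i => ‖φ i t‖ ^ 2) (fun _ _ => by positivity)
      (Finset.mem_univ i)
  have hcI : ∀ i, Integrable (fun ω : Metric.sphere (0 : Space d) 1 =>
      c i ω * angIntegrand p ν η ψ φ ω) (sphereMeasure d) := by
    intro i
    refine hI.bdd_mul (c := 1) (aemeasurable_sphere hd (κ := 0) (hcm i) ?_).aestronglyMeasurable ?_
    · intro t ht r hr
      rw [hch i t ht r hr, Real.rpow_zero, one_mul]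
    · filter_upwards with ω
      rw [Real.norm_of_nonneg (hc0 i ω)]
      exact hc1 i ω
  have hcI' : ∀ i, ∫ ω : Metric.sphere (0 : Space d) 1, c i ω * angIntegrand p ν η ψ φ ω
      ∂sphereMeasure d = angI' p ν η ψ φ i := by
    intro i
    refine integral_congr_ae ?_
    filter_upwards [hsph] with ω hω
    simp only [hc, angIntegrand]
    rw [Real.rpow_add_one hω.2.ne']
    have := hω.2
    field_simp
  have hsum : ∑ i, angI' p ν η ψ φ i = angI p ν η ψ φ := by
    simp only [← hcI']
    rw [← integral_finsetSum _ fun i _ => hcI i, angI]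
    refine integral_congr_ae ?_
    filter_upwards [hsph] with ω hω
    rw [← Finset.sum_mul]
    simp only [hc]
    rw [← Finset.sum_div, ← s2, div_self hω.2.ne', one_mul]
  have hn : (0 : ℝ) < n := by
    have : 0 < n := j.pos
    exact_mod_cast this
  have hval : angI' p ν η ψ φ j = angI p ν η ψ φ / n := by
    rw [← hsum, Finset.sum_congr rfl fun i _ => hI' i j]
    simp only [Finset.sum_const, Finset.card_univ, Fintype.card_fin, nsmul_eq_mul]
    field_simp
  have h1 := (lintegral_weighted hd hp hγ hψ hφ hψη hφν hpos (hcm j) (hch j)).2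
  rw [← ofReal_integral_eq_lintegral_ofReal (hcI j) (Filter.Eventually.of_forall fun ω =>
    mul_nonneg (hc0 j ω) (angIntegrand_nonneg ω)), hcI', hval, ← ENNReal.ofReal_mul'
    (div_nonneg angI_nonneg hn.le)] at h1
  have h2 : (1 - gamma1 d p ν η) * totalJ p ν η ψ φ / n =
      (1 - gamma1 d p ν η) * (((2 * Real.pi) ^ d) ^ (-tauExp d p ν η) *
        (ProbabilityTheory.beta (tauExp d p ν η + 1) (sigmaExp d p ν η) /
          (2 * |ν - η - d / 2|))) * (angI p ν η ψ φ / n) := by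
    rw [totalJ]; ring
  rw [h2, ← h1]
  refine lintegral_congr_ae ?_
  filter_upwards [hpos] with t ht
  rw [← ENNReal.ofReal_mul (by positivity)]
  congr 1
  simp only [hc, extremalAbs]
  have := ht.2
  field_simp

end Integrals

/-! ### The sharp constant -/

section Constants

/-- The norm of the multiplier `k ψ` in the space conjugate to `L_p`. -/
noncomputable def constA {d n : ℕ} (p : ℝ≥0∞) (ν η : ℝ) (ψ : Space d → ℂ)
    (φ : Fin n → Space d → ℂ) : ℝ :=
  ((2 * Real.pi) ^ d) ^ recip p *
    (gamma1 d p ν η * totalJ p ν η ψ φ) ^ (1 - recip p)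

/-- The norm of `(1 - k) ψ / √s₂` in `L₂`. -/
noncomputable def constB {d n : ℕ} (p : ℝ≥0∞) (ν η : ℝ) (ψ : Space d → ℂ)
    (φ : Fin n → Space d → ℂ) : ℝ :=
  ((1 - gamma1 d p ν η) * totalJ p ν η ψ φ) ^ (1 / 2 : ℝ)

/-- The bound for `‖√s₂ F x‖_{L₂}` when `‖D_j x‖_{L₂} ≤ N` for all `j`. -/
noncomputable def constM (d n : ℕ) (N : ℝ) : ℝ :=
  (n : ℝ) ^ (1 / 2 : ℝ) * ((2 * Real.pi) ^ (d / 2 : ℝ) * N)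

/-- The optimal parameter of the dilation of `k`. -/
noncomputable def optScale {d n : ℕ} (p : ℝ≥0∞) (ν η : ℝ) (ψ : Space d → ℂ)
    (φ : Fin n → Space d → ℂ) (G N : ℝ) : ℝ :=
  (1 - gamma1 d p ν η) * (constA p ν η ψ φ * G) /
    (gamma1 d p ν η * (constB p ν η ψ φ * constM d n N))

variable {d n : ℕ} {p : ℝ≥0∞} {ν η : ℝ} {ψ : Space d → ℂ} {φ : Fin n → Space d → ℂ}

theorem one_div_q1 : 1 / q1 d p ν η = 1 / 2 + gamma1 d p ν η * (1 / 2 - recip p) := by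
  rw [q1, one_div_one_div]

theorem constA_pos (hγ : gamma1 d p ν η ∈ Set.Ioo 0 1) (hJ : 0 < totalJ p ν η ψ φ) :
    0 < constA p ν η ψ φ := by
  have := hγ.1
  unfold constA
  positivity

theorem constB_pos (hγ : gamma1 d p ν η ∈ Set.Ioo 0 1) (hJ : 0 < totalJ p ν η ψ φ) :
    0 < constB p ν η ψ φ := by
  have : 0 < 1 - gamma1 d p ν η := sub_pos.2 hγ.2
  unfold constB
  positivity

theorem constM_pos (hn : 0 < n) {N : ℝ} (hN : 0 < N) : 0 < constM d n N := by
  unfold constM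
  positivity

theorem optScale_pos (hγ : gamma1 d p ν η ∈ Set.Ioo 0 1) (hJ : 0 < totalJ p ν η ψ φ)
    (hn : 0 < n) {G N : ℝ} (hG : 0 < G) (hN : 0 < N) : 0 < optScale p ν η ψ φ G N := by
  have h0 := hγ.1
  have h1 : 0 < 1 - gamma1 d p ν η := sub_pos.2 hγ.2
  have h2 := constA_pos hγ hJ
  have h3 := constB_pos hγ hJ
  have h4 := constM_pos (d := d) hn hN
  unfold optScale
  positivity

theorem log_constA (hγ : gamma1 d p ν η ∈ Set.Ioo 0 1) (hJ : 0 < totalJ p ν η ψ φ) :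
    Real.log (constA p ν η ψ φ) = recip p * (d * Real.log (2 * Real.pi)) +
      (1 - recip p) * (Real.log (gamma1 d p ν η) + Real.log (totalJ p ν η ψ φ)) := by
  have h0 := hγ.1
  rw [constA, Real.log_mul (by positivity) (by positivity), Real.log_rpow (by positivity),
    Real.log_rpow (by positivity), Real.log_pow, Real.log_mul h0.ne' hJ.ne']

theorem log_constB (hγ : gamma1 d p ν η ∈ Set.Ioo 0 1) (hJ : 0 < totalJ p ν η ψ φ) :
    Real.log (constB p ν η ψ φ) =
      1 / 2 * (Real.log (1 - gamma1 d p ν η) + Real.log (totalJ p ν η ψ φ)) := by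
  have h1 : 0 < 1 - gamma1 d p ν η := sub_pos.2 hγ.2
  rw [constB, Real.log_rpow (by positivity), Real.log_mul h1.ne' hJ.ne']

theorem log_constM (hn : 0 < n) {N : ℝ} (hN : 0 < N) :
    Real.log (constM d n N) =
      1 / 2 * Real.log n + (d / 2 * Real.log (2 * Real.pi) + Real.log N) := by
  rw [constM, Real.log_mul (by positivity) (by positivity), Real.log_mul (by positivity) hN.ne',
    Real.log_rpow (by positivity), Real.log_rpow (by positivity)]

theorem log_optScale (hγ : gamma1 d p ν η ∈ Set.Ioo 0 1) (hJ : 0 < totalJ p ν η ψ φ)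
    (hn : 0 < n) {G N : ℝ} (hG : 0 < G) (hN : 0 < N) :
    Real.log (optScale p ν η ψ φ G N) =
      Real.log (1 - gamma1 d p ν η) + (Real.log (constA p ν η ψ φ) + Real.log G) -
        (Real.log (gamma1 d p ν η) +
          (Real.log (constB p ν η ψ φ) + Real.log (constM d n N))) := by
  have h0 := hγ.1
  have h1 : 0 < 1 - gamma1 d p ν η := sub_pos.2 hγ.2
  have h2 := constA_pos hγ hJ
  have h3 := constB_pos hγ hJ
  have h4 := constM_pos (d := d) hn hN
  rw [optScale, Real.log_div (by positivity) (by positivity), Real.log_mul h1.ne' (by positivity),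
    Real.log_mul h2.ne' hG.ne', Real.log_mul h0.ne' (by positivity), Real.log_mul h3.ne' h4.ne']

/-- The factor `B(q₁γ₁/p + 1, q₁(1 - γ₁)/2) / (2|ν - η - d/2|)`. -/
noncomputable def betaFactor (d : ℕ) (p : ℝ≥0∞) (ν η : ℝ) : ℝ :=
  ProbabilityTheory.beta (tauExp d p ν η + 1) (sigmaExp d p ν η) / (2 * |ν - η - d / 2|)

theorem betaFactor_pos (hp : 1 ≤ p) (hγ : gamma1 d p ν η ∈ Set.Ioo 0 1) :
    0 < betaFactor d p ν η := by
  have ha : ν - η - d / 2 ≠ 0 := by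
    rw [← gamma1_mul_scale hγ]
    exact mul_ne_zero hγ.1.ne' (scale_ne_zero hγ)
  have h2 := ProbabilityTheory.beta_pos (α := tauExp d p ν η + 1)
    (by linarith [tauExp_nonneg hp hγ]) (sigmaExp_pos hp hγ)
  have : 0 < |ν - η - d / 2| := abs_pos.2 ha
  unfold betaFactor
  positivity

theorem log_totalJ (hp : 1 ≤ p) (hγ : gamma1 d p ν η ∈ Set.Ioo 0 1) (hI : 0 < angI p ν η ψ φ) :
    Real.log (totalJ p ν η ψ φ) = -tauExp d p ν η * (d * Real.log (2 * Real.pi)) +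
      Real.log (betaFactor d p ν η) + Real.log (angI p ν η ψ φ) := by
  have hb := betaFactor_pos hp hγ
  rw [totalJ, ← betaFactor, Real.log_mul (by positivity) hI.ne',
    Real.log_mul (by positivity) hb.ne', Real.log_rpow (by positivity), Real.log_pow]

theorem sharpConst_eq :
    sharpConst p ν η ψ φ = (2 * Real.pi) ^ (-(d * (1 + gamma1 d p ν η) / 2)) *
      (gamma1 d p ν η ^ (-(gamma1 d p ν η * recip p)) *
        ((1 - gamma1 d p ν η) / n) ^ (-((1 - gamma1 d p ν η) / 2)) *
        betaFactor d p ν η ^ (1 / q1 d p ν η)) * angI p ν η ψ φ ^ (1 / q1 d p ν η) := rfl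

theorem sharpConst_pos (hp : 1 ≤ p) (hγ : gamma1 d p ν η ∈ Set.Ioo 0 1)
    (hI : 0 < angI p ν η ψ φ) (hn : 0 < n) : 0 < sharpConst p ν η ψ φ := by
  have h0 := hγ.1
  have h1 : 0 < 1 - gamma1 d p ν η := sub_pos.2 hγ.2
  have hb := betaFactor_pos hp hγ
  have hn' : (0 : ℝ) < n := by exact_mod_cast hn
  rw [sharpConst_eq]
  positivity

theorem log_sharpConst (hp : 1 ≤ p) (hγ : gamma1 d p ν η ∈ Set.Ioo 0 1)
    (hI : 0 < angI p ν η ψ φ) (hn : 0 < n) :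
    Real.log (sharpConst p ν η ψ φ) =
      -(d * (1 + gamma1 d p ν η) / 2) * Real.log (2 * Real.pi) +
      (-(gamma1 d p ν η * recip p) * Real.log (gamma1 d p ν η) +
        -((1 - gamma1 d p ν η) / 2) * (Real.log (1 - gamma1 d p ν η) - Real.log n) +
        (1 / 2 + gamma1 d p ν η * (1 / 2 - recip p)) * Real.log (betaFactor d p ν η)) +
      (1 / 2 + gamma1 d p ν η * (1 / 2 - recip p)) * Real.log (angI p ν η ψ φ) := by
  have h0 := hγ.1
  have h1 : 0 < 1 - gamma1 d p ν η := sub_pos.2 hγ.2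
  have hb := betaFactor_pos hp hγ
  have hn' : (0 : ℝ) < n := by exact_mod_cast hn
  rw [sharpConst_eq, Real.log_mul (by positivity) (by positivity),
    Real.log_mul (by positivity) (by positivity), Real.log_mul (by positivity) (by positivity),
    Real.log_mul (by positivity) (by positivity), Real.log_rpow (by positivity),
    Real.log_rpow h0, Real.log_rpow (by positivity), Real.log_rpow hb, Real.log_rpow hI,
    Real.log_div h1.ne' hn'.ne', one_div_q1]

/-- The value of the minimum over all dilations. -/
theorem optScale_value (hp : 1 ≤ p) (hγ : gamma1 d p ν η ∈ Set.Ioo 0 1)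
    (hI : 0 < angI p ν η ψ φ) (hJ : 0 < totalJ p ν η ψ φ) (hn : 0 < n) {G N : ℝ} (hG : 0 < G)
    (hN : 0 < N) :
    optScale p ν η ψ φ G N ^ gamma1 d p ν η * (constB p ν η ψ φ * constM d n N) /
        (1 - gamma1 d p ν η) =
      (2 * Real.pi) ^ (d : ℝ) * (sharpConst p ν η ψ φ * G ^ gamma1 d p ν η *
        N ^ (1 - gamma1 d p ν η)) := by
  have h0 := hγ.1
  have h1 : 0 < 1 - gamma1 d p ν η := sub_pos.2 hγ.2
  have h3 := constB_pos hγ hJ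
  have h4 := constM_pos (d := d) hn hN
  have h5 := optScale_pos hγ hJ hn hG hN
  have h6 := sharpConst_pos hp hγ hI hn
  -- Both sides are products of powers, so their logarithms are linear in those of the basic
  -- quantities; what remains is a multiple of the relation in `q1_mul`.
  refine Real.log_injOn_pos (Set.mem_Ioi.2 (by positivity)) (Set.mem_Ioi.2 (by positivity)) ?_
  rw [Real.log_div (by positivity) h1.ne', Real.log_mul (by positivity) (by positivity),
    Real.log_rpow h5, Real.log_mul h3.ne' h4.ne',
    Real.log_mul (x := (2 * Real.pi) ^ (d : ℝ)) (by positivity) (by positivity),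
    Real.log_rpow (by positivity), Real.log_mul (y := N ^ _) (by positivity) (by positivity),
    Real.log_mul h6.ne' (by positivity), Real.log_rpow hG, Real.log_rpow hN,
    log_optScale hγ hJ hn hG hN, log_constA hγ hJ, log_constB hγ hJ, log_constM hn hN,
    log_sharpConst hp hγ hI hn, log_totalJ hp hγ hI, tauExp]
  linear_combination (-gamma1 d p ν η * recip p * d * Real.log (2 * Real.pi)) * (q1_mul hp hγ).2

/-- `optScale` is the stationary point of `s^{-(1-γ)} A G + s^γ B M`, where the first term is `γ/(1
- γ)` times the second. -/
theorem optScale_min (hγ : gamma1 d p ν η ∈ Set.Ioo 0 1)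
    (hJ : 0 < totalJ p ν η ψ φ) (hn : 0 < n) {G N : ℝ} (hG : 0 < G) (hN : 0 < N) :
    optScale p ν η ψ φ G N ^ (-(1 - gamma1 d p ν η)) * constA p ν η ψ φ * G +
      optScale p ν η ψ φ G N ^ gamma1 d p ν η * constB p ν η ψ φ * constM d n N =
    optScale p ν η ψ φ G N ^ gamma1 d p ν η * (constB p ν η ψ φ * constM d n N) /
        (1 - gamma1 d p ν η) := by
  have h0 := hγ.1
  have h1 : 0 < 1 - gamma1 d p ν η := sub_pos.2 hγ.2
  have h3 := constB_pos hγ hJ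
  have h4 := constM_pos (d := d) hn hN
  have h5 := optScale_pos hγ hJ hn hG hN
  have h6 : constA p ν η ψ φ * G = optScale p ν η ψ φ G N *
      (gamma1 d p ν η * (constB p ν η ψ φ * constM d n N)) / (1 - gamma1 d p ν η) := by
    rw [optScale, div_mul_cancel₀ _ (by positivity), mul_div_cancel_left₀ _ h1.ne']
  rw [neg_sub, Real.rpow_sub_one h5.ne', mul_assoc _ _ G, h6]
  field_simp
  ring

/-- The parameter of the stated method is the minimizer for `G = δ`, `N = 1`. -/
theorem xi1_eq (hp : 1 ≤ p) (hγ : gamma1 d p ν η ∈ Set.Ioo 0 1)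
    (hI : 0 < angI p ν η ψ φ) (hJ : 0 < totalJ p ν η ψ φ) (hn : 0 < n) {δ : ℝ} (hδ : 0 < δ) :
    xi1 p ν η δ ψ φ = optScale p ν η ψ φ δ 1 := by
  have h0 := hγ.1
  have h1 : 0 < 1 - gamma1 d p ν η := sub_pos.2 hγ.2
  have h5 := optScale_pos hγ hJ hn hδ one_pos
  have h6 := sharpConst_pos hp hγ hI hn
  have hn' : (0 : ℝ) < n := by exact_mod_cast hn
  have h7 : xi1 p ν η δ ψ φ = δ * gamma1 d p ν η ^ (-(q1 d p ν η * recip p / 2)) *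
      ((1 - gamma1 d p ν η) / n) ^ (q1 d p ν η * (1 - recip p) / 2) *
      sharpConst p ν η ψ φ ^ (q1 d p ν η * (1 / 2 - recip p)) := rfl
  rw [h7]
  refine Real.log_injOn_pos (Set.mem_Ioi.2 (by positivity)) (Set.mem_Ioi.2 h5) ?_
  rw [Real.log_mul (by positivity) (by positivity), Real.log_mul (by positivity) (by positivity),
    Real.log_mul (by positivity) (by positivity), Real.log_rpow h0, Real.log_rpow (by positivity),
    Real.log_rpow h6, Real.log_div h1.ne' hn'.ne',
    log_optScale hγ hJ hn hδ one_pos, log_constA hγ hJ, log_constB hγ hJ, log_constM hn one_pos,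
    log_sharpConst hp hγ hI hn, log_totalJ hp hγ hI, tauExp, Real.log_one]
  linear_combination (-recip p * Real.log (gamma1 d p ν η) +
    1 / 2 * (Real.log (1 - gamma1 d p ν η) - Real.log n) +
    (1 / 2 - recip p) * (Real.log (betaFactor d p ν η) + Real.log (angI p ν η ψ φ)) -
    (1 / 2 - recip p) * d * Real.log (2 * Real.pi)) * (q1_mul hp hγ).2

end Constants

/-! ### The upper bound -/

section Upper

variable {d n : ℕ} {p : ℝ≥0∞} {ν η : ℝ} {ψ : Space d → ℂ} {φ : Fin n → Space d → ℂ}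

theorem ae_ne_zero (hd : 0 < d) : ∀ᵐ t : Space d, t ≠ 0 := by
  have : Nontrivial (Space d) := by
    rw [← Module.finrank_pos_iff (R := ℝ), finrank_euclideanSpace_fin]; exact hd
  exact compl_mem_ae_iff.2 (measure_singleton 0)

/-- The norm of a function which is, up to a factor, a dilation in modulus. -/
theorem eLpNorm_of_norm_eq_dilation {q : ℝ≥0∞} {f g : Space d → ℂ} {c m : ℝ} (hc : 0 < c)
    (hm : 0 ≤ m) (hg : AEStronglyMeasurable g volume)
    (h : ∀ᵐ t, ‖f t‖ = m * ‖g (c • t)‖) :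
    eLpNorm f q volume =
      ENNReal.ofReal (m * c ^ (-(d * recip q))) * eLpNorm g q volume := by
  have h1 : eLpNorm f q volume = eLpNorm (m • fun t => g (c • t)) q volume := by
    refine eLpNorm_congr_norm_ae ?_
    filter_upwards [h] with t ht
    rw [ht, Pi.smul_apply, norm_smul, Real.norm_of_nonneg hm]
  rw [h1, eLpNorm_const_smul, eLpNorm_comp_smul hc hg, Real.enorm_eq_ofReal hm, ← mul_assoc,
    ← ENNReal.ofReal_mul hm]

theorem lintegral_sq_eq {f : Space d → ℂ} :
    ∫⁻ t, ENNReal.ofReal (‖f t‖ ^ 2) = eLpNorm f 2 volume ^ 2 := by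
  have h := eLpNorm_nnreal_pow_eq_lintegral (f := f) (μ := (volume : Measure (Space d)))
    (p := 2) two_ne_zero
  simp only [ENNReal.coe_ofNat, NNReal.coe_ofNat, ENNReal.rpow_ofNat] at h
  rw [h]
  refine lintegral_congr fun t => ?_
  rw [ENNReal.ofReal_pow (norm_nonneg _), ofReal_norm]

theorem recip_two : recip 2 = 1 / 2 := by simp [recip]

theorem eLpNorm_two_le_of_sq_le {f : Space d → ℂ} {F : Space d → ℝ} {c : ℝ} (hc : 0 ≤ c)
    (hf : ∀ᵐ t, ‖f t‖ ^ 2 ≤ F t)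
    (hF : ∫⁻ t, ENNReal.ofReal (F t) ≤ ENNReal.ofReal c) :
    eLpNorm f 2 volume ≤ ENNReal.ofReal (c ^ (1 / 2 : ℝ)) := by
  rw [← recip_two]
  refine eLpNorm_le_of_rpow_le one_le_two ENNReal.ofNat_ne_top hc ?_ hF
  simpa using hf

/-- The square of the left side is the sum of the `n` squares `‖φ_j g‖₂²`, whence the factor `√n` in
`constM`. -/
theorem eLpNorm_sqrt_s2_mul_le {g : Space d → ℂ} {N : ℝ} (hN : 0 < N)
    (hg : AEStronglyMeasurable g volume) (hφ : ∀ j, AEStronglyMeasurable (φ j) volume)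
    (h : ∀ j, eLpNorm (fun t => φ j t * g t) 2 volume ≤
        ENNReal.ofReal ((2 * Real.pi) ^ (d / 2 : ℝ) * N)) :
    eLpNorm (fun t => (Real.sqrt (s2 φ t) : ℂ) * g t) 2 volume ≤
      ENNReal.ofReal (constM d n N) := by
  have hM : constM d n N =
      (n * ((2 * Real.pi) ^ (d / 2 : ℝ) * N) ^ 2) ^ (1 / 2 : ℝ) := by
    rw [Real.mul_rpow (by positivity) (by positivity), ← Real.rpow_natCast, ← Real.rpow_mul
      (by positivity), constM]
    norm_num
  rw [hM]
  refine eLpNorm_two_le_of_sq_le (by positivity) (F := fun t => ∑ j, ‖φ j t * g t‖ ^ 2)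
    (Filter.Eventually.of_forall fun t => ?_) ?_
  · rw [norm_mul, Complex.norm_real, Real.norm_of_nonneg (Real.sqrt_nonneg _), mul_pow,
      Real.sq_sqrt (s2_nonneg t), s2, Finset.sum_mul]
    simp [mul_pow]
  · simp only [ENNReal.ofReal_sum_of_nonneg (fun _ _ => sq_nonneg _)]
    have hm : ∀ j, AEMeasurable (fun t => ENNReal.ofReal (‖φ j t * g t‖ ^ 2)) volume := fun j =>
      (((hφ j).mul hg).norm.aemeasurable.pow_const 2).ennreal_ofReal
    rw [lintegral_finsetSum' _ fun j _ => hm j]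
    calc _ ≤ ∑ _j : Fin n, ENNReal.ofReal (((2 * Real.pi) ^ (d / 2 : ℝ) * N) ^ 2) := by
          refine Finset.sum_le_sum fun j _ => ?_
          rw [ENNReal.ofReal_pow (by positivity), lintegral_sq_eq]
          exact pow_le_pow_left' (h j) 2
      _ = _ := by
          rw [Finset.sum_const, Finset.card_univ, Fintype.card_fin, nsmul_eq_mul,
            ENNReal.ofReal_mul (by positivity), ENNReal.ofReal_natCast]

/-- The multiplier with the dilation parameter `s`. -/
noncomputable def scaledMultiplier (p : ℝ≥0∞) (ν : ℝ) (ψ : Space d → ℂ)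
    (φ : Fin n → Space d → ℂ) (s : ℝ) (t : Space d) : ℂ :=
  (kFun p ψ φ (s ^ (1 / (ν + d * (1 / 2 - recip p))) • t) : ℂ) * ψ t

variable (hd : 0 < d) (hp : 1 ≤ p) (hγ : gamma1 d p ν η ∈ Set.Ioo 0 1)
  (hψ : AEStronglyMeasurable ψ volume) (hφ : ∀ j, AEStronglyMeasurable (φ j) volume)
  (hψη : AbsHomogeneous ψ η) (hφν : ∀ j, AbsHomogeneous (φ j) ν)
  (hpos : ∀ᵐ t, ψ t ≠ 0 ∧ 0 < s2 φ t)
  (hI : Integrable (angIntegrand p ν η ψ φ) (sphereMeasure d))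

include hγ in
theorem rpow_scale {s x y : ℝ} (hs : 0 < s) (hxy : (ν + d * (1 / 2 - recip p)) * y = x) :
    (s ^ (1 / (ν + d * (1 / 2 - recip p)))) ^ x = s ^ y := by
  rw [← Real.rpow_mul hs.le, ← hxy, ← mul_assoc, one_div_mul_cancel (scale_ne_zero hγ), one_mul]

theorem norm_smul_inv (hψη : AbsHomogeneous ψ η) {c : ℝ} (hc : 0 < c) {t : Space d} (ht : t ≠ 0) :
    ‖ψ t‖ = c ^ (-η) * ‖ψ (c • t)‖ := by
  rw [hψη t ht c hc, ← mul_assoc, ← Real.rpow_add hc]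
  simp

include hp hψ hφ hpos in
theorem aestronglyMeasurable_kFun : AEStronglyMeasurable (fun t => (kFun p ψ φ t : ℂ)) volume :=
  (Complex.measurable_ofReal.comp_aemeasurable
    (aemeasurable_kFun hp hψ hφ hpos)).aestronglyMeasurable

include hp hψ hφ hpos in
theorem aestronglyMeasurable_kFun_smul {c : ℝ} (hc : 0 < c) :
    AEStronglyMeasurable (fun t => (kFun p ψ φ (c • t) : ℂ)) volume :=
  (aestronglyMeasurable_kFun hp hψ hφ hpos).comp_quasiMeasurePreserving
    (quasiMeasurePreserving_smul hc.ne')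

include hd hp hγ hψ hφ hψη hφν hpos hI

/-- Homogeneity of `|ψ|` and the dilation in `L_{p'}` give `c` to the power `-η - d(1 - 1/p)`, which
is `-(1 - γ₁)` times `ν + d(1/2 - 1/p)`. -/
theorem eLpNorm_scaledMultiplier_le {s : ℝ} (hs : 0 < s) :
    eLpNorm (scaledMultiplier p ν ψ φ s) (conjExp p) volume ≤
      ENNReal.ofReal (s ^ (-(1 - gamma1 d p ν η)) * constA p ν η ψ φ) := by
  set c := s ^ (1 / (ν + d * (1 / 2 - recip p))) with hcdef
  have hc : 0 < c := Real.rpow_pos_of_pos hs _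
  have hJ := totalJ_pos hd hp hγ hψη hφν hpos hI
  have h1 := eLpNorm_of_norm_eq_dilation (q := conjExp p) (f := scaledMultiplier p ν ψ φ s)
    (g := fun t => (kFun p ψ φ t : ℂ) * ψ t) (m := c ^ (-η)) hc (by positivity)
    ((aestronglyMeasurable_kFun hp hψ hφ hpos).mul hψ) (by
      filter_upwards [ae_ne_zero hd] with t ht
      rw [scaledMultiplier, ← hcdef, norm_mul, norm_mul, norm_smul_inv hψη hc ht]
      ring)
  have h2 : c ^ (-η) * c ^ (-(d * recip (conjExp p))) = s ^ (-(1 - gamma1 d p ν η)) := by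
    rw [← Real.rpow_add hc]
    refine rpow_scale hγ hs ?_
    rw [recip_conjExp hp]
    linear_combination gamma1_mul_scale hγ
  rw [h1, h2, ENNReal.ofReal_mul (by positivity)]
  refine mul_le_mul_right (eLpNorm_kFun_mul_le hp hpos (mul_pos hγ.1 hJ).le ?_) _
  exact (lintegral_kFun_mul_one_sub hd hp hγ hψ hφ hψη hφν hpos hI).le

/-- The power of `c` is now `ν - η - d/2`, which is `γ₁` times `ν + d(1/2 - 1/p)`. -/
theorem eLpNorm_one_sub_scaled_le {s : ℝ} (hs : 0 < s) :
    eLpNorm (fun t => (((1 - kFun p ψ φ (s ^ (1 / (ν + d * (1 / 2 - recip p))) • t)) * ‖ψ t‖ /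
      Real.sqrt (s2 φ t) : ℝ) : ℂ)) 2 volume ≤
      ENNReal.ofReal (s ^ gamma1 d p ν η * constB p ν η ψ φ) := by
  set c := s ^ (1 / (ν + d * (1 / 2 - recip p))) with hcdef
  have hc : 0 < c := Real.rpow_pos_of_pos hs _
  have hJ := totalJ_pos hd hp hγ hψη hφν hpos hI
  have hγ1 : 0 < 1 - gamma1 d p ν η := sub_pos.2 hγ.2
  have hm : AEStronglyMeasurable (fun t => (((1 - kFun p ψ φ t) * ‖ψ t‖ /
      Real.sqrt (s2 φ t) : ℝ) : ℂ)) volume :=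
    (Complex.measurable_ofReal.comp_aemeasurable ((((aemeasurable_kFun hp hψ hφ hpos).const_sub
      1).mul hψ.norm.aemeasurable).div (aemeasurable_s2 hφ).sqrt)).aestronglyMeasurable
  rw [eLpNorm_of_norm_eq_dilation (m := c ^ (ν - η)) hc (by positivity) hm]
  · have h2 : c ^ (ν - η) * c ^ (-(d * recip 2)) = s ^ gamma1 d p ν η := by
      rw [← Real.rpow_add hc]
      refine rpow_scale hγ hs ?_
      rw [recip_two]
      linear_combination gamma1_mul_scale hγ
    rw [h2, ENNReal.ofReal_mul (by positivity)]
    refine mul_le_mul_right (eLpNorm_two_le_of_sq_le (by positivity)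
      (F := fun t => (1 - kFun p ψ φ t) ^ 2 * (‖ψ t‖ ^ 2 / s2 φ t))
      (Filter.Eventually.of_forall fun t => ?_)
      (lintegral_one_sub_kFun_sq hd hp hγ hψ hφ hψη hφν hpos hI).le) _
    rw [Complex.norm_real, Real.norm_eq_abs, sq_abs, div_pow, mul_pow, Real.sq_sqrt (s2_nonneg t),
      mul_div_assoc]
  · filter_upwards [ae_ne_zero hd, hpos] with t ht htp
    have hs2 : Real.sqrt (s2 φ (c • t)) = c ^ ν * Real.sqrt (s2 φ t) := by
      rw [s2_smul hφν ht hc, Real.sqrt_mul (by positivity), mul_comm 2 ν, Real.rpow_mul hc.le,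
        Real.rpow_two, Real.sqrt_sq (by positivity)]
    rw [Complex.norm_real, Complex.norm_real, norm_div, norm_mul, norm_div, norm_mul, norm_norm,
      norm_norm, hs2, hψη t ht c hc, norm_mul (c ^ ν), Real.norm_of_nonneg (by positivity :
      (0 : ℝ) ≤ c ^ ν), Real.rpow_sub hc]
    have : 0 < ‖Real.sqrt (s2 φ t)‖ := norm_pos_iff.2 (Real.sqrt_pos.2 htp.2).ne'
    have h3 : 0 < c ^ ν := by positivity
    have h4 : 0 < c ^ η := by positivity
    field_simp

/-- The deviation of the data is paid in the pair `(p', p)` and the smoothness in the pair `(2, 2)`,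
after dividing and multiplying by `√s₂`. -/
theorem eLpNorm_sub_scaledMultiplier_le {s G N : ℝ} (hs : 0 < s) (hG : 0 < G) (hN : 0 < N)
    {g y : Space d → ℂ} (hg : AEStronglyMeasurable g volume) (hy : AEStronglyMeasurable y volume)
    (hgy : eLpNorm (fun t => g t - y t) p volume ≤ ENNReal.ofReal G)
    (hgN : ∀ j, eLpNorm (fun t => φ j t * g t) 2 volume ≤
        ENNReal.ofReal ((2 * Real.pi) ^ (d / 2 : ℝ) * N)) :
    eLpNorm (fun t => ψ t * g t - scaledMultiplier p ν ψ φ s t * y t) 1 volume ≤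
      ENNReal.ofReal (s ^ (-(1 - gamma1 d p ν η)) * constA p ν η ψ φ * G +
        s ^ gamma1 d p ν η * constB p ν η ψ φ * constM d n N) := by
  set c := s ^ (1 / (ν + d * (1 / 2 - recip p))) with hcdef
  have hc : 0 < c := Real.rpow_pos_of_pos hs _
  have hJ := totalJ_pos hd hp hγ hψη hφν hpos hI
  have hA := constA_pos hγ hJ
  have hB := constB_pos hγ hJ
  have hM : 0 ≤ constM d n N := by unfold constM; positivity
  have hkm := aestronglyMeasurable_kFun_smul hp hψ hφ hpos hc
  have hκm : AEStronglyMeasurable (scaledMultiplier p ν ψ φ s) volume := hkm.mul hψ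
  have hum : AEStronglyMeasurable (fun t => (((1 - kFun p ψ φ (c • t)) * ‖ψ t‖ /
      Real.sqrt (s2 φ t) : ℝ) : ℂ)) volume := by
    have hk' : AEMeasurable (fun t => kFun p ψ φ (c • t)) volume :=
      (aemeasurable_kFun hp hψ hφ hpos).comp_quasiMeasurePreserving
        (quasiMeasurePreserving_smul hc.ne')
    exact (Complex.measurable_ofReal.comp_aemeasurable (((hk'.const_sub
      1).mul hψ.norm.aemeasurable).div (aemeasurable_s2 hφ).sqrt)).aestronglyMeasurable
  have hvm : AEStronglyMeasurable (fun t => (Real.sqrt (s2 φ t) : ℂ) * g t) volume :=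
    (Complex.measurable_ofReal.comp_aemeasurable
      (aemeasurable_s2 hφ).sqrt).aestronglyMeasurable.mul hg
  have hconj := holderConjugate_conjExp hp
  have hconj' : ENNReal.HolderTriple (conjExp p) p 1 := hconj.symm
  have e1 : eLpNorm (fun t => scaledMultiplier p ν ψ φ s t * (g t - y t)) 1 volume ≤
      ENNReal.ofReal (s ^ (-(1 - gamma1 d p ν η)) * constA p ν η ψ φ * G) := by
    rw [ENNReal.ofReal_mul (by positivity)]
    exact (eLpNorm_smul_le_mul_eLpNorm (hg.sub hy) hκm).trans (mul_le_mul'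
      (eLpNorm_scaledMultiplier_le hd hp hγ hψ hφ hψη hφν hpos hI hs) hgy)
  have e2 : eLpNorm (fun t => (1 - (kFun p ψ φ (c • t) : ℂ)) * ψ t * g t) 1 volume ≤
      ENNReal.ofReal (s ^ gamma1 d p ν η * constB p ν η ψ φ * constM d n N) := by
    rw [ENNReal.ofReal_mul (by positivity)]
    have h22 : ENNReal.HolderTriple 2 2 1 := inferInstance
    refine le_trans (le_of_eq ?_) ((eLpNorm_smul_le_mul_eLpNorm (p := 2) (q := 2) (r := 1) hvm
      hum).trans (mul_le_mul'
      (eLpNorm_one_sub_scaled_le hd hp hγ hψ hφ hψη hφν hpos hI hs)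
      (eLpNorm_sqrt_s2_mul_le hN hg hφ hgN)))
    refine eLpNorm_congr_norm_ae ?_
    filter_upwards [hpos] with t ht
    have h0 : 0 < Real.sqrt (s2 φ t) := Real.sqrt_pos.2 ht.2
    rw [Pi.smul_apply', smul_eq_mul, norm_mul, norm_mul, norm_mul, norm_mul, Complex.norm_real,
      Complex.norm_real, norm_div, norm_mul, norm_norm, ← Complex.ofReal_one, ← Complex.ofReal_sub,
      Complex.norm_real, Real.norm_of_nonneg h0.le]
    field_simp
  have heq : (fun t => ψ t * g t - scaledMultiplier p ν ψ φ s t * y t) =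
      (fun t => scaledMultiplier p ν ψ φ s t * (g t - y t)) +
        fun t => (1 - (kFun p ψ φ (c • t) : ℂ)) * ψ t * g t := by
    funext t
    simp only [Pi.add_apply, scaledMultiplier, ← hcdef]
    ring
  rw [heq, ENNReal.ofReal_add (by positivity) (by positivity)]
  refine (eLpNorm_add_le (hκm.mul (hg.sub hy)) ?_ le_rfl).trans (add_le_add e1 e2)
  exact ((aestronglyMeasurable_const.sub hkm).mul hψ).mul hg

end Upper

/-! ### The extremal function -/

section Extremal

variable {d n : ℕ} {p : ℝ≥0∞} {ν η : ℝ} {ψ : Space d → ℂ} {φ : Fin n → Space d → ℂ}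

/-- The factor of the extremal function. -/
noncomputable def extremalFactor (p : ℝ≥0∞) (ν η : ℝ) (ψ : Space d → ℂ)
    (φ : Fin n → Space d → ℂ) (c : ℝ) : ℝ :=
  constM d n 1 * c ^ (ν + d / 2) / constB p ν η ψ φ

/-- The Fourier transform of an extremal element. -/
noncomputable def extremalFun (p : ℝ≥0∞) (ν η : ℝ) (ψ : Space d → ℂ)
    (φ : Fin n → Space d → ℂ) (c : ℝ) (t : Space d) : ℂ :=
  (extremalFactor p ν η ψ φ c * extremalAbs p ψ φ (c • t) : ℝ) *
    ((starRingEnd ℂ) (ψ t) / ‖ψ t‖)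

theorem log_extremalFactor (hγ : gamma1 d p ν η ∈ Set.Ioo 0 1) (hJ : 0 < totalJ p ν η ψ φ)
    (hn : 0 < n) {c : ℝ} (hc : 0 < c) :
    Real.log (extremalFactor p ν η ψ φ c) = Real.log (constM d n 1) + (ν + d / 2) * Real.log c -
      Real.log (constB p ν η ψ φ) := by
  have h3 := constB_pos hγ hJ
  have h4 := constM_pos (d := d) hn one_pos
  rw [extremalFactor, Real.log_div (by positivity) h3.ne', Real.log_mul h4.ne' (by positivity),
    Real.log_rpow hc]

theorem extremalFactor_pos (hγ : gamma1 d p ν η ∈ Set.Ioo 0 1) (hJ : 0 < totalJ p ν η ψ φ)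
    (hn : 0 < n) {c : ℝ} (hc : 0 < c) : 0 < extremalFactor p ν η ψ φ c := by
  have h3 := constB_pos hγ hJ
  have h4 := constM_pos (d := d) hn one_pos
  unfold extremalFactor
  positivity

theorem log_scale (hγ : gamma1 d p ν η ∈ Set.Ioo 0 1) {s : ℝ} (hs : 0 < s) :
    (ν + d * (1 / 2 - recip p)) * Real.log (s ^ (1 / (ν + d * (1 / 2 - recip p)))) =
      Real.log s := by
  rw [Real.log_rpow hs, ← mul_assoc, mul_one_div_cancel (scale_ne_zero hγ), one_mul]

variable (hd : 0 < d) (hn : 0 < n) (hp : 1 ≤ p) (hγ : gamma1 d p ν η ∈ Set.Ioo 0 1)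
  (hψ : AEStronglyMeasurable ψ volume) (hφ : ∀ j, AEStronglyMeasurable (φ j) volume)
  (hψη : AbsHomogeneous ψ η) (hφν : ∀ j, AbsHomogeneous (φ j) ν)
  (hpos : ∀ᵐ t, ψ t ≠ 0 ∧ 0 < s2 φ t)
  (hI : Integrable (angIntegrand p ν η ψ φ) (sphereMeasure d))
  (hI' : ∀ i j, angI' p ν η ψ φ i = angI' p ν η ψ φ j)

include hp hψ hφ hpos in
theorem aemeasurable_extremalAbs : AEMeasurable (extremalAbs p ψ φ) volume :=
  (((aemeasurable_kFun hp hψ hφ hpos).const_sub 1).mul hψ.norm.aemeasurable).div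
    (aemeasurable_s2 hφ)

include hp in
theorem norm_extremalFun {c : ℝ} (hL : 0 < extremalFactor p ν η ψ φ c) {t : Space d}
    (ht : ψ t ≠ 0) :
    ‖extremalFun p ν η ψ φ c t‖ = extremalFactor p ν η ψ φ c * extremalAbs p ψ φ (c • t) := by
  have h1 : ‖ψ t‖ ≠ 0 := norm_ne_zero_iff.2 ht
  have h2 := extremalAbs_nonneg (ψ := ψ) (φ := φ) hp (c • t)
  rw [extremalFun, norm_mul, norm_div, RCLike.norm_conj, Complex.norm_real, Complex.norm_real,
    norm_norm, div_self h1, mul_one, Real.norm_of_nonneg (by positivity)]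

include hd hn hp hγ hψ hφ hψη hφν hpos hI hI' in
-- The factor is normalized so that the bound on each `‖φ_j g‖₂` comes out as `(2π)^{d/2}`. With
-- this factor, the optimal dilation makes the bound on `‖g‖_p` equal to `δ` and `‖ψ g‖₁` equal to
-- the minimum in `optScale_min`. The phase `ψ̄ / |ψ|` makes `ψ g` nonnegative.
theorem isExtremal_extremalFun {δ : ℝ} (hδ : 0 < δ) :
    IsExtremal p ψ φ δ (sharpConst p ν η ψ φ * δ ^ gamma1 d p ν η)
      (extremalFun p ν η ψ φ
        (optScale p ν η ψ φ δ 1 ^ (1 / (ν + d * (1 / 2 - recip p))))) := by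
  have hJ := totalJ_pos hd hp hγ hψη hφν hpos hI
  have hIp := angI_pos (p := p) hd hψη hφν hpos hI
  set s := optScale p ν η ψ φ δ 1 with hsdef
  have hs : 0 < s := optScale_pos hγ hJ hn hδ one_pos
  have hlogc := log_scale hγ hs
  set c := s ^ (1 / (ν + d * (1 / 2 - recip p))) with hcdef
  have hc : 0 < c := Real.rpow_pos_of_pos hs _
  have hlogs := log_optScale hγ hJ hn hδ one_pos
  rw [← hsdef] at hlogs
  -- From here only the logarithms of `c` and `s` are used.
  clear_value c s
  have hL := extremalFactor_pos hγ hJ hn hc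
  have hlogL := log_extremalFactor hγ hJ hn hc
  set Λ := extremalFactor p ν η ψ φ c with hΛ
  have hγ0 := hγ.1
  have hγ1 : 0 < 1 - gamma1 d p ν η := sub_pos.2 hγ.2
  have hB := constB_pos hγ hJ
  have hM := constM_pos (d := d) hn one_pos
  have hnr : (0 : ℝ) < n := by exact_mod_cast hn
  have hgm := aemeasurable_extremalAbs hp hψ hφ hpos
  have hgmC : AEStronglyMeasurable (fun t => (extremalAbs p ψ φ t : ℂ)) volume :=
    (Complex.measurable_ofReal.comp_aemeasurable hgm).aestronglyMeasurable
  have hnorm : ∀ᵐ t, ‖extremalFun p ν η ψ φ c t‖ = Λ * extremalAbs p ψ φ (c • t) := by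
    filter_upwards [hpos] with t ht
    exact norm_extremalFun hp hL ht.1
  have hnormC : ∀ t, ‖(extremalAbs p ψ φ t : ℂ)‖ = extremalAbs p ψ φ t := fun t => by
    rw [Complex.norm_real, Real.norm_of_nonneg (extremalAbs_nonneg hp t)]
  refine ⟨?_, ?_, fun j => ?_, ?_, ?_⟩
  · have h1 : AEMeasurable (fun t => extremalAbs p ψ φ (c • t)) volume :=
      hgm.comp_quasiMeasurePreserving (quasiMeasurePreserving_smul hc.ne')
    have h2 : AEMeasurable (fun t => (starRingEnd ℂ) (ψ t)) volume :=
      Complex.continuous_conj.measurable.comp_aemeasurable hψ.aemeasurable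
    exact ((Complex.measurable_ofReal.comp_aemeasurable (h1.const_mul Λ)).mul (h2.div
      (Complex.measurable_ofReal.comp_aemeasurable hψ.norm.aemeasurable))).aestronglyMeasurable
  · have h1 := eLpNorm_of_norm_eq_dilation (q := p) (f := extremalFun p ν η ψ φ c) hc hL.le hgmC
      (by
        filter_upwards [hnorm] with t ht
        rw [ht, hnormC])
    have h2 := eLpNorm_extremalAbs_le hp hpos (mul_pos hγ0 hJ).le
      (lintegral_kFun_mul_one_sub hd hp hγ hψ hφ hψη hφν hpos hI).le
    rw [h1]
    refine (mul_le_mul_right h2 _).trans (le_of_eq ?_)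
    rw [← ENNReal.ofReal_mul (by positivity)]
    congr 1
    refine Real.log_injOn_pos (Set.mem_Ioi.2 (by positivity)) (Set.mem_Ioi.2 hδ) ?_
    rw [Real.log_mul (by positivity) (by positivity), Real.log_mul (by positivity) (by positivity),
      Real.log_rpow hc, Real.log_rpow (by positivity), Real.log_div (by positivity) (by positivity),
      Real.log_mul hγ0.ne' hJ.ne', Real.log_pow]
    rw [log_constA hγ hJ] at hlogs
    have hlogB := log_constB hγ hJ
    linear_combination hlogL + hlogc + hlogs - 2 * hlogB
  · have hf : AEStronglyMeasurable (fun t => ((‖φ j t‖ * extremalAbs p ψ φ t : ℝ) : ℂ)) volume :=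
      (Complex.measurable_ofReal.comp_aemeasurable
        ((hφ j).norm.aemeasurable.mul hgm)).aestronglyMeasurable
    rw [eLpNorm_of_norm_eq_dilation (m := Λ * c ^ (-ν)) hc (by positivity) hf]
    · have h2 : eLpNorm (fun t => ((‖φ j t‖ * extremalAbs p ψ φ t : ℝ) : ℂ)) 2 volume ≤
          ENNReal.ofReal (((1 - gamma1 d p ν η) * totalJ p ν η ψ φ / n) ^ (1 / 2 : ℝ)) := by
        refine eLpNorm_two_le_of_sq_le (by positivity)
          (F := fun t => (‖φ j t‖ * extremalAbs p ψ φ t) ^ 2)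
          (Filter.Eventually.of_forall fun t => ?_)
          (lintegral_symbol_sq hd hp hγ hψ hφ hψη hφν hpos hI hI' j).le
        rw [Complex.norm_real, Real.norm_eq_abs, sq_abs]
      refine (mul_le_mul_right h2 _).trans (le_of_eq ?_)
      rw [← ENNReal.ofReal_mul (by positivity)]
      congr 1
      refine Real.log_injOn_pos (Set.mem_Ioi.2 (by positivity)) (Set.mem_Ioi.2 (by positivity)) ?_
      rw [Real.log_mul (by positivity) (by positivity), Real.log_mul (by positivity)
        (by positivity), Real.log_mul (by positivity) (by positivity),
        Real.log_rpow hc, Real.log_rpow hc, Real.log_rpow (by positivity),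
        Real.log_rpow (by positivity), Real.log_div (by positivity) (by positivity),
        Real.log_mul hγ1.ne' hJ.ne', recip_two]
      have hlogB := log_constB hγ hJ
      have hlogM := log_constM (d := d) hn one_pos
      rw [Real.log_one] at hlogM
      linear_combination hlogL + hlogM - hlogB
    · filter_upwards [hnorm, ae_ne_zero hd] with t ht ht0
      rw [norm_mul, ht, Complex.norm_real, norm_mul, norm_norm, norm_smul_inv (hφν j) hc ht0,
        Real.norm_of_nonneg (extremalAbs_nonneg hp _)]
      ring
  · filter_upwards [hpos, hnorm] with t ht hnt
    have h1 : ‖ψ t‖ ≠ 0 := norm_ne_zero_iff.2 ht.1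
    rw [norm_mul, hnt, extremalFun, ← hΛ]
    have h2 : ψ t * (starRingEnd ℂ) (ψ t) = (‖ψ t‖ : ℂ) ^ 2 := Complex.mul_conj' (ψ t)
    have h3 : (‖ψ t‖ : ℂ) ≠ 0 := by exact_mod_cast h1
    rw [mul_left_comm, ← mul_div_assoc, h2, pow_two, mul_div_cancel_right₀ _ h3]
    push_cast
    ring
  · have hf : AEStronglyMeasurable (fun t => ((‖ψ t‖ * extremalAbs p ψ φ t : ℝ) : ℂ)) volume :=
      (Complex.measurable_ofReal.comp_aemeasurable
        (hψ.norm.aemeasurable.mul hgm)).aestronglyMeasurable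
    rw [eLpNorm_of_norm_eq_dilation (g := fun t => ((‖ψ t‖ * extremalAbs p ψ φ t : ℝ) : ℂ))
      (m := Λ * c ^ (-η)) hc (by positivity) hf]
    · have h2 : eLpNorm (fun t => ((‖ψ t‖ * extremalAbs p ψ φ t : ℝ) : ℂ)) 1 volume =
          ENNReal.ofReal (totalJ p ν η ψ φ) := by
        rw [← lintegral_one_sub_kFun hd hp hγ hψ hφ hψη hφν hpos hI,
          eLpNorm_one_eq_lintegral_enorm]
        refine lintegral_congr fun t => ?_
        rw [← ofReal_norm, Complex.norm_real, Real.norm_of_nonneg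
          (mul_nonneg (norm_nonneg _) (extremalAbs_nonneg hp t)), extremalAbs]
        congr 1
        ring
      rw [h2, ← ENNReal.ofReal_mul (by positivity)]
      congr 1
      have h3 := optScale_value hp hγ hIp hJ hn hδ one_pos
      rw [← hsdef, Real.one_rpow, mul_one] at h3
      rw [← h3]
      refine Real.log_injOn_pos (Set.mem_Ioi.2 (by positivity)) (Set.mem_Ioi.2 (by positivity)) ?_
      have hr1 : recip 1 = 1 := by simp [recip]
      rw [Real.log_mul (by positivity) (by positivity), Real.log_mul (by positivity)
        (by positivity), Real.log_mul (by positivity) (by positivity),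
        Real.log_rpow hc, Real.log_rpow hc, Real.log_div (by positivity) hγ1.ne',
        Real.log_mul (by positivity) (by positivity), Real.log_mul hB.ne' hM.ne',
        Real.log_rpow hs, hr1]
      have hlogB := log_constB hγ hJ
      linear_combination hlogL + gamma1 d p ν η * hlogc - 2 * hlogB -
        Real.log c * gamma1_mul_scale hγ
    · filter_upwards [hnorm, ae_ne_zero hd] with t ht ht0
      rw [norm_mul, ht, Complex.norm_real, norm_mul, norm_norm, norm_smul_inv hψη hc ht0,
        Real.norm_of_nonneg (extremalAbs_nonneg hp _)]
      ring

end Extremal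

end NoisyFourier

/-! ### Assembly of the theorem -/

open NoisyFourier in
theorem theorem8 (d n : ℕ) (hd : 0 < d) (p : ℝ≥0∞) (hp : 1 ≤ p) (ν η δ : ℝ) (hδ : 0 < δ)
    (ψ : Space d → ℂ) (φ : Fin n → Space d → ℂ)
    (hψ : AEStronglyMeasurable ψ volume) (hφ : ∀ j, AEStronglyMeasurable (φ j) volume)
    (hψη : AbsHomogeneous ψ η) (hφν : ∀ j, AbsHomogeneous (φ j) ν)
    (hψ0 : ∀ᵐ t, ψ t ≠ 0) (hφ0 : ∀ᵐ t, ∑ j, ‖φ j t‖ ≠ 0)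
    (hγ : gamma1 d p ν η ∈ Set.Ioo 0 1)
    (hI : Integrable (angIntegrand p ν η ψ φ) (sphereMeasure d))
    (hI' : ∀ i j, angI' p ν η ψ φ i = angI' p ν η ψ φ j) :
    -- `Λ x = F⁻¹(ψ F x)` is well defined and lies in `L_∞` for all `x ∈ X_p`
    (∀ x ∈ classX p φ, IsTempered (fun ξ => ψ ξ * toFun (fourierD d x) ξ) ∧
      distNorm ∞ (multOp ψ x) < ∞) ∧
    -- the error of optimal recovery
    optimalError p ∞ ψ φ δ = ENNReal.ofReal (sharpConst p ν η ψ φ * δ ^ gamma1 d p ν η) ∧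
    -- the explicit method `y ↦ F⁻¹(k(ξ₁^{1/(ν + d(1/2 - 1/p))} ·) ψ y)` is well defined and optimal
    (∃ m : Method d p ∞,
      (∀ y, IsTempered (fun t => optMultiplier p ν η δ ψ φ t * y t) ∧
        ofFun (m y) = fourierInvD d (ofFun fun t => optMultiplier p ν η δ ψ φ t * y t)) ∧
      IsOptimal p ∞ ψ φ δ m) ∧
    -- the sharp inequality
    IsLeast {K : ℝ≥0∞ | ∀ x ∈ classX p φ, distNorm ∞ (multOp ψ x) ≤
        K * eLpNorm (toFun (fourierD d x)) p volume ^ gamma1 d p ν η *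
          (⨆ j, distNorm 2 (multOp (φ j) x)) ^ (1 - gamma1 d p ν η)}
      (ENNReal.ofReal (sharpConst p ν η ψ φ)) := by
  have hpos := ae_pos hψ0 hφ0
  have hn : 0 < n := by
    -- For `n = 0` the sum in `hφ0` would be empty, hence 0 everywhere.
    rcases Nat.eq_zero_or_pos n with rfl | h
    · obtain ⟨t, ht⟩ := hφ0.exists
      simp at ht
    · exact h
  have hJ := totalJ_pos hd hp hγ hψη hφν hpos hI
  have hIp := angI_pos (p := p) hd hψη hφν hpos hI
  have hE := sharpConst_pos hp hγ hIp hn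
  have hs := optScale_pos hγ hJ hn hδ one_pos
  have hκ : optMultiplier p ν η δ ψ φ = scaledMultiplier p ν ψ φ (optScale p ν η ψ φ δ 1) := by
    rw [← xi1_eq hp hγ hIp hJ hn hδ]
    rfl
  rw [hκ]
  refine recovery_of_bounds hp hφ hδ hE.le hγ hψ hφ0 ?_ ?_ ?_
    ⟨_, isExtremal_extremalFun hd hn hp hγ hψ hφ hψη hφν hpos hI hI' hδ⟩
  · intro y hy
    have hconj := (holderConjugate_conjExp hp).symm
    have hm : MemLp (scaledMultiplier p ν ψ φ (optScale p ν η ψ φ δ 1)) (conjExp p) volume :=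
      ⟨(aestronglyMeasurable_kFun_smul hp hψ hφ hpos (Real.rpow_pos_of_pos hs _)).mul hψ,
        (eLpNorm_scaledMultiplier_le hd hp hγ hψ hφ hψη hφν hpos hI hs).trans_lt
          ENNReal.ofReal_lt_top⟩
    exact hm.integrable_mul hy
  · intro g y hg hy hgy hgN
    refine (eLpNorm_sub_scaledMultiplier_le hd hp hγ hψ hφ hψη hφν hpos hI hs hδ one_pos hg hy hgy
      hgN).trans_eq ?_
    rw [optScale_min hγ hJ hn hδ one_pos, optScale_value hp hγ hIp hJ hn hδ one_pos,
      Real.one_rpow, mul_one]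
  · intro g G N hg hG hN hgG hgN
    -- The inequality is the recovery estimate with `y = 0`, the dilation now being adapted to `G`
    -- and `N`.
    have h := eLpNorm_sub_scaledMultiplier_le hd hp hγ hψ hφ hψη hφν hpos hI
      (optScale_pos hγ hJ hn hG hN) hG hN hg (aestronglyMeasurable_const (b := 0))
      (by simpa using hgG) hgN
    rw [optScale_min hγ hJ hn hG hN, optScale_value hp hγ hIp hJ hn hG hN] at h
    simpa using h
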